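/- **Setting.** Let $\mathbb F_q$ be a finite field with $q$ elements. A *Galois function field* is a finite Galois extension $K/\mathbb F_q(T)$ with full field of constants $\mathbb F_q$; $\mathcal O_K$ is the integral closure of $\mathbb F_q[T]$ in $K$ and $G=\mathrm{Gal}(K/\mathbb F_q(T))$. A polynomial $f\in\mathbb F_q[X]$ of degree $r\ge 1$ is a *Galois modulus of inertia $d$* if there are a Galois function field $K$ and $Q\in\mathbb F_q[T]$ of degree one, such that $R:=\mathbb F_q[X]/(f)\simeq\mathcal O_K/Q\mathcal O_K$ as $\mathbb F_q$-algebras, and all primes of $\mathcal O_K$ above $Q$ are unramified with inertia degree $d$. Fix such data; $G$ acts on $R$ through the isomorphism. Let $\mathbf c\in R$ generate a normal basis, i.e. $(\sigma(\mathbf c))_{\sigma\in G}$ is an $\mathbb F_q$-basis of $R$, and let $p\in[0,\tfrac12)$. Let $\psi$ be the distribution of $\mathbf e=\sum_{\sigma\in G}e_\sigma\sigma(\mathbf c)$ with independent $e_\sigma\in\mathbb F_q$, $\Pr[e_\sigma=0]=1-p$ and $\Pr[e_\sigma=a]=p/(q-1)$ for $a\neq0$. For $\mathbf s\in R$ let $\mathcal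 D_{\mathbf s}$ (the normal Ring-LPN distribution with secret $\mathbf s$) be the distribution of $(\mathbf a,\mathbf a\mathbf s+\mathbf e)$ with $\mathbf a$ uniform in $R$ and $\mathbf e\leftarrow\psi$ independent. **Algorithms and running time.** Algorithms are programs with finitely many registers with contents in $R$ and finitely many registers with contents in $\mathbb N$. Unit-cost instructions: load a constant; apply to registers an operation from a fixed set $\Omega$ of maps $R\times R\to R$ (two-place maps) containing the ring operations $+,-,\times$ and the action of each $\sigma\in G$; draw a uniform element of $R$; query the oracle for a fresh independent sample in $R\times R$; branch on equality of two $R$-registers; branch on a fair coin; integer addition, truncated subtraction and comparison; halt and output an $R$-register. All registers start at $0$. An algorithm *runs in time $t$* if the number of its instructions and registers is at most $t$ and, whatever the oracle distribution, it always halts within $t$ steps. The *advantage* of $\mathcal A$ (its output read as the bit $1$ if it is $1\in R$ and as $0$ otherwise) is $\frac12\bigl(\Pr[\mathcal A=1\mid \text{oracle }\mathcal D_{\mathbf s}]-\Pr[\mathcal A=1\mid\text{uniform oracle on }R\times R]\bigr)$, where $\mathbf s\in R$ is uniform and fixed during the run. **Theorem.** For the normal Ring-LPN distribution, the decision and search versions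 of Ring-LPN are equivalent. Precisely, there is an absolute constant $C>0$ such that for all data as above (all $q,K,Q,f,r,d,\mathbf c,p$, the isomorphism, and all $\Omega$): 1. (Decision to search.) If some algorithm runs in time $t$ and has advantage at least $\varepsilon>0$, then there is an algorithm running in time at most $C\cdot\frac{r^4}{d^3}\cdot\frac1{\varepsilon^2}\cdot q^d\cdot t$ which, for every $\mathbf s\in R$, given the oracle $\mathcal D_{\mathbf s}$, outputs $\mathbf s$ with probability at least $1-2^{-r}$. 2. (Search to decision.) If some algorithm runs in time $t$ and, for uniformly random $\mathbf s\in R$ and oracle $\mathcal D_{\mathbf s}$, outputs $\mathbf s$ with probability at least $\eta$, then there is an algorithm running in time at most $C(r+t)$ whose advantage is at least $\frac{\eta}{2}\bigl(1-p-\frac1q\bigr)$ (note that $1-p-\frac1q>0$). -/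

import Mathlib

open Polynomial

universe u v

noncomputable section

namespace RingLPN

/-! ### Probability distributions -/

/-- The uniform distribution on a finite nonempty type. -/
def unif (α : Type*) [Finite α] [Nonempty α] : PMF α :=
  letI := Fintype.ofFinite α
  PMF.uniformOfFintype α

open Classical in
/-- The `q`-ary Bernoulli distribution of parameter `p` on a field with `q` elements: it takes
the value `0` with probability `1 - p` and each nonzero value with probability `p / (q - 1)`. -/
def qBernoulli (F : Type u) [Field F] [Fintype F] (p : ℝ) (hp0 : 0 ≤ p) (hp : p < 1 / 2) :
    PMF F :=
  PMF.ofFintype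
    (fun a => if a = 0 then ENNReal.ofReal (1 - p)
      else ENNReal.ofReal (p / ((Fintype.card F : ℝ) - 1))) (by
    have hq : (1 : ℝ) < Fintype.card F := by exact_mod_cast Fintype.one_lt_card
    have h1 : (0 : ℝ) ≤ 1 - p := by linarith
    have h2 : (0 : ℝ) ≤ p / ((Fintype.card F : ℝ) - 1) := div_nonneg hp0 (by linarith)
    have key : ∀ a : F, (if a = 0 then ENNReal.ofReal (1 - p)
        else ENNReal.ofReal (p / ((Fintype.card F : ℝ) - 1))) =
        ENNReal.ofReal (if a = 0 then 1 - p else p / ((Fintype.card F : ℝ) - 1)) := by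
      intro a; split_ifs <;> rfl
    simp_rw [key]
    rw [← ENNReal.ofReal_sum_of_nonneg (by intro a _; split_ifs <;> assumption)]
    rw [← Finset.add_sum_erase _ _ (Finset.mem_univ (0 : F))]
    rw [Finset.sum_congr rfl (g := fun _ => p / ((Fintype.card F : ℝ) - 1))
      (by intro a ha; simp [Finset.ne_of_mem_erase ha])]
    rw [Finset.sum_const, Finset.card_erase_of_mem (Finset.mem_univ _), Finset.card_univ,
      nsmul_eq_mul, Nat.cast_sub Fintype.card_pos, Nat.cast_one,
      mul_div_cancel₀ _ (by linarith)]
    simp)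

/-- The joint distribution of a family of independent random variables indexed by a finite type
`G`, each distributed according to `μ`. -/
def iidFamily (G : Type*) [Finite G] {F : Type*} [Fintype F] (μ : PMF F) : PMF (G → F) :=
  letI := Fintype.ofFinite G
  letI := Classical.decEq G
  PMF.ofFintype (fun e => ∏ g, μ (e g)) (by
    have h : ∑ a, μ a = 1 := by simpa [tsum_fintype] using μ.tsum_coe
    rw [← Fintype.piFinset_univ, ← Finset.prod_univ_sum]
    simp [h])

/-- The distribution of a sample `(a, a s + e)` with `a` uniform in the finite ring `R` and
`e` drawn from the error distribution `ψ`, independently of `a`. -/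
def sampleDist {R : Type u} [CommRing R] [Finite R] (ψ : PMF R) (s : R) : PMF (R × R) :=
  (unif R).bind fun a => ψ.map fun e => (a, a * s + e)

/-! ### Probabilistic oracle machines with a step count

A machine over a finite ring `R` has finitely many ring registers (contents in `R`), finitely many
integer registers (contents in `ℕ`) and a finite program. `Ω` is the set of operations on `R` that
are available at unit cost; it is a parameter of the model. -/

/-- Instructions; `ι` indexes the ring registers, `κ` the integer registers and `σ` the
addresses (lines) of the program. -/
inductive Instr (R : Type u) (Ω : Set (R → R → R)) (ι κ σ : Type) : Type u
  /-- `rᵢ := x`, then go to `next` -/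
  | const (i : ι) (x : R) (next : σ)
  /-- `rᵢ := φ rⱼ rₖ` for an available operation `φ`, then go to `next` -/
  | op (φ : Ω) (i j k : ι) (next : σ)
  /-- `rᵢ :=` a fresh uniform element of `R`, then go to `next` -/
  | rand (i : ι) (next : σ)
  /-- query the oracle for a fresh sample `(a, b)`; `rᵢ := a`, `rⱼ := b`, then go to `next` -/
  | sample (i j : ι) (next : σ)
  /-- go to `yes` if `rᵢ = rⱼ`, else to `no` -/
  | test (i j : ι) (yes no : σ)
  /-- toss a fair coin and branch accordingly -/
  | coin (heads tails : σ)
  /-- `nₖ := m`, then go to `next` -/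
  | natConst (k : κ) (m : ℕ) (next : σ)
  /-- `nₖ := nₗ + nₘ`, then go to `next` -/
  | natAdd (k l m : κ) (next : σ)
  /-- `nₖ := nₗ - nₘ` (truncated at `0`), then go to `next` -/
  | natSub (k l m : κ) (next : σ)
  /-- go to `yes` if `nₖ < nₗ`, else to `no` -/
  | natTest (k l : κ) (yes no : σ)
  /-- stop and output the content of `rᵢ` -/
  | halt (i : ι)

/-- A probabilistic oracle machine over `R` with unit-cost operations `Ω`. -/
structure Machine (R : Type u) (Ω : Set (R → R → R)) where
  /-- ring registers -/
  ι : Type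
  /-- integer registers -/
  κ : Type
  /-- program addresses -/
  σ : Type
  [fintypeι : Fintype ι]
  [fintypeκ : Fintype κ]
  [fintypeσ : Fintype σ]
  [decEqι : DecidableEq ι]
  [decEqκ : DecidableEq κ]
  /-- the initial address -/
  start : σ
  /-- the program -/
  code : σ → Instr R Ω ι κ σ

attribute [instance] Machine.fintypeι Machine.fintypeκ Machine.fintypeσ Machine.decEqι
  Machine.decEqκ

namespace Machine

variable {R : Type u} [CommRing R] [Finite R] {Ω : Set (R → R → R)}

/-- A configuration: current address and contents of the registers. -/
structure Config (M : Machine R Ω) where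
  pos : M.σ
  reg : M.ι → R
  cnt : M.κ → ℕ

/-- The initial configuration; all registers hold `0`. -/
def init (M : Machine R Ω) : M.Config := ⟨M.start, fun _ => 0, fun _ => 0⟩

open Classical in
/-- One step of the machine, where each oracle query is answered by an independent sample from
`D`. A halting configuration is left unchanged. -/
def step (M : Machine R Ω) (D : PMF (R × R)) (c : M.Config) : PMF M.Config :=
  match M.code c.pos with
  | .const i x next => PMF.pure ⟨next, Function.update c.reg i x, c.cnt⟩
  | .op φ i j k next =>
      PMF.pure ⟨next, Function.update c.reg i (φ.1 (c.reg j) (c.reg k)), c.cnt⟩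
  | .rand i next => (unif R).map fun x => ⟨next, Function.update c.reg i x, c.cnt⟩
  | .sample i j next =>
      D.map fun x => ⟨next, Function.update (Function.update c.reg i x.1) j x.2, c.cnt⟩
  | .test i j yes no => PMF.pure ⟨if c.reg i = c.reg j then yes else no, c.reg, c.cnt⟩
  | .coin heads tails =>
      (unif Bool).map fun b => ⟨if b = true then heads else tails, c.reg, c.cnt⟩
  | .natConst k m next => PMF.pure ⟨next, c.reg, Function.update c.cnt k m⟩
  | .natAdd k l m next => PMF.pure ⟨next, c.reg, Function.update c.cnt k (c.cnt l + c.cnt m)⟩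
  | .natSub k l m next => PMF.pure ⟨next, c.reg, Function.update c.cnt k (c.cnt l - c.cnt m)⟩
  | .natTest k l yes no => PMF.pure ⟨if c.cnt k < c.cnt l then yes else no, c.reg, c.cnt⟩
  | .halt _ => PMF.pure c

/-- The configuration after `n` steps. -/
def exec (M : Machine R Ω) (D : PMF (R × R)) : ℕ → M.Config → PMF M.Config
  | 0, c => PMF.pure c
  | n + 1, c => (M.step D c).bind (M.exec D n)

/-- The content of the output register of a halting configuration (and `none` for a configuration
that is not halting). -/
def result (M : Machine R Ω) (c : M.Config) : Option R :=
  match M.code c.pos with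
  | .halt i => some (c.reg i)
  | _ => none

/-- The size of the description: number of instructions and of registers. -/
def size (M : Machine R Ω) : ℕ := Fintype.card M.σ + Fintype.card M.ι + Fintype.card M.κ

/-- `M` runs in time `t`: its description has size at most `t`, and for every oracle
distribution every execution halts within `t` steps. -/
def RunsIn (M : Machine R Ω) (t : ℕ) : Prop :=
  M.size ≤ t ∧ ∀ (D : PMF (R × R)), ∀ c ∈ (M.exec D t M.init).support, (M.result c).isSome

/-- The probability that `M`, with oracle `D`, has stopped with output `x` after at most `t`
steps. -/
def probOutput (M : Machine R Ω) (D : PMF (R × R)) (t : ℕ) (x : R) : ℝ :=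
  (((M.exec D t M.init).map M.result) (some x)).toReal

/-- The expectation of `probOutput` over a uniformly random secret `s`, which stays fixed during
the execution; the oracle gives samples `(a, a s + e)` and the output `x s` may depend on `s`. -/
def avgProbOutput (M : Machine R Ω) (ψ : PMF R) (t : ℕ) (x : R → R) : ℝ :=
  letI := Fintype.ofFinite R
  (∑ s : R, M.probOutput (sampleDist ψ s) t (x s)) / (Fintype.card R : ℝ)

/-- The advantage of `M`, run for `t` steps, in distinguishing the uniform distribution on `R × R`
from the samples with uniform secret and error distribution `ψ`. The output `1 : R` stands for the
bit `1`, and all other outputs for the bit `0`. -/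
def advantage (M : Machine R Ω) (ψ : PMF R) (t : ℕ) : ℝ :=
  1 / 2 * (M.avgProbOutput ψ t (fun _ => 1) - M.probOutput (unif (R × R)) t 1)

end Machine

/-! ### Galois moduli and the normal Ring-LPN noise -/

section Galois

variable (F : Type u) [Field F] (K : Type v) [Field K] [Algebra F K] [Algebra F[X] K]
  [Algebra (RatFunc F) K] [IsScalarTower F F[X] K] [IsScalarTower F[X] (RatFunc F) K]

/-- The ring of integers of `K`: the integral closure of `F[T]` in `K`. -/
abbrev OK : Type v := FunctionField.ringOfIntegers F K

/-- The ideal `Q 𝓞_K`. -/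
abbrev modIdeal (Q : F[X]) : Ideal (OK F K) := Ideal.span {algebraMap F[X] (OK F K) Q}

/-- The `F`-algebra structure of `𝓞_K`. -/
instance : Algebra F (OK F K) :=
  inferInstanceAs (Algebra F (integralClosure F[X] K))

variable {F K}

/-- The action of the Galois group on the ring of integers. -/
def intAct (g : Gal(K/RatFunc F)) : OK F K →+* OK F K :=
  (((g.restrictScalars F[X]).mapIntegralClosure :
    integralClosure F[X] K ≃ₐ[F[X]] integralClosure F[X] K) :
    integralClosure F[X] K →+* integralClosure F[X] K)

theorem modIdeal_le_comap (Q : F[X]) (g : Gal(K/RatFunc F)) :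
    modIdeal F K Q ≤ (modIdeal F K Q).comap (intAct g) := by
  rw [Ideal.span_singleton_le_iff_mem, Ideal.mem_comap]
  have : intAct g (algebraMap F[X] (OK F K) Q) = algebraMap F[X] (OK F K) Q :=
    AlgEquiv.commutes ((g.restrictScalars F[X]).mapIntegralClosure :
      integralClosure F[X] K ≃ₐ[F[X]] integralClosure F[X] K) Q
  rw [this]
  exact Ideal.mem_span_singleton_self _

/-- The induced action of the Galois group on `𝓞_K / Q 𝓞_K`. -/
def residueAct (Q : F[X]) (g : Gal(K/RatFunc F)) :
    OK F K ⧸ modIdeal F K Q →+* OK F K ⧸ modIdeal F K Q :=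
  Ideal.quotientMap _ (intAct g) (modIdeal_le_comap Q g)

variable (K) in
/-- The data exhibiting `f ∈ F[X]` as a Galois modulus of inertia `d`, with `K / F(T)` as the
related Galois function field. (That `K / F(T)` is finite and Galois is expressed by type class
hypotheses.) -/
structure GaloisModulus (f : F[X]) (d : ℕ) where
  /-- `F` is the full field of constants of `K` -/
  constants : ∀ x : K, IsAlgebraic F x → x ∈ Set.range (algebraMap F K)
  /-- the modulus in `F[T]` -/
  Q : F[X]
  natDegree_Q : Q.natDegree = 1
  /-- the isomorphism `F[X]/(f) ≃ 𝓞_K / Q 𝓞_K` of `F`-algebras -/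
  iso : AdjoinRoot f ≃ₐ[F] OK F K ⧸ modIdeal F K Q
  /-- no prime of `𝓞_K` above `Q` ramifies -/
  unramified : ∀ P ∈ (Ideal.span {Q}).primesOver (OK F K), P.ramificationIdx F[X] = 1
  /-- all primes of `𝓞_K` above `Q` have inertia degree `d` -/
  inertia : ∀ P ∈ (Ideal.span {Q}).primesOver (OK F K), P.inertiaDeg F[X] = d

/-- `F[X]/(f)` is finite when `F` is finite and `f` has positive degree. -/
instance finite_adjoinRoot [Finite F] (f : F[X]) [hf : Fact (0 < f.natDegree)] :
    Finite (AdjoinRoot f) := by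
  have h0 : f ≠ 0 := by
    rintro rfl
    simpa using hf.out
  have : Module.Finite F (AdjoinRoot f) := (AdjoinRoot.powerBasis h0).finite
  exact Module.finite_of_finite F

namespace GaloisModulus

variable {f : F[X]} {d : ℕ} (M : GaloisModulus K f d)

/-- The action of the Galois group on `F[X]/(f)`, transported from `𝓞_K / Q 𝓞_K`. -/
def act (g : Gal(K/RatFunc F)) (x : AdjoinRoot f) : AdjoinRoot f :=
  M.iso.symm (residueAct M.Q g (M.iso x))

/-- `c` generates a normal basis: `(σ(c))_σ` is an `F`-basis of `F[X]/(f)`, where `σ` runs over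
the Galois group. -/
def IsNormal (c : AdjoinRoot f) : Prop :=
  LinearIndependent F (fun g : Gal(K/RatFunc F) => M.act g c) ∧
    Submodule.span F (Set.range fun g : Gal(K/RatFunc F) => M.act g c) = ⊤

/-- The noise `∑_σ e_σ σ(c)` with independent `q`-ary Bernoulli coefficients `e_σ` of
parameter `p`. -/
def noise [Fintype F] [FunctionField F K] (c : AdjoinRoot f) (p : ℝ) (hp0 : 0 ≤ p)
    (hp : p < 1 / 2) : PMF (AdjoinRoot f) :=
  letI := Fintype.ofFinite Gal(K/RatFunc F)
  (iidFamily Gal(K/RatFunc F) (qBernoulli F p hp0 hp)).map fun e => ∑ g, e g • M.act g c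

/-- The ring operations of `F[X]/(f)` and the (unary) Galois operations. -/
def basicOps : Set (AdjoinRoot f → AdjoinRoot f → AdjoinRoot f) :=
  {fun x y => x + y, fun x y => x - y, fun x y => x * y} ∪
    Set.range fun (g : Gal(K/RatFunc F)) x _ => M.act g x

end GaloisModulus

end Galois

end RingLPN

end

noncomputable section

namespace RingLPN

theorem pmf_bind_congr {α β : Type*} (p : PMF α) {f g : α → PMF β}
    (h : ∀ a ∈ p.support, f a = g a) : p.bind f = p.bind g := by
  ext b
  simp only [PMF.bind_apply]
  refine tsum_congr fun a => ?_
  by_cases ha : p a = 0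
  · simp [ha]
  · rw [h a ha]

/-! ### Program fragments -/

/-- The memory of a machine: ring registers and integer registers. -/
@[ext]
structure Mem (R : Type u) (ι κ : Type) : Type u where
  reg : ι → R
  cnt : κ → ℕ

/-- The part of the memory seen through injections of the register names. -/
def Mem.restrict {R : Type u} {ι κ ι' κ' : Type} (f : ι' → ι) (g : κ' → κ) (m : Mem R ι κ) :
    Mem R ι' κ' := ⟨m.reg ∘ f, m.cnt ∘ g⟩

/-- The memory with content `x` in the ring register `i`. -/
def Mem.setReg {R : Type u} {ι κ : Type} [DecidableEq ι] (m : Mem R ι κ) (i : ι) (x : R) :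
    Mem R ι κ := ⟨Function.update m.reg i x, m.cnt⟩

/-- The memory with content `x` in the integer register `k`. -/
def Mem.setCnt {R : Type u} {ι κ : Type} [DecidableEq κ] (m : Mem R ι κ) (k : κ) (x : ℕ) :
    Mem R ι κ := ⟨m.reg, Function.update m.cnt k x⟩

/-- The memory in which all registers hold `0`. -/
def Mem.zero (R : Type u) [CommRing R] (ι κ : Type) : Mem R ι κ := ⟨fun _ => 0, fun _ => 0⟩

/-- The non-halting instructions, with addresses in `τ`. -/
inductive Cmd (R : Type u) (Ω : Set (R → R → R)) (ι κ τ : Type) : Type u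
  | const (i : ι) (x : R) (next : τ)
  | op (φ : Ω) (i j k : ι) (next : τ)
  | rand (i : ι) (next : τ)
  | sample (i j : ι) (next : τ)
  | test (i j : ι) (yes no : τ)
  | coin (heads tails : τ)
  | natConst (k : κ) (m : ℕ) (next : τ)
  | natAdd (k l m : κ) (next : τ)
  | natSub (k l m : κ) (next : τ)
  | natTest (k l : κ) (yes no : τ)

section

variable {R : Type u} {Ω : Set (R → R → R)} {ι κ : Type}

namespace Cmd

variable {τ τ' : Type}

/-- Change of addresses. -/
def map (f : τ → τ') : Cmd R Ω ι κ τ → Cmd R Ω ι κ τ'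
  | const i x n => const i x (f n)
  | op φ i j k n => op φ i j k (f n)
  | rand i n => rand i (f n)
  | sample i j n => sample i j (f n)
  | test i j y n => test i j (f y) (f n)
  | coin y n => coin (f y) (f n)
  | natConst k m n => natConst k m (f n)
  | natAdd k l m n => natAdd k l m (f n)
  | natSub k l m n => natSub k l m (f n)
  | natTest k l y n => natTest k l (f y) (f n)

/-- Change of register names. -/
def rename {ι' κ' : Type} (f : ι → ι') (g : κ → κ') : Cmd R Ω ι κ τ → Cmd R Ω ι' κ' τ
  | const i x n => const (f i) x n
  | op φ i j k n => op φ (f i) (f j) (f k) n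
  | rand i n => rand (f i) n
  | sample i j n => sample (f i) (f j) n
  | test i j y n => test (f i) (f j) y n
  | coin y n => coin y n
  | natConst k m n => natConst (g k) m n
  | natAdd k l m n => natAdd (g k) (g l) (g m) n
  | natSub k l m n => natSub (g k) (g l) (g m) n
  | natTest k l y n => natTest (g k) (g l) y n

/-- The instruction of the machine model. -/
def toInstr : Cmd R Ω ι κ τ → Instr R Ω ι κ τ
  | const i x n => .const i x n
  | op φ i j k n => .op φ i j k n
  | rand i n => .rand i n
  | sample i j n => .sample i j n
  | test i j y n => .test i j y n
  | coin y n => .coin y n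
  | natConst k m n => .natConst k m n
  | natAdd k l m n => .natAdd k l m n
  | natSub k l m n => .natSub k l m n
  | natTest k l y n => .natTest k l y n

variable [CommRing R] [Finite R] [DecidableEq ι] [DecidableEq κ]

open Classical in
/-- The distribution of the next address and the memory after the execution of a command. -/
def sem (D : PMF (R × R)) (m : Mem R ι κ) : Cmd R Ω ι κ τ → PMF (τ × Mem R ι κ)
  | const i x n => PMF.pure (n, m.setReg i x)
  | op φ i j k n => PMF.pure (n, m.setReg i (φ.1 (m.reg j) (m.reg k)))
  | rand i n => (unif R).map fun x => (n, m.setReg i x)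
  | sample i j n => D.map fun x => (n, (m.setReg i x.1).setReg j x.2)
  | test i j y n => PMF.pure (if m.reg i = m.reg j then y else n, m)
  | coin y n => (unif Bool).map fun b => (if b = true then y else n, m)
  | natConst k a n => PMF.pure (n, m.setCnt k a)
  | natAdd k l j n => PMF.pure (n, m.setCnt k (m.cnt l + m.cnt j))
  | natSub k l j n => PMF.pure (n, m.setCnt k (m.cnt l - m.cnt j))
  | natTest k l y n => PMF.pure (if m.cnt k < m.cnt l then y else n, m)

theorem sem_map (D : PMF (R × R)) (m : Mem R ι κ) (f : τ → τ') (c : Cmd R Ω ι κ τ) :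
    (c.map f).sem D m = (c.sem D m).map (Prod.map f id) := by
  cases c <;> simp [map, sem, PMF.pure_map, PMF.map_comp, Function.comp_def, Prod.map, apply_ite f]

theorem sem_rename {ι' κ' : Type} [DecidableEq ι'] [DecidableEq κ'] (D : PMF (R × R))
    (f : ι → ι') (g : κ → κ') (hf : Function.Injective f) (hg : Function.Injective g)
    (m : Mem R ι' κ') (c : Cmd R Ω ι κ τ) :
    ((c.rename f g).sem D m).map (Prod.map id (Mem.restrict f g)) =
      c.sem D (m.restrict f g) := by
  have h1 : ∀ i x (m : Mem R ι' κ'),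
      (m.setReg (f i) x).restrict f g = (m.restrict f g).setReg i x := by
    intro i x m
    simp only [Mem.setReg, Mem.restrict, Function.update_comp_eq_of_injective _ hf]
  have h2 : ∀ i x (m : Mem R ι' κ'),
      (m.setCnt (g i) x).restrict f g = (m.restrict f g).setCnt i x := by
    intro i x m
    simp only [Mem.setCnt, Mem.restrict, Function.update_comp_eq_of_injective _ hg]
  cases c <;> simp [rename, sem, PMF.pure_map, PMF.map_comp, Function.comp_def, Prod.map, h1, h2]
    <;> rfl

end Cmd

/-- A piece of program with exits in `ε`. -/
structure Frag (R : Type u) (Ω : Set (R → R → R)) (ι κ ε : Type) : Type (max u 1) where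
  σ : Type
  [fintypeσ : Fintype σ]
  start : σ
  code : σ → Cmd R Ω ι κ (σ ⊕ ε)

attribute [instance] Frag.fintypeσ

namespace Frag

variable {ε ε' N : Type} [CommRing R] [Finite R] [DecidableEq ι] [DecidableEq κ]

/-- `P.Ev D n x m μ`: started at `x` with memory `m` and oracle `D`, the fragment exits within `n`
steps, and `μ` is the distribution of the exit and the memory. -/
inductive Ev (P : Frag R Ω ι κ ε) (D : PMF (R × R)) :
    ℕ → P.σ ⊕ ε → Mem R ι κ → PMF (ε × Mem R ι κ) → Prop
  | exit (n : ℕ) (e : ε) (m : Mem R ι κ) : Ev P D n (.inr e) m (PMF.pure (e, m))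
  | step (n : ℕ) (s : P.σ) (m : Mem R ι κ) (α : Type u) (p : PMF α)
      (g : α → (P.σ ⊕ ε) × Mem R ι κ) (ν : α → PMF (ε × Mem R ι κ))
      (hp : (P.code s).sem D m = p.map g)
      (h : ∀ a ∈ p.support, Ev P D n (g a).1 (g a).2 (ν a)) :
      Ev P D (n + 1) (.inl s) m (p.bind ν)

theorem Ev.mono {P : Frag R Ω ι κ ε} {D : PMF (R × R)} {n n' : ℕ} {x : P.σ ⊕ ε} {m : Mem R ι κ}
    {μ : PMF (ε × Mem R ι κ)} (h : P.Ev D n x m μ) (hn : n ≤ n') : P.Ev D n' x m μ := by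
  induction h generalizing n' with
  | exit n e m => exact .exit _ _ _
  | step n s m α p g ν hp h ih =>
    obtain ⟨k, rfl⟩ : ∃ k, n' = k + 1 := ⟨n' - 1, by omega⟩
    exact .step _ _ _ α p g _ hp fun x hx => ih x hx (by omega)

/-- Executions of a fragment `P` inside a larger fragment `P'`. -/
theorem Ev.embed {P : Frag R Ω ι κ ε} {P' : Frag R Ω ι κ ε'} (w : P.σ ⊕ ε → P'.σ ⊕ ε')
    (φ : P.σ → P'.σ) (hφ : ∀ s, w (.inl s) = .inl (φ s))
    (hcode : ∀ s, P'.code (φ s) = (P.code s).map w) {D : PMF (R × R)}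
    {k j : ℕ} {x : P.σ ⊕ ε} {m : Mem R ι κ} {μ : PMF (ε × Mem R ι κ)}
    (h : P.Ev D k x m μ) (ν : ε × Mem R ι κ → PMF (ε' × Mem R ι κ))
    (hν : ∀ y ∈ μ.support, P'.Ev D j (w (.inr y.1)) y.2 (ν y)) :
    P'.Ev D (k + j) (w x) m (μ.bind ν) := by
  induction h with
  | exit k e m =>
    rw [PMF.pure_bind]
    exact (hν (e, m) (by simp)).mono (by omega)
  | step k s m α p g ν' hp h ih =>
    rw [PMF.bind_bind, Nat.add_right_comm, hφ]
    refine Ev.step _ _ m α p (fun a => (w (g a).1, (g a).2)) _ ?_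
      (fun a ha => ih a ha fun y hy => hν y ?_)
    · rw [hcode, Cmd.sem_map, hp, PMF.map_comp]
      rfl
    · rw [PMF.mem_support_bind_iff]
      exact ⟨a, ha, hy⟩

/-- Replaces the exits of a fragment. -/
def mapExit (f : ε → ε') (P : Frag R Ω ι κ ε) : Frag R Ω ι κ ε' where
  σ := P.σ
  start := P.start
  code s := (P.code s).map (Sum.map id f)

theorem Ev.mapExit (f : ε → ε') {P : Frag R Ω ι κ ε} {D : PMF (R × R)} {n : ℕ} {x : P.σ ⊕ ε}
    {m : Mem R ι κ} {μ : PMF (ε × Mem R ι κ)} (h : P.Ev D n x m μ) :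
    (P.mapExit f).Ev D n (x.map id f) m (μ.map (Prod.map f id)) :=
  Ev.embed (P := P) (P' := P.mapExit f) (j := 0) (Sum.map id f) id (fun _ => rfl) (fun _ => rfl) h _
    fun y _ => .exit _ (f y.1) y.2

/-- Sequential composition, where the exit of the first fragment selects the second one. -/
def append [Fintype ε] (P : Frag R Ω ι κ ε) (Q : ε → Frag R Ω ι κ ε') : Frag R Ω ι κ ε' where
  σ := P.σ ⊕ Σ e, (Q e).σ
  start := .inl P.start
  code := Sum.elim
    (fun s => (P.code s).map (Sum.elim (.inl ∘ .inl) fun e => .inl (.inr ⟨e, (Q e).start⟩)))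
    (fun s => ((Q s.1).code s.2).map (Sum.map (fun t => .inr ⟨s.1, t⟩) id))

theorem Ev.append [Fintype ε] {P : Frag R Ω ι κ ε} {Q : ε → Frag R Ω ι κ ε'} {D : PMF (R × R)}
    {k j : ℕ} {m : Mem R ι κ} {μ : PMF (ε × Mem R ι κ)} (h : P.Ev D k (.inl P.start) m μ)
    (ν : ε × Mem R ι κ → PMF (ε' × Mem R ι κ))
    (hν : ∀ y ∈ μ.support, (Q y.1).Ev D j (.inl (Q y.1).start) y.2 (ν y)) :
    (P.append Q).Ev D (k + j) (.inl (P.append Q).start) m (μ.bind ν) := by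
  refine Ev.embed (P' := P.append Q)
    (Sum.elim (.inl ∘ .inl) fun e => .inl (.inr ⟨e, (Q e).start⟩)) .inl (fun _ => rfl)
    (fun _ => rfl) h _ fun y hy => ?_
  have := Ev.embed (P' := P.append Q) (j := 0) (Sum.map (fun t => .inr ⟨y.1, t⟩) id)
    (fun t => .inr ⟨y.1, t⟩) (fun _ => rfl) (fun _ => rfl) (hν y hy) _ fun z _ => .exit _ z.1 z.2
  rwa [PMF.bind_pure] at this

/-- Links a family of fragments that may jump to each other. -/
def link [Fintype N] (body : N → Frag R Ω ι κ (N ⊕ ε)) (n : N) : Frag R Ω ι κ ε where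
  σ := Σ n, (body n).σ
  start := ⟨n, (body n).start⟩
  code s := ((body s.1).code s.2).map (Sum.elim (fun t => .inl ⟨s.1, t⟩)
    (Sum.map (fun n => ⟨n, (body n).start⟩) id))

theorem Ev.link [Fintype N] {body : N → Frag R Ω ι κ (N ⊕ ε)} {n₀ n : N} {D : PMF (R × R)}
    {k j : ℕ} {m : Mem R ι κ} {μ : PMF ((N ⊕ ε) × Mem R ι κ)}
    (h : (body n).Ev D k (.inl (body n).start) m μ) (ν : (N ⊕ ε) × Mem R ι κ → PMF (ε × Mem R ι κ))
    (hν : ∀ y ∈ μ.support, (Frag.link body n₀).Ev D j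
      (y.1.map (fun n => ⟨n, (body n).start⟩) id) y.2 (ν y)) :
    (Frag.link body n₀).Ev D (k + j) (.inl ⟨n, (body n).start⟩) m (μ.bind ν) :=
  Ev.embed (P' := Frag.link body n₀) (Sum.elim (fun t => .inl ⟨n, t⟩)
    (Sum.map (fun n => ⟨n, (body n).start⟩) id)) (fun t => ⟨n, t⟩) (fun _ => rfl)
    (fun _ => rfl) h ν hν

end Frag

/-! ### Procedures -/

/-- A fragment together with a bound `cost` for its number of instructions and of steps and a
description of its effect on the part of the memory that is visible through `view`. -/
structure Proc [CommRing R] [Finite R] [DecidableEq ι] [DecidableEq κ] (Ω : Set (R → R → R))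
    {V : Type u} (view : Mem R ι κ → V) (ε : Type) where
  frag : Frag R Ω ι κ ε
  cost : ℕ
  sem : PMF (R × R) → V → PMF (ε × V)
  card_le : Fintype.card frag.σ ≤ cost
  ev : ∀ D m, ∃ μ, frag.Ev D cost (.inl frag.start) m μ ∧
    μ.map (Prod.map id view) = sem D (view m)

namespace Proc

variable [CommRing R] [Finite R] [DecidableEq ι] [DecidableEq κ] {V V' : Type u}
  {view : Mem R ι κ → V} {ε ε' N : Type}

/-- Replaces the exits of a procedure. -/
def mapExit (f : ε → ε') (P : Proc Ω view ε) : Proc Ω view ε' where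
  frag := P.frag.mapExit f
  cost := P.cost
  sem D v := (P.sem D v).map (Prod.map f id)
  card_le := P.card_le
  ev D m := by
    obtain ⟨μ, h1, h2⟩ := P.ev D m
    refine ⟨_, h1.mapExit f, ?_⟩
    rw [← h2, PMF.map_comp, PMF.map_comp]
    rfl

/-- Sees less of the memory. -/
def coarsen (P : Proc Ω view ε) (π : V → V') (sem : PMF (R × R) → V' → PMF (ε × V'))
    (h : ∀ D v, (P.sem D v).map (Prod.map id π) = sem D (π v)) : Proc Ω (π ∘ view) ε where
  frag := P.frag
  cost := P.cost
  sem := sem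
  card_le := P.card_le
  ev D m := by
    obtain ⟨μ, h1, h2⟩ := P.ev D m
    refine ⟨μ, h1, ?_⟩
    rw [Function.comp_apply, ← h, ← h2, PMF.map_comp]
    rfl

/-- A single command as a procedure, on all of the memory. -/
def cmd (c : Cmd R Ω ι κ ε) : Proc Ω (id : Mem R ι κ → Mem R ι κ) ε where
  frag := { σ := Unit, start := (), code := fun _ => c.map .inr }
  cost := 1
  sem D m := c.sem D m
  card_le := by simp
  ev D m := by
    refine ⟨c.sem D m, ?_, PMF.map_id _⟩
    rw [← PMF.bind_pure (c.sem D m)]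
    refine Frag.Ev.step (P := { σ := Unit, start := (), code := fun _ => c.map .inr }) 0 () m _
      (c.sem D m) (fun x => (.inr x.1, x.2)) _ ?_ (fun x _ => .exit _ _ _)
    exact Cmd.sem_map D m _ c

/-- Sequential composition: the exit of the first procedure selects the second one. -/
def bind [Fintype ε] (P : Proc Ω view ε) (Q : ε → Proc Ω view ε') : Proc Ω view ε' where
  frag := P.frag.append fun e => (Q e).frag
  cost := P.cost + ∑ e, (Q e).cost
  sem D v := (P.sem D v).bind fun x => (Q x.1).sem D x.2
  card_le := by
    have : Fintype.card (P.frag.append fun e => (Q e).frag).σ =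
        Fintype.card P.frag.σ + ∑ e, Fintype.card (Q e).frag.σ := by
      simp only [← Fintype.card_sigma, ← Fintype.card_sum]
      exact Fintype.card_congr (Equiv.refl _)
    rw [this]
    exact add_le_add P.card_le (Finset.sum_le_sum fun e _ => (Q e).card_le)
  ev D m := by
    obtain ⟨μ, h1, h2⟩ := P.ev D m
    choose ν hν1 hν2 using fun e m => (Q e).ev D m
    refine ⟨_, h1.append (Q := fun e => (Q e).frag) (fun x => ν x.1 x.2) fun y _ =>
      (hν1 y.1 y.2).mono (Finset.single_le_sum (f := fun e => (Q e).cost)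
            (fun _ _ => Nat.zero_le _) (Finset.mem_univ y.1)), ?_⟩
    rw [PMF.map_bind, ← h2, PMF.bind_map]
    congr 1
    funext x
    exact hν2 _ _

/-- The machine that executes a procedure and then outputs the content of the register `i`. -/
def toMachine [Fintype ι] [Fintype κ] (P : Proc Ω view Unit) (i : ι) : Machine R Ω where
  ι := ι
  κ := κ
  σ := Option P.frag.σ
  start := some P.frag.start
  code := fun s => s.elim (.halt i)
    fun s => ((P.frag.code s).map (Sum.elim some fun _ => none)).toInstr

theorem size_toMachine [Fintype ι] [Fintype κ] (P : Proc Ω view Unit) (i : ι) :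
    (P.toMachine i).size ≤ P.cost + 1 + Fintype.card ι + Fintype.card κ := by
  have : Fintype.card (P.toMachine i).σ = Fintype.card P.frag.σ + 1 := by
    rw [← Fintype.card_option]
    exact Fintype.card_congr (Equiv.refl _)
  have h2 := P.card_le
  have h3 : Fintype.card (P.toMachine i).ι = Fintype.card ι := Fintype.card_congr (Equiv.refl _)
  have h4 : Fintype.card (P.toMachine i).κ = Fintype.card κ := Fintype.card_congr (Equiv.refl _)
  rw [Machine.size]
  omega

/-- The configuration of `P.toMachine i` at an address of `P` or its exit. -/
def config [Fintype ι] [Fintype κ] (P : Proc Ω view Unit) (i : ι) (x : P.frag.σ ⊕ Unit)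
    (m : Mem R ι κ) : (P.toMachine i).Config :=
  ⟨x.elim some fun _ => none, m.reg, m.cnt⟩

theorem step_config [Fintype ι] [Fintype κ] (P : Proc Ω view Unit) (i : ι) (D : PMF (R × R))
    (s : P.frag.σ) (m : Mem R ι κ) :
    (P.toMachine i).step D (P.config i (.inl s) m) =
      ((P.frag.code s).sem D m).map fun x => P.config i x.1 x.2 := by
  have hite : ∀ (q : Prop) (_ : Decidable q) (y n : P.frag.σ ⊕ Unit),
      (⟨if q then (y.elim some fun _ => none : Option P.frag.σ) else n.elim some fun _ => none,
        m.reg, m.cnt⟩ : (P.toMachine i).Config) = P.config i (if q then y else n) m := by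
    intro q hq y n
    cases hq <;> rfl
  have key : ∀ (c : Cmd R Ω ι κ (P.frag.σ ⊕ Unit)),
      P.frag.code s = c → (P.toMachine i).step D (P.config i (.inl s) m) =
      (c.sem D m).map fun x => P.config i x.1 x.2 := by
    intro c hc
    have h1 : (P.toMachine i).code (P.config i (.inl s) m).pos =
        (c.map (Sum.elim some fun _ => none)).toInstr := by rw [← hc]; rfl
    unfold Machine.step
    rw [h1]
    cases c <;> simp only [Cmd.map, Cmd.toInstr, Cmd.sem, PMF.pure_map, PMF.map_comp]
    all_goals first
      | rfl
      | exact congrArg PMF.pure (hite _ _ _ _)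
      | exact congrArg (fun f => PMF.map f (unif Bool)) (funext fun b => hite _ _ _ _)
  exact key _ rfl

theorem exec_config [Fintype ι] [Fintype κ] (P : Proc Ω view Unit) (i : ι) (D : PMF (R × R))
    {n : ℕ} {x : P.frag.σ ⊕ Unit} {m : Mem R ι κ} {μ : PMF (Unit × Mem R ι κ)}
    (h : P.frag.Ev D n x m μ) :
    (P.toMachine i).exec D n (P.config i x m) = μ.map fun y => P.config i (.inr ()) y.2 := by
  induction h with
  | exit n e m =>
    rw [PMF.pure_map]
    induction n with
    | zero => rfl
    | succ n ih => 
      change (PMF.pure _).bind _ = _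
      rw [PMF.pure_bind]
      exact ih
  | step n s m α p g ν hp h ih =>
    change ((P.toMachine i).step D _).bind _ = _
    rw [step_config, hp, PMF.map_comp, PMF.bind_map, PMF.map_bind]
    exact pmf_bind_congr p fun a ha => ih a ha

theorem exists_exec_toMachine [Fintype ι] [Fintype κ] (P : Proc Ω view Unit) (i : ι)
    (D : PMF (R × R)) {t : ℕ} (ht : P.cost ≤ t) :
    ∃ μ : PMF (Unit × Mem R ι κ), μ.map (Prod.map id view) = P.sem D (view (Mem.zero R ι κ)) ∧
      (P.toMachine i).exec D t (P.toMachine i).init =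
        μ.map fun y => P.config i (.inr ()) y.2 := by
  obtain ⟨μ, h1, h2⟩ := P.ev D (Mem.zero R ι κ)
  exact ⟨μ, h2, P.exec_config i D (h1.mono ht)⟩

theorem runsIn_toMachine [Fintype ι] [Fintype κ] (P : Proc Ω view Unit) (i : ι) {t : ℕ}
    (ht : P.cost + 1 + Fintype.card ι + Fintype.card κ ≤ t) : (P.toMachine i).RunsIn t := by
  refine ⟨(P.size_toMachine i).trans ht, fun D c hc => ?_⟩
  obtain ⟨μ, -, h⟩ := P.exists_exec_toMachine i D (t := t) (by omega)
  rw [h] at hc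
  obtain ⟨y, -, rfl⟩ := (PMF.mem_support_map_iff _ _ _).1 hc
  rfl

theorem probOutput_toMachine [Fintype ι] [Fintype κ] (P : Proc Ω view Unit) (i : ι) {t : ℕ}
    (ht : P.cost ≤ t) (D : PMF (R × R)) (out : V → R) (hout : ∀ m, out (view m) = m.reg i)
    (x : R) : (P.toMachine i).probOutput D t x =
      (((P.sem D (view (Mem.zero R ι κ))).map fun y => out y.2) x).toReal := by
  obtain ⟨μ, h1, h2⟩ := P.exists_exec_toMachine i D ht
  rw [Machine.probOutput, h2, ← h1, PMF.map_comp, PMF.map_comp]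
  have : ((P.toMachine i).result ∘ fun y : Unit × Mem R ι κ => P.config i (.inr ()) y.2) =
      some ∘ (fun y => y.2.reg i) := rfl
  rw [this, ← PMF.map_comp]
  have h3 : ((fun y : Unit × V => out y.2) ∘ Prod.map id view) =
      fun y : Unit × Mem R ι κ => y.2.reg i := by
    funext y; simp [hout]
  rw [h3]
  congr 1
  rw [PMF.map_apply, tsum_eq_single x (fun y hy => by simp [hy.symm])]
  simp

end Proc

end

section

variable {R : Type u} {Ω : Set (R → R → R)} {ι κ τ : Type}

/-- An instruction is a command or a halting instruction. -/
def Instr.toCmd : Instr R Ω ι κ τ → Cmd R Ω ι κ τ ⊕ ι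
  | .const i x n => .inl (.const i x n)
  | .op φ i j k n => .inl (.op φ i j k n)
  | .rand i n => .inl (.rand i n)
  | .sample i j n => .inl (.sample i j n)
  | .test i j y n => .inl (.test i j y n)
  | .coin y n => .inl (.coin y n)
  | .natConst k m n => .inl (.natConst k m n)
  | .natAdd k l m n => .inl (.natAdd k l m n)
  | .natSub k l m n => .inl (.natSub k l m n)
  | .natTest k l y n => .inl (.natTest k l y n)
  | .halt i => .inr i

variable [CommRing R] [Finite R]

theorem Machine.step_of_toCmd {A : Machine R Ω} {c : A.Config} {x : Cmd R Ω A.ι A.κ A.σ}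
    (h : (A.code c.pos).toCmd = .inl x) (D : PMF (R × R)) :
    A.step D c = (x.sem D ⟨c.reg, c.cnt⟩).map fun y => ⟨y.1, y.2.reg, y.2.cnt⟩ := by
  unfold Machine.step
  cases hc : A.code c.pos <;> rw [hc] at h <;> simp only [Instr.toCmd, reduceCtorEq] at h <;>
    cases h <;> simp only [Cmd.sem, PMF.pure_map, PMF.map_comp] <;> rfl

omit [CommRing R] [Finite R] in
theorem Machine.result_of_toCmd {A : Machine R Ω} {c : A.Config} {x : Cmd R Ω A.ι A.κ A.σ}
    (h : (A.code c.pos).toCmd = .inl x) : A.result c = none := by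
  unfold Machine.result
  cases hc : A.code c.pos <;> rw [hc] at h <;>
    simp only [Instr.toCmd, reduceCtorEq] at h

theorem Machine.exec_of_halt {A : Machine R Ω} {c : A.Config} {i : A.ι}
    (h : (A.code c.pos).toCmd = .inr i) (D : PMF (R × R)) (n : ℕ) :
    A.exec D n c = PMF.pure c := by
  have hc : A.code c.pos = .halt i := by
    cases hc : A.code c.pos <;> rw [hc] at h <;> simp only [Instr.toCmd, reduceCtorEq] at h
    cases h
    rfl
  have h1 : A.step D c = PMF.pure c := by
    unfold Machine.step
    rw [hc]
  induction n with
  | zero => rfl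
  | succ n ih =>
    rw [Machine.exec, h1, PMF.pure_bind, ih]

omit [CommRing R] [Finite R] in
theorem Machine.result_of_halt {A : Machine R Ω} {c : A.Config} {i : A.ι}
    (h : (A.code c.pos).toCmd = .inr i) : A.result c = some (c.reg i) := by
  have hc : A.code c.pos = .halt i := by
    cases hc : A.code c.pos <;> rw [hc] at h <;> simp only [Instr.toCmd, reduceCtorEq] at h
    cases h
    rfl
  unfold Machine.result
  rw [hc]

end

section

variable {R : Type u} [CommRing R] [Finite R] {Ω : Set (R → R → R)} {ι κ ε : Type}
  [DecidableEq ι] [DecidableEq κ]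

namespace Proc

/-- A command on the visible registers. -/
def onView {ι' κ' : Type} [DecidableEq ι'] [DecidableEq κ'] (f : ι' → ι) (g : κ' → κ)
    (hf : Function.Injective f) (hg : Function.Injective g) (c : Cmd R Ω ι' κ' ε) :
    Proc Ω (Mem.restrict (R := R) f g) ε :=
  (Proc.cmd (c.rename f g)).coarsen (Mem.restrict f g) (fun D m => c.sem D m)
    (fun D m => c.sem_rename D f g hf hg m)

variable {V : Type u} {view : Mem R ι κ → V}

/-- Sequential composition. -/
def seq (P : Proc Ω view Unit) (Q : Proc Ω view ε) : Proc Ω view ε := P.bind fun _ => Q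

theorem sem_seq (P : Proc Ω view Unit) (Q : Proc Ω view ε) (D : PMF (R × R)) (v : V) :
    (P.seq Q).sem D v = (P.sem D v).bind fun x => Q.sem D x.2 := rfl

theorem cost_seq (P : Proc Ω view Unit) (Q : Proc Ω view ε) :
    (P.seq Q).cost = P.cost + Q.cost := by
  simp [seq, bind]

/-- The procedure that does nothing. -/
def skip (view : Mem R ι κ → V) : Proc Ω view Unit :=
  (Proc.cmd (.coin () ())).coarsen view (fun _ v => PMF.pure ((), v)) (fun D m => by
    simp only [cmd, Cmd.sem, ite_self, PMF.map_comp]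
    exact PMF.map_const _ _)

/-- Executes a list of procedures. -/
def seqList (view : Mem R ι κ → V) (l : List (Proc Ω view Unit)) : Proc Ω view Unit :=
  l.foldr seq (skip view)

end Proc

end

section

variable {R : Type u} [CommRing R] [Finite R] {Ω : Set (R → R → R)} (A : Machine R Ω)
  {T L C ε : Type} [DecidableEq T] [DecidableEq L] [DecidableEq C]

/-- The view of the registers of a simulated machine and of the live registers. -/
def simView (m : Mem R (A.ι ⊕ T ⊕ L) (A.κ ⊕ C)) : Mem R A.ι A.κ × Mem R L C :=
  (m.restrict .inl .inl, m.restrict (.inr ∘ .inr) .inr)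

/-- A command of a simulated machine. -/
def simCmd (c : Cmd R Ω A.ι A.κ ε) : Proc Ω (simView A (T := T) (L := L) (C := C)) ε :=
  (Proc.cmd (c.rename .inl .inl)).coarsen (simView A)
    (fun D v => (c.sem D v.1).map fun x => (x.1, (x.2, v.2))) (fun D m => by
      have h1 : ∀ i x (m : Mem R (A.ι ⊕ T ⊕ L) (A.κ ⊕ C)),
          simView A (m.setReg (.inl i) x) = ((simView A m).1.setReg i x, (simView A m).2) := by
        intro i x m
        simp [simView, Mem.setReg, Mem.restrict,
          Function.update_comp_eq_of_injective _ Sum.inl_injective, Function.comp_def]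
      have h2 : ∀ i x (m : Mem R (A.ι ⊕ T ⊕ L) (A.κ ⊕ C)),
          simView A (m.setCnt (.inl i) x) = ((simView A m).1.setCnt i x, (simView A m).2) := by
        intro i x m
        simp [simView, Mem.setCnt, Mem.restrict,
          Function.update_comp_eq_of_injective _ Sum.inl_injective, Function.comp_def]
      cases c <;> simp only [Proc.cmd, Cmd.rename, Cmd.sem, PMF.pure_map, PMF.map_comp,
        Function.comp_def, Prod.map, h1, h2] <;> rfl)

theorem seqList_simCmd (l : List (Cmd R Ω A.ι A.κ Unit)) (D : PMF (R × R))
    (F : Mem R A.ι A.κ → Cmd R Ω A.ι A.κ Unit → Mem R A.ι A.κ)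
    (hF : ∀ c ∈ l, ∀ m, c.sem D m = PMF.pure ((), F m c)) (v : Mem R A.ι A.κ × Mem R L C) :
    (Proc.seqList (simView A (T := T)) (l.map (simCmd A))).sem D v =
      PMF.pure ((), (l.foldl F v.1, v.2)) := by
  induction l generalizing v with
  | nil => rfl
  | cons c l ih =>
    change PMF.bind ((simCmd A c).sem D v) (fun x =>
      (Proc.seqList (simView A (T := T)) (l.map (simCmd A))).sem D x.2) = _
    have : (simCmd A (T := T) c).sem D v = PMF.pure ((), (F v.1 c, v.2)) := by
      change (c.sem D v.1).map _ = _
      rw [hF c (by simp), PMF.pure_map]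
    rw [this, PMF.pure_bind, ih (fun c hc => hF c (by simp [hc]))]
    rfl

/-- The commands that set all registers to zero. -/
def resetCmds : List (Cmd R Ω A.ι A.κ Unit) :=
  (Finset.univ : Finset A.ι).toList.map (fun i => .const i 0 ()) ++
    (Finset.univ : Finset A.κ).toList.map (fun k => .natConst k 0 ())

/-- Sets all registers of the simulated machine to zero. -/
def reset : Proc Ω (simView A (T := T) (L := L) (C := C)) Unit :=
  Proc.seqList (simView A) ((resetCmds A).map (simCmd A))

theorem sem_reset (D : PMF (R × R)) (v : Mem R A.ι A.κ × Mem R L C) :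
    (reset A (T := T)).sem D v = PMF.pure ((), (Mem.zero R A.ι A.κ, v.2)) := by
  have key1 : ∀ (l : List A.ι) (m : Mem R A.ι A.κ),
      ((l.map (fun i => (.const i 0 () : Cmd R Ω A.ι A.κ Unit))).foldl
        (fun m c => (match c with
          | .const i _ _ => m.setReg i 0
          | .natConst k _ _ => m.setCnt k 0
          | _ => m)) m) = ⟨fun i => if i ∈ l then 0 else m.reg i, m.cnt⟩ := by
    intro l
    induction l with
    | nil => intro m; simp
    | cons a l ih =>
      intro m
      rw [List.map_cons, List.foldl_cons, ih]
      ext i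
      · by_cases h : i = a <;> simp [Mem.setReg, h]
      · simp [Mem.setReg]
  have key2 : ∀ (l : List A.κ) (m : Mem R A.ι A.κ),
      ((l.map (fun i => (.natConst i 0 () : Cmd R Ω A.ι A.κ Unit))).foldl
        (fun m c => (match c with
          | .const i _ _ => m.setReg i 0
          | .natConst k _ _ => m.setCnt k 0
          | _ => m)) m) = ⟨m.reg, fun i => if i ∈ l then 0 else m.cnt i⟩ := by
    intro l
    induction l with
    | nil => intro m; simp
    | cons a l ih =>
      intro m
      rw [List.map_cons, List.foldl_cons, ih]
      ext i
      · simp [Mem.setCnt]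
      · by_cases h : i = a <;> simp [Mem.setCnt, h]
  rw [reset, seqList_simCmd A (resetCmds A) D (fun m c => (match c with
          | .const i _ _ => m.setReg i 0
          | .natConst k _ _ => m.setCnt k 0
          | _ => m)), resetCmds, List.foldl_append, key1, key2]
  · simp [Mem.zero]
  · intro c hc m
    rw [resetCmds, List.mem_append, List.mem_map, List.mem_map] at hc
    rcases hc with ⟨i, -, rfl⟩ | ⟨i, -, rfl⟩ <;> rfl

theorem cost_reset : (reset A (T := T) (L := L) (C := C)).cost =
    Fintype.card A.ι + Fintype.card A.κ + 1 := by
  have : ∀ l : List (Cmd R Ω A.ι A.κ Unit),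
      (Proc.seqList (simView A (T := T) (L := L) (C := C)) (l.map (simCmd A))).cost
        = l.length + 1 := by
    intro l
    induction l with
    | nil => rfl
    | cons c l ih =>
      change (Proc.seq (simCmd A c) (Proc.seqList _ (l.map (simCmd A)))).cost = _
      rw [Proc.cost_seq, ih, List.length_cons]
      change 1 + _ = _
      ring
  rw [reset, this, resetCmds]
  simp

/-- Simulation of a single instruction, where `smp` answers oracle queries and `fin` handles the
output. -/
def simBody (smp : A.ι → A.ι → Proc Ω (simView A (T := T) (L := L) (C := C)) Unit)
    (fin : A.ι → Proc Ω (simView A (T := T) (L := L) (C := C)) ε) :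
    Cmd R Ω A.ι A.κ A.σ ⊕ A.ι → Proc Ω (simView A (T := T) (L := L) (C := C)) (A.σ ⊕ ε)
  | .inr i => (fin i).mapExit .inr
  | .inl (.sample i j n) => (smp i j).mapExit fun _ => .inl n
  | .inl c => (simCmd A c).mapExit .inl

variable {A} {smp : A.ι → A.ι → Proc Ω (simView A (T := T) (L := L) (C := C)) Unit}
    {fin : A.ι → Proc Ω (simView A (T := T) (L := L) (C := C)) ε}
    {S : PMF (R × R) → Mem R L C → PMF (R × R)} {φ : R → Mem R L C → ε × Mem R L C}

theorem sem_simBody (hsmp : ∀ i j D v, (smp i j).sem D v = (S D v.2).map fun x =>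
      ((), ((v.1.setReg i x.1).setReg j x.2, v.2))) (c : Cmd R Ω A.ι A.κ A.σ) (D : PMF (R × R))
    (v : Mem R A.ι A.κ × Mem R L C) :
    (simBody A smp fin (.inl c)).sem D v =
      (c.sem (S D v.2) v.1).map fun x => (.inl x.1, (x.2, v.2)) := by
  cases c
  case sample i j n =>
    change ((smp i j).sem D v).map _ = _
    rw [hsmp]
    simp only [Cmd.sem, PMF.map_comp]
    rfl
  all_goals
    change PMF.map _ (PMF.map _ _) = _
    rw [PMF.map_comp]
    rfl

theorem ev_sim (hsmp : ∀ i j D v, (smp i j).sem D v = (S D v.2).map fun x =>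
      ((), ((v.1.setReg i x.1).setReg j x.2, v.2)))
    (hfin : ∀ i D v, ((fin i).sem D v).map (Prod.map id Prod.snd) =
      PMF.pure (φ (v.1.reg i) v.2)) {K : ℕ}
    (hK : ∀ x, (simBody A smp fin x).cost ≤ K) (D : PMF (R × R)) (v : Mem R L C) (n : ℕ)
    (c : A.Config) (m : Mem R (A.ι ⊕ T ⊕ L) (A.κ ⊕ C))
    (hm : simView A m = (⟨c.reg, c.cnt⟩, v))
    (hc : ∀ c' ∈ (A.exec (S D v) n c).support, (A.result c').isSome) :
    ∃ μ, (Frag.link (fun s => (simBody A smp fin (A.code s).toCmd).frag) A.start).Ev D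
        ((n + 1) * K)
        (.inl ⟨c.pos, (simBody A smp fin (A.code c.pos).toCmd).frag.start⟩) m μ ∧
      μ.map (Prod.map id (Mem.restrict (.inr ∘ .inr) .inr)) =
        (A.exec (S D v) n c).map fun c => φ ((A.result c).getD 0) v := by
  have halt : ∀ (n : ℕ) (c : A.Config) (m : Mem R (A.ι ⊕ T ⊕ L) (A.κ ⊕ C)) (i : A.ι),
      simView A m = (⟨c.reg, c.cnt⟩, v) → (A.code c.pos).toCmd = .inr i →
      ∃ μ, (Frag.link (fun s => (simBody A smp fin (A.code s).toCmd).frag) A.start).Ev D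
        ((n + 1) * K)
        (.inl ⟨c.pos, (simBody A smp fin (A.code c.pos).toCmd).frag.start⟩) m μ ∧
      μ.map (Prod.map id (Mem.restrict (.inr ∘ .inr) .inr)) =
        (A.exec (S D v) n c).map fun c => φ ((A.result c).getD 0) v := by
    intro n c m i hm hi
    obtain ⟨μ, h1, h2⟩ := (simBody A smp fin (A.code c.pos).toCmd).ev D m
    have hb : (simBody A smp fin (A.code c.pos).toCmd).sem D (simView A m) =
        ((fin i).sem D (simView A m)).map (Prod.map .inr id) := by
      rw [hi]
      rfl
    rw [hb] at h2
    have hsupp : ∀ y ∈ μ.support, ∃ e, y.1 = .inr e := by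
      intro y hy
      have : Prod.map id (simView A) y ∈ (μ.map (Prod.map id (simView A))).support :=
        (PMF.mem_support_map_iff _ _ _).2 ⟨y, hy, rfl⟩
      rw [h2, PMF.mem_support_map_iff] at this
      obtain ⟨z, -, hz⟩ := this
      exact ⟨z.1, (congrArg Prod.fst hz).symm⟩
    obtain ⟨e₀⟩ : Nonempty ε := by
      obtain ⟨y, hy⟩ := μ.support_nonempty
      exact ⟨(hsupp y hy).choose⟩
    refine ⟨_, (Frag.Ev.link (body := fun s => (simBody A smp fin (A.code s).toCmd).frag)
      (j := 0) h1 (fun y => PMF.pure (y.1.elim (fun _ => e₀) id, y.2)) ?_).mono ?_, ?_⟩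
    · intro y hy
      obtain ⟨e, he⟩ := hsupp y hy
      rw [he]
      exact .exit _ _ _
    · have := hK (A.code c.pos).toCmd
      nlinarith
    · rw [PMF.map_bind, Machine.exec_of_halt hi, PMF.pure_map, Machine.result_of_halt hi]
      have h3 := congrArg (fun p : PMF ((A.σ ⊕ ε) × Mem R A.ι A.κ × Mem R L C) =>
        p.map (Prod.map (fun x : A.σ ⊕ ε => x.elim (fun _ => e₀) id) Prod.snd)) h2
      have h4 := hfin i D (simView A m)
      simp only [PMF.map_comp] at h3
      rw [hm] at h4 h3
      refine Eq.trans ?_ ((h3.trans ?_).trans h4)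
      · simp only [PMF.pure_map]
        rfl
      · rfl
  have isCmd : ∀ c : A.Config, (∃ x, (A.code c.pos).toCmd = .inl x) ∨
      ∃ i, (A.code c.pos).toCmd = .inr i := fun c => by
    cases (A.code c.pos).toCmd <;> simp
  induction n generalizing c m with
  | zero =>
    rcases isCmd c with ⟨x, hi⟩ | ⟨i, hi⟩
    · have := hc c (by simp [Machine.exec])
      rw [Machine.result_of_toCmd hi] at this
      simp at this
    · exact halt 0 c m i hm hi
  | succ n ih =>
    rcases isCmd c with ⟨x, hi⟩ | ⟨i, hi⟩
    swap
    · exact halt _ c m i hm hi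
    obtain ⟨μ, h1, h2⟩ := (simBody A smp fin (A.code c.pos).toCmd).ev D m
    have hb : (simBody A smp fin (A.code c.pos).toCmd).sem D (simView A m) =
        (x.sem (S D v) ⟨c.reg, c.cnt⟩).map fun x => (.inl x.1, (x.2, v)) := by
      rw [hi, sem_simBody hsmp, hm]
    rw [hb] at h2
    have hexec : A.exec (S D v) (n + 1) c = (x.sem (S D v) ⟨c.reg, c.cnt⟩).bind
        fun y => A.exec (S D v) n ⟨y.1, y.2.reg, y.2.cnt⟩ := by
      rw [Machine.exec, Machine.step_of_toCmd hi, PMF.bind_map]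
      rfl
    rw [hexec] at hc ⊢
    have hsupp : ∀ y ∈ μ.support, ∃ z ∈ (x.sem (S D v) ⟨c.reg, c.cnt⟩).support,
        y.1 = .inl z.1 ∧ simView A y.2 = (z.2, v) := by
      intro y hy
      have : Prod.map id (simView A) y ∈ (μ.map (Prod.map id (simView A))).support :=
        (PMF.mem_support_map_iff _ _ _).2 ⟨y, hy, rfl⟩
      rw [h2, PMF.mem_support_map_iff] at this
      obtain ⟨z, hz1, hz⟩ := this
      exact ⟨z, hz1, (congrArg Prod.fst hz).symm, (congrArg Prod.snd hz).symm⟩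
    let G : (A.σ ⊕ ε) × Mem R A.ι A.κ × Mem R L C → PMF (ε × Mem R L C) := fun y =>
      y.1.elim (fun s => (A.exec (S D v) n ⟨s, y.2.1.reg, y.2.1.cnt⟩).map
        fun c => φ ((A.result c).getD 0) v) fun e => PMF.pure (e, y.2.2)
    have hν : ∀ y : (A.σ ⊕ ε) × Mem R (A.ι ⊕ T ⊕ L) (A.κ ⊕ C), ∃ ν : PMF (ε × _),
        y ∈ μ.support →
        (Frag.link (fun s => (simBody A smp fin (A.code s).toCmd).frag) A.start).Ev D
          ((n + 1) * K) (y.1.map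
            (fun s => ⟨s, (simBody A smp fin (A.code s).toCmd).frag.start⟩) id) y.2 ν ∧
        ν.map (Prod.map id (Mem.restrict (.inr ∘ .inr) .inr)) =
          G (Prod.map id (simView A) y) := by
      intro y
      by_cases hy : y ∈ μ.support
      · obtain ⟨z, hz, hz1, hz2⟩ := hsupp y hy
        obtain ⟨ν, hν1, hν2⟩ := ih ⟨z.1, z.2.reg, z.2.cnt⟩ y.2 hz2 (fun c' hc' =>
          hc c' ((PMF.mem_support_bind_iff _ _ _).2 ⟨z, hz, hc'⟩))
        refine ⟨ν, fun _ => ⟨?_, ?_⟩⟩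
        · rw [hz1]
          exact hν1
        · rw [hν2]
          simp only [G, Prod.map, hz1, hz2, id, Sum.elim_inl]
      · have e₀ : Nonempty (PMF (ε × Mem R (A.ι ⊕ T ⊕ L) (A.κ ⊕ C))) := by
          obtain ⟨y, hy⟩ := μ.support_nonempty
          obtain ⟨z, hz, hz1, hz2⟩ := hsupp y hy
          obtain ⟨ν, -⟩ := ih ⟨z.1, z.2.reg, z.2.cnt⟩ y.2 hz2 (fun c' hc' =>
            hc c' ((PMF.mem_support_bind_iff _ _ _).2 ⟨z, hz, hc'⟩))
          exact ⟨ν⟩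
        exact ⟨e₀.some, fun h => absurd h hy⟩
    choose ν hν using hν
    refine ⟨_, (Frag.Ev.link (body := fun s => (simBody A smp fin (A.code s).toCmd).frag)
      h1 ν fun y hy => (hν y hy).1).mono ?_, ?_⟩
    · have := hK (A.code c.pos).toCmd
      nlinarith
    · rw [PMF.map_bind, PMF.map_bind, pmf_bind_congr μ fun y hy => (hν y hy).2]
      change μ.bind (G ∘ Prod.map id (simView A)) = _
      rw [← PMF.bind_map, h2, PMF.bind_map]
      rfl

/-- Resets the registers of the machine `A` and simulates its execution. -/
def simulate (hsmp : ∀ i j D v, (smp i j).sem D v = (S D v.2).map fun x =>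
      ((), ((v.1.setReg i x.1).setReg j x.2, v.2)))
    (hfin : ∀ i D v, ((fin i).sem D v).map (Prod.map id Prod.snd) =
      PMF.pure (φ (v.1.reg i) v.2)) {K t : ℕ}
    (hK : ∀ x, (simBody A smp fin x).cost ≤ K) (ht : A.RunsIn t) :
    Proc Ω (Mem.restrict (R := R) (.inr ∘ .inr : L → A.ι ⊕ T ⊕ L) (.inr : C → A.κ ⊕ C)) ε where
  frag := (reset A).frag.append fun _ =>
    Frag.link (fun s => (simBody A smp fin (A.code s).toCmd).frag) A.start
  cost := t + 1 + (t + 1) * K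
  sem D v := (A.exec (S D v) t A.init).map fun c => φ ((A.result c).getD 0) v
  card_le := by
    have h1 : Fintype.card ((reset A (T := T) (L := L) (C := C)).frag.append fun _ =>
        Frag.link (fun s => (simBody A smp fin (A.code s).toCmd).frag) A.start).σ =
        Fintype.card (reset A (T := T) (L := L) (C := C)).frag.σ + ∑ _ : Unit, ∑ s,
          Fintype.card (simBody A smp fin (A.code s).toCmd).frag.σ := by
      simp only [← Fintype.card_sigma, ← Fintype.card_sum]
      exact Fintype.card_congr (Equiv.refl _)
    have h2 : ∑ s, Fintype.card (simBody A smp fin (A.code s).toCmd).frag.σ ≤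
        Fintype.card A.σ * K := by
      rw [← smul_eq_mul, ← Finset.card_univ, ← Finset.sum_const]
      exact Finset.sum_le_sum fun s _ => (Proc.card_le _).trans (hK _)
    have h3 := (reset A (T := T) (L := L) (C := C)).card_le
    have h4 := ht.1
    rw [cost_reset] at h3
    rw [Machine.size] at h4
    rw [h1]
    simp only [Finset.univ_unique, Finset.sum_const, Finset.card_singleton, one_smul]
    have h5 : Fintype.card A.σ * K ≤ (t + 1) * K := Nat.mul_le_mul_right _ (by omega)
    omega
  ev D m := by
    obtain ⟨μ, h1, h2⟩ := (reset A (T := T) (L := L) (C := C)).ev D m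
    rw [sem_reset] at h2
    have hsupp : ∀ y ∈ μ.support, simView A y.2 =
        (Mem.zero R A.ι A.κ, m.restrict (.inr ∘ .inr) .inr) := by
      intro y hy
      have : Prod.map id (simView A) y ∈ (μ.map (Prod.map id (simView A))).support :=
        (PMF.mem_support_map_iff _ _ _).2 ⟨y, hy, rfl⟩
      rw [h2, PMF.mem_support_pure_iff] at this
      exact congrArg Prod.snd this
    have hsim : ∀ y : Unit × Mem R (A.ι ⊕ T ⊕ L) (A.κ ⊕ C), simView A y.2 =
        (Mem.zero R A.ι A.κ, m.restrict (.inr ∘ .inr) .inr) → _ := fun y hy =>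
      ev_sim hsmp hfin hK D (m.restrict (.inr ∘ .inr : L → A.ι ⊕ T ⊕ L)
        (.inr : C → A.κ ⊕ C)) t A.init y.2 hy (ht.2 _)
    have hν : ∀ y : Unit × Mem R (A.ι ⊕ T ⊕ L) (A.κ ⊕ C), ∃ ν : PMF (ε × _),
        y ∈ μ.support →
        (Frag.link (fun s => (simBody A smp fin (A.code s).toCmd).frag) A.start).Ev D
          ((t + 1) * K) (.inl ⟨A.start, (simBody A smp fin (A.code A.start).toCmd).frag.start⟩)
          y.2 ν ∧ ν.map (Prod.map id (Mem.restrict (.inr ∘ .inr) .inr)) =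
        (A.exec (S D (m.restrict (.inr ∘ .inr) .inr)) t A.init).map
          fun c => φ ((A.result c).getD 0) (m.restrict (.inr ∘ .inr) .inr) := by
      intro y
      obtain ⟨y₀, hy₀⟩ := μ.support_nonempty
      by_cases hy : y ∈ μ.support
      · obtain ⟨ν, hν⟩ := hsim y (hsupp y hy)
        exact ⟨ν, fun _ => hν⟩
      · obtain ⟨ν, hν⟩ := hsim y₀ (hsupp y₀ hy₀)
        exact ⟨ν, fun h => absurd h hy⟩
    choose ν hν using hν
    refine ⟨_, (h1.append (Q := fun _ =>
      Frag.link (fun s => (simBody A smp fin (A.code s).toCmd).frag) A.start) ν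
      fun y hy => (hν y hy).1).mono ?_, ?_⟩
    · rw [cost_reset]
      have h4 := ht.1
      have : 0 < Fintype.card A.σ := Fintype.card_pos_iff.2 ⟨A.start⟩
      rw [Machine.size] at h4
      omega
    · rw [PMF.map_bind, pmf_bind_congr μ fun y hy => (hν y hy).2, PMF.bind_const]

end

/-! ### Uniform distributions and hybrid samples -/

section

theorem unif_apply {α : Type*} [Finite α] [Nonempty α] (a : α) :
    unif α a = (Nat.card α : ENNReal)⁻¹ := by
  let _ := Fintype.ofFinite α
  rw [unif, PMF.uniformOfFintype_apply, Nat.card_eq_fintype_card]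

theorem eq_unif_of_forall_eq {α : Type*} [Finite α] [Nonempty α] (p : PMF α)
    (h : ∀ a b, p a = p b) : p = unif α := by
  let _ := Fintype.ofFinite α
  ext a
  have h1 : ∑ b, p b = 1 := (tsum_fintype _).symm.trans p.tsum_coe
  rw [Finset.sum_congr rfl (fun b _ => h b a), Finset.sum_const, nsmul_eq_mul, Finset.card_univ]
    at h1
  rw [unif_apply, Nat.card_eq_fintype_card]
  exact ENNReal.eq_inv_of_mul_eq_one_left (by rw [mul_comm]; exact h1)

theorem unif_map_of_bijective {α β : Type*} [Finite α] [Nonempty α] [Finite β] [Nonempty β]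
    {f : α → β} (hf : Function.Bijective f) : (unif α).map f = unif β := by
  refine eq_unif_of_forall_eq _ ?_
  have : ∀ b, (unif α).map f b = (Nat.card α : ENNReal)⁻¹ := by
    intro b
    obtain ⟨a, rfl⟩ := hf.2 b
    rw [PMF.map_apply, tsum_eq_single a (fun a' ha => by
      rw [if_neg]
      exact fun h => ha (hf.1 h).symm), if_pos rfl, unif_apply]
  intro a b
  rw [this, this]

theorem unif_map_of_surjective {A B : Type*} [AddGroup A] [AddGroup B] [Finite A] [Finite B]
    (f : A →+ B) (hf : Function.Surjective f) : (unif A).map f = unif B := by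
  refine eq_unif_of_forall_eq _ ?_
  have : ∀ b, (unif A).map f b = (unif A).map f 0 := by
    intro b
    obtain ⟨x, rfl⟩ := hf b
    rw [PMF.map_apply, PMF.map_apply, ← (Equiv.addLeft x).tsum_eq]
    refine tsum_congr fun a => ?_
    have h : f x = f (Equiv.addLeft x a) ↔ 0 = f a := by
      rw [Equiv.coe_addLeft, map_add, left_eq_add, eq_comm]
    rw [unif_apply, unif_apply]
    by_cases h0 : 0 = f a
    · rw [if_pos (h.2 h0), if_pos h0]
    · rw [if_neg (mt h.1 h0), if_neg h0]
  intro a b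
  rw [this a, this b]

theorem unif_map_eq_of_range_eq {A B M : Type*} [AddGroup A] [AddGroup B] [AddGroup M] [Finite A]
    [Finite B] (f : A →+ M) (g : B →+ M) (h : f.range = g.range) :
    (unif A).map f = (unif B).map g := by
  have key : ∀ {A : Type _} [AddGroup A] [Finite A] (f : A →+ M) (S : AddSubgroup M) [Finite S],
      f.range = S → (unif A).map f = (unif S).map Subtype.val := by
    intro A _ _ f S _ hS
    subst hS
    rw [← unif_map_of_surjective f.rangeRestrict f.rangeRestrict_surjective, PMF.map_comp]
    rfl
  have hB : Finite g.range := inferInstanceAs (Finite (Set.range g))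
  have key' : ∀ {A : Type _} [AddGroup A] [Finite A] (f : A →+ M) (S : AddSubgroup M) [Finite S],
      f.range = S → (unif A).map f = (unif S).map Subtype.val := by
    intro A _ _ f S _ hS
    subst hS
    rw [← unif_map_of_surjective f.rangeRestrict f.rangeRestrict_surjective, PMF.map_comp]
    rfl
  rw [key f _ h, key' g _ rfl]

theorem unif_prod {α β : Type*} [Finite α] [Nonempty α] [Finite β] [Nonempty β] :
    ((unif α).bind fun a => (unif β).map fun b => (a, b)) = unif (α × β) := by
  refine eq_unif_of_forall_eq _ ?_
  have : ∀ x, ((unif α).bind fun a => (unif β).map fun b => (a, b)) x =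
      (Nat.card α : ENNReal)⁻¹ * (Nat.card β : ENNReal)⁻¹ := by
    rintro ⟨a, b⟩
    rw [PMF.bind_apply, tsum_eq_single a, PMF.map_apply, tsum_eq_single b]
    · simp [unif_apply]
    · intro b' hb
      simp [hb.symm]
    · intro a' ha
      rw [PMF.map_apply]
      simp [ha.symm]
  intro x y
  rw [this, this]

theorem unif_bind_comp {α : Type*} {β : Type*} [Finite α] [Nonempty α] {f : α → α}
    (hf : Function.Bijective f) (F : α → PMF β) :
    ((unif α).bind fun a => F (f a)) = (unif α).bind F := by
  conv_rhs => rw [← unif_map_of_bijective hf, PMF.bind_map]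
  rfl

end

section

variable {R : Type u} [CommRing R] [Finite R]

/-- Ring-LPN samples with additional uniform noise in the ideal generated by `E`. -/
def hybrid (ψ : PMF R) (E s : R) : PMF (R × R) :=
  (unif R).bind fun a => ψ.bind fun e => (unif R).map fun h => (a, a * s + e + h * E)

theorem hybrid_zero (ψ : PMF R) (s : R) : hybrid ψ 0 s = sampleDist ψ s := by
  simp only [hybrid, sampleDist, mul_zero, add_zero]
  congr 1
  funext a
  rw [← PMF.bind_pure_comp]
  congr 1
  funext e
  exact PMF.map_const _ _

theorem hybrid_one (ψ : PMF R) (s : R) : hybrid ψ 1 s = unif (R × R) := by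
  rw [← unif_prod]
  simp only [hybrid, mul_one]
  congr 1
  funext a
  have : ∀ e, (unif R).map (fun h => (a, a * s + e + h)) = (unif R).map fun b => (a, b) := by
    intro e
    conv_rhs => rw [← unif_map_of_bijective (AddGroup.addLeft_bijective (a * s + e)), PMF.map_comp]
    rfl
  simp only [this, PMF.bind_const]

/-- The transformation of a sample, for a guess `x` of the secret in the component of the
idempotent `e`. -/
def guessSample (D : PMF (R × R)) (g : R → R) (e E x s₀ : R) : PMF (R × R) :=
  D.bind fun ab => (unif R).bind fun y => (unif R).map fun h =>
    (g ab.1 + y * e, g ab.2 + y * e * x + h * E + (g ab.1 + y * e) * s₀)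

variable {ψ : PMF R} {g : R →+* R}

theorem guessSample_sampleDist (hg : Function.Bijective g) (hψ : ψ.map g = ψ) (e E x s₀ s : R) :
    guessSample (sampleDist ψ s) g e E x s₀ = (unif R).bind fun a => ψ.bind fun z =>
      (unif R).bind fun y => (unif R).map fun h =>
        (a, a * (g s + s₀) + z + (y * (e * (x - g s)) + h * E)) := by
  calc guessSample (sampleDist ψ s) g e E x s₀
      = (unif R).bind fun a => ψ.bind fun z => (unif R).bind fun y => (unif R).map fun h =>
          (g a + y * e, (g a + y * e) * (g s + s₀) + g z + (y * (e * (x - g s)) + h * E)) := by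
        simp only [guessSample, sampleDist, PMF.bind_bind, PMF.bind_map]
        congr 1; funext a; congr 1; funext z
        simp only [Function.comp]
        congr 1; funext y; congr 1; funext h
        rw [Prod.mk.injEq, map_add, map_mul]
        exact ⟨rfl, by ring⟩
    _ = ψ.bind fun z => (unif R).bind fun y => (unif R).bind fun a => (unif R).map fun h =>
          (g a + y * e, (g a + y * e) * (g s + s₀) + g z + (y * (e * (x - g s)) + h * E)) := by
        rw [PMF.bind_comm]
        congr 1; funext z
        rw [PMF.bind_comm]
    _ = ψ.bind fun z => (unif R).bind fun y => (unif R).bind fun a => (unif R).map fun h =>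
          (a, a * (g s + s₀) + g z + (y * (e * (x - g s)) + h * E)) := by
        congr 1; funext z; congr 1; funext y
        exact unif_bind_comp (f := fun a => g a + y * e)
          ((AddGroup.addRight_bijective (y * e)).comp hg) fun a => (unif R).map fun h =>
          (a, a * (g s + s₀) + g z + (y * (e * (x - g s)) + h * E))
    _ = (unif R).bind fun a => ψ.bind fun z => (unif R).bind fun y => (unif R).map fun h =>
          (a, a * (g s + s₀) + g z + (y * (e * (x - g s)) + h * E)) := by
        rw [PMF.bind_comm (unif R) ψ]
        congr 1; funext z
        rw [PMF.bind_comm]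
    _ = _ := by
        congr 1; funext a
        conv_rhs => rw [← hψ, PMF.bind_map]
        rfl

/-- If the guess is right then the transformed samples are hybrid samples. -/
theorem guessSample_of_eq (hg : Function.Bijective g) (hψ : ψ.map g = ψ) {e E x s₀ s : R}
    (h : e * x = e * g s) :
    guessSample (sampleDist ψ s) g e E x s₀ = hybrid ψ E (g s + s₀) := by
  rw [guessSample_sampleDist hg hψ, hybrid, mul_sub, h, sub_self]
  simp only [mul_zero, zero_add, PMF.bind_const]

/-- If the guess is wrong then the transformed samples are hybrid samples of the next level. -/
theorem guessSample_of_ne (hg : Function.Bijective g) (hψ : ψ.map g = ψ) {e E x s₀ s w : R}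
    (he : e * e = e) (hE : E * E = E) (heE : e * E = 0) (hw : e * (x - g s) * w = e) :
    guessSample (sampleDist ψ s) g e E x s₀ = hybrid ψ (E + e) (g s + s₀) := by
  rw [guessSample_sampleDist hg hψ, hybrid]
  congr 1; funext a; congr 1; funext z
  have h1 : ((unif R).bind fun y => (unif R).map fun h =>
        (a, a * (g s + s₀) + z + (y * (e * (x - g s)) + h * E))) =
      ((unif (R × R)).map (((AddMonoidHom.mulRight (e * (x - g s))).coprod
        (AddMonoidHom.mulRight E)) : R × R →+ R)).map
          fun c => (a, a * (g s + s₀) + z + c) := by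
    rw [← unif_prod, PMF.map_bind, PMF.map_bind]
    simp only [PMF.map_comp]
    rfl
  have h2 : (unif R).map (fun h => (a, a * (g s + s₀) + z + h * (E + e))) =
      ((unif R).map (AddMonoidHom.mulRight (E + e))).map
          fun c => (a, a * (g s + s₀) + z + c) := by
    rw [PMF.map_comp]
    rfl
  rw [h1, h2]
  congr 1
  refine unif_map_eq_of_range_eq _ _ ?_
  ext c
  simp only [AddMonoidHom.mem_range, Prod.exists, AddMonoidHom.coprod_apply,
    AddMonoidHom.coe_mulRight]
  constructor
  · rintro ⟨y, h, rfl⟩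
    refine ⟨y * (e * (x - g s)) + h * E, ?_⟩
    linear_combination (y * (x - g s) + h) * heE + y * (x - g s) * he + h * hE
  · rintro ⟨h, rfl⟩
    refine ⟨h * w, h, ?_⟩
    linear_combination h * hw

end

/-! ### Running a distinguisher on transformed samples -/

/-- The names of the basic operations. -/
structure RingOps {R : Type u} [CommRing R] (Ω : Set (R → R → R)) where
  add : Ω
  sub : Ω
  mul : Ω
  copy : Ω
  add_apply : ∀ x y, add.1 x y = x + y
  sub_apply : ∀ x y, sub.1 x y = x - y
  mul_apply : ∀ x y, mul.1 x y = x * y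
  copy_apply : ∀ x y, copy.1 x y = x

section

variable {R : Type u} [CommRing R] [Finite R] {Ω : Set (R → R → R)} {ι κ ε : Type}
  [DecidableEq ι] [DecidableEq κ]

theorem Proc.cost_coarsen {V V' : Type u} {view : Mem R ι κ → V} (P : Proc Ω view ε) (π : V → V')
    (sem : PMF (R × R) → V' → PMF (ε × V'))
    (h : ∀ D v, (P.sem D v).map (Prod.map id π) = sem D (π v)) :
    (P.coarsen π sem h).cost = P.cost := rfl

theorem Proc.cost_cmd (c : Cmd R Ω ι κ ε) : (Proc.cmd c).cost = 1 := rfl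

theorem Proc.sem_seqList_cons {V : Type u} {view : Mem R ι κ → V} (P : Proc Ω view Unit)
    (l : List (Proc Ω view Unit)) (D : PMF (R × R)) (v : V) :
    (Proc.seqList view (P :: l)).sem D v =
      (P.sem D v).bind fun x => (Proc.seqList view l).sem D x.2 := rfl

theorem Proc.sem_seqList_nil {V : Type u} {view : Mem R ι κ → V} (D : PMF (R × R)) (v : V) :
    (Proc.seqList (Ω := Ω) view []).sem D v = PMF.pure ((), v) := rfl

theorem Proc.cost_seqList {V : Type u} {view : Mem R ι κ → V} (l : List (Proc Ω view Unit)) :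
    (Proc.seqList view l).cost = (l.map Proc.cost).sum + 1 := by
  induction l with
  | nil => rfl
  | cons P l ih =>
    change (P.seq (Proc.seqList view l)).cost = _
    rw [Proc.cost_seq, ih, List.map_cons, List.sum_cons]
    ring

end

theorem Mem.setReg_reg {R : Type u} {ι κ : Type} [DecidableEq ι] (m : Mem R ι κ) (i : ι) (x : R) (j : ι) :
    (m.setReg i x).reg j = if j = i then x else m.reg j := by
  simp [Mem.setReg, Function.update_apply]

section

variable {R : Type u} [CommRing R] [Finite R] {Ω : Set (R → R → R)} (A : Machine R Ω)
  {T L C ε : Type} [DecidableEq T] [DecidableEq L] [DecidableEq C]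

/-- The memory with the given contents of the four scratch registers. -/
def scratch (m : Mem R (A.ι ⊕ Fin 4 ⊕ L) (A.κ ⊕ C)) (a b y z : R) :
    Mem R (A.ι ⊕ Fin 4 ⊕ L) (A.κ ⊕ C) :=
  ⟨Sum.elim (m.reg ∘ .inl) (Sum.elim ![a, b, y, z] (m.reg ∘ .inr ∘ .inr)), m.cnt⟩

section scratch

variable (m : Mem R (A.ι ⊕ Fin 4 ⊕ L) (A.κ ⊕ C)) (a b y z x : R)

omit [CommRing R] [Finite R] in
theorem exists_eq_scratch : ∃ a b y z, m = scratch A m a b y z := by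
  refine ⟨m.reg (.inr (.inl 0)), m.reg (.inr (.inl 1)), m.reg (.inr (.inl 2)),
    m.reg (.inr (.inl 3)), ?_⟩
  ext i
  · rcases i with i | i | i
    · rfl
    · fin_cases i <;> rfl
    · rfl
  · rfl

omit [CommRing R] [Finite R] in
theorem setReg_scratch (k : Fin 4) : (scratch A m a b y z).setReg (.inr (.inl k)) x =
    scratch A m (if k = 0 then x else a) (if k = 1 then x else b) (if k = 2 then x else y)
      (if k = 3 then x else z) := by
  ext i
  · rw [Mem.setReg_reg]
    rcases i with i | i | i
    · rw [if_neg (by simp)]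
      rfl
    · by_cases h : i = k
      · rw [if_pos (by rw [h]), h]
        fin_cases k <;> rfl
      · rw [if_neg (by simpa using h)]
        fin_cases k <;> fin_cases i <;> first | rfl | exact absurd rfl h
    · rw [if_neg (by simp)]
      rfl
  · rfl

omit [CommRing R] [Finite R] in
theorem simView_scratch : simView A (scratch A m a b y z) = simView A m := rfl

end scratch

omit [CommRing R] [Finite R] in
theorem simView_setReg_inl (m : Mem R (A.ι ⊕ T ⊕ L) (A.κ ⊕ C)) (i : A.ι) (x : R) :
    simView A (m.setReg (.inl i) x) = ((simView A m).1.setReg i x, (simView A m).2) := by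
  simp [simView, Mem.setReg, Mem.restrict,
    Function.update_comp_eq_of_injective _ Sum.inl_injective, Function.comp_def]

variable {A}

/-- Draws a sample from the oracle and transforms it according to the guess in the register
`some l` and the additional secret in the register `none`. -/
def sampler (o : RingOps Ω) (γ : Ω) (g : R → R) (hγ : ∀ x y, γ.1 x y = g x) (e E : R) (l : L)
    (i j : A.ι) : Proc Ω (simView A (T := Fin 4) (L := Option L) (C := C)) Unit :=
  (Proc.seqList id (List.map Proc.cmd
    [.sample (.inr (.inl 0)) (.inr (.inl 1)) (),
     .op γ (.inr (.inl 0)) (.inr (.inl 0)) (.inr (.inl 0)) (),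
     .op γ (.inr (.inl 1)) (.inr (.inl 1)) (.inr (.inl 1)) (),
     .rand (.inr (.inl 2)) (),
     .const (.inr (.inl 3)) e (),
     .op o.mul (.inr (.inl 2)) (.inr (.inl 2)) (.inr (.inl 3)) (),
     .op o.add (.inr (.inl 0)) (.inr (.inl 0)) (.inr (.inl 2)) (),
     .op o.mul (.inr (.inl 2)) (.inr (.inl 2)) (.inr (.inr (some l))) (),
     .op o.add (.inr (.inl 1)) (.inr (.inl 1)) (.inr (.inl 2)) (),
     .rand (.inr (.inl 2)) (),
     .const (.inr (.inl 3)) E (),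
     .op o.mul (.inr (.inl 2)) (.inr (.inl 2)) (.inr (.inl 3)) (),
     .op o.add (.inr (.inl 1)) (.inr (.inl 1)) (.inr (.inl 2)) (),
     .op o.mul (.inr (.inl 2)) (.inr (.inl 0)) (.inr (.inr none)) (),
     .op o.add (.inr (.inl 1)) (.inr (.inl 1)) (.inr (.inl 2)) (),
     .op o.copy (.inl i) (.inr (.inl 0)) (.inr (.inl 0)) (),
     .op o.copy (.inl j) (.inr (.inl 1)) (.inr (.inl 1)) ()])).coarsen (simView A)
  (fun D v => (guessSample D g e E (v.2.reg (some l)) (v.2.reg none)).map fun x =>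
    ((), ((v.1.setReg i x.1).setReg j x.2, v.2))) (by
    intro D m
    obtain ⟨a, b, y, z, hm⟩ := exists_eq_scratch A m
    have e0 : ∀ a b y z, (scratch A m a b y z).reg (.inr (.inl 0)) = a := fun _ _ _ _ => rfl
    have e1 : ∀ a b y z, (scratch A m a b y z).reg (.inr (.inl 1)) = b := fun _ _ _ _ => rfl
    have e2 : ∀ a b y z, (scratch A m a b y z).reg (.inr (.inl 2)) = y := fun _ _ _ _ => rfl
    have e3 : ∀ a b y z, (scratch A m a b y z).reg (.inr (.inl 3)) = z := fun _ _ _ _ => rfl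
    have el : ∀ a b y z l, (scratch A m a b y z).reg (.inr (.inr l)) = (simView A m).2.reg l :=
      fun _ _ _ _ _ => rfl
    have hi : ∀ a b y z x, ((scratch A m a b y z).setReg (.inl i) x).reg (.inr (.inl 1)) = b := by
      intro a b y z x
      rw [Mem.setReg_reg, if_neg (by simp), e1]
    have s0 : ∀ a b y z x, (scratch A m a b y z).setReg (.inr (.inl 0)) x = scratch A m x b y z :=
      fun a b y z x => setReg_scratch A m a b y z x 0
    have s1 : ∀ a b y z x, (scratch A m a b y z).setReg (.inr (.inl 1)) x = scratch A m a x y z :=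
      fun a b y z x => setReg_scratch A m a b y z x 1
    have s2 : ∀ a b y z x, (scratch A m a b y z).setReg (.inr (.inl 2)) x = scratch A m a b x z :=
      fun a b y z x => setReg_scratch A m a b y z x 2
    have s3 : ∀ a b y z x, (scratch A m a b y z).setReg (.inr (.inl 3)) x = scratch A m a b y x :=
      fun a b y z x => setReg_scratch A m a b y z x 3
    have hv : ∀ a b y z i x j x', simView A
        (((scratch A m a b y z).setReg (.inl i) x).setReg (.inl j) x') =
        (((simView A m).1.setReg i x).setReg j x', (simView A m).2) := by
      intro a b y z i x j x'
      rw [simView_setReg_inl, simView_setReg_inl, simView_scratch]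
    rw [hm, simView_scratch]
    simp only [List.map_cons, List.map_nil, Proc.sem_seqList_cons, Proc.sem_seqList_nil, Proc.cmd,
      Cmd.sem, PMF.pure_bind, PMF.bind_map, Function.comp_def, e0, e1, e2, e3, el, hi, s0, s1, s2,
      s3, hγ, o.add_apply, o.mul_apply, o.copy_apply, PMF.map_bind, PMF.pure_map, Prod.map, id, hv,
      guessSample, PMF.map_comp]
    exact congrArg _ (funext fun a => congrArg _ (funext fun b => rfl)))

theorem cost_sampler (o : RingOps Ω) (γ : Ω) (g : R → R) (hγ : ∀ x y, γ.1 x y = g x) (e E : R)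
    (l : L) (i j : A.ι) : (sampler (A := A) (C := C) o γ g hγ e E l i j).cost = 18 := by
  rw [sampler, Proc.cost_coarsen, Proc.cost_seqList]
  simp only [List.map_cons, List.map_nil, Proc.cost_cmd, List.sum_cons, List.sum_nil]
  norm_num

/-- Tests whether the output of the simulated machine is `1`. -/
def isOne (i : A.ι) : Proc Ω (simView A (T := Fin 4) (L := L) (C := C)) Bool :=
  ((Proc.cmd (.const (.inr (.inl 0)) 1 ())).bind fun _ =>
    Proc.cmd (.test (.inl i) (.inr (.inl 0)) true false)).coarsen (simView A)
    (fun _ v => open Classical in PMF.pure (decide (v.1.reg i = 1), v)) (by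
      intro D m
      obtain ⟨a, b, y, z, hm⟩ := exists_eq_scratch A m
      have h0 : (scratch A m a b y z).setReg (.inr (.inl 0)) 1 = scratch A m 1 b y z :=
        setReg_scratch A m a b y z 1 0
      rw [hm]
      simp only [Proc.bind, Proc.cmd, Cmd.sem, PMF.pure_bind, h0, PMF.pure_map]
      rfl)

open Classical in
/-- The distribution of the answer of the machine `A` on transformed samples with a random
additional secret. -/
def accept (A : Machine R Ω) (t : ℕ) (D : PMF (R × R)) (g : R → R) (e E x : R) : PMF Bool :=
  (unif R).bind fun s₀ => (A.exec (guessSample D g e E x s₀) t A.init).map fun c =>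
    decide ((A.result c).getD 0 = 1)

theorem cost_simBody_le {smp : A.ι → A.ι → Proc Ω (simView A (T := T) (L := L) (C := C)) Unit}
    {fin : A.ι → Proc Ω (simView A (T := T) (L := L) (C := C)) ε} {K : ℕ} (hK : 1 ≤ K)
    (h1 : ∀ i j, (smp i j).cost ≤ K) (h2 : ∀ i, (fin i).cost ≤ K)
    (x : Cmd R Ω A.ι A.κ A.σ ⊕ A.ι) : (simBody A smp fin x).cost ≤ K := by
  rcases x with c | i
  · cases c
    case sample i j n => exact h1 i j
    all_goals exact hK
  · exact h2 i

/-- Runs the machine `A` on samples transformed according to the guess in the register `l`. -/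
def call (o : RingOps Ω) (γ : Ω) (g : R → R) (hγ : ∀ x y, γ.1 x y = g x) (e E : R) {t : ℕ}
    (ht : A.RunsIn t) (l : L) : Proc Ω (Mem.restrict (R := R)
      (.inr ∘ .inr ∘ some : L → A.ι ⊕ Fin 4 ⊕ Option L) (.inr : C → A.κ ⊕ C)) Bool :=
  ((Proc.onView (.inr ∘ .inr : Option L → A.ι ⊕ Fin 4 ⊕ Option L) (.inr : C → A.κ ⊕ C)
    (Sum.inr_injective.comp Sum.inr_injective) Sum.inr_injective (.rand none ())).seq
    (simulate (S := fun D v => guessSample D g e E (v.reg (some l)) (v.reg none))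
      (hsmp := fun i j D v => (rfl : (sampler o γ g hγ e E l i j).sem D v = _))
      (hfin := fun i D v => by
        change PMF.map _ (PMF.pure _) = _
        rw [PMF.pure_map]
        rfl)
      (φ := fun x v => open Classical in (decide (x = 1), v))
      (fin := isOne) (K := 18)
      (cost_simBody_le (by norm_num) (fun i j => (cost_sampler o γ g hγ e E l i j).le)
        fun i => by
          change 1 + ∑ _ : Unit, 1 ≤ 18
          simp) ht)).coarsen
    (Mem.restrict some id) (fun D v => (accept A t D g e E (v.reg l)).map fun b => (b, v)) (by
      intro D v
      rw [Proc.sem_seq]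
      change PMF.map _ (PMF.bind (PMF.map _ (unif R)) fun x => PMF.map _ (A.exec _ t A.init)) = _
      rw [PMF.map_bind, PMF.bind_map, accept, PMF.map_bind]
      congr 1; funext s₀
      simp only [Function.comp, PMF.map_comp]
      have h1 : (v.setReg none s₀).reg (some l) = v.reg (some l) := by simp [Mem.setReg_reg]
      have h2 : (v.setReg none s₀).reg none = s₀ := by simp [Mem.setReg_reg]
      have h3 : (v.setReg none s₀).restrict some (id : C → C) = v.restrict some id := by
        simp [Mem.setReg, Mem.restrict, Function.comp_def]
      rw [h1, h2]
      exact congrArg (fun f => PMF.map f _) (funext fun c => Prod.ext rfl h3))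

theorem cost_call (o : RingOps Ω) (γ : Ω) (g : R → R) (hγ : ∀ x y, γ.1 x y = g x) (e E : R) {t : ℕ}
    (ht : A.RunsIn t) (l : L) : (call (A := A) (C := C) o γ g hγ e E ht l).cost = 19 * (t + 1) + 1 := by
  change (Proc.seq _ _).cost = _
  rw [Proc.cost_seq]
  change 1 + (t + 1 + (t + 1) * 18) = _
  ring

end

/-! ### Comparing two guesses -/

section

theorem toOuterMeasure_bind_le {α β : Type*} (p : PMF α) (f : α → PMF β) {B₁ : Set α} {B : Set β}
    {δ₁ δ₂ : ENNReal} (h₁ : p.toOuterMeasure B₁ ≤ δ₁)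
    (h₂ : ∀ a ∈ p.support, a ∉ B₁ → (f a).toOuterMeasure B ≤ δ₂) :
    (p.bind f).toOuterMeasure B ≤ δ₁ + δ₂ := by
  classical
  rw [PMF.toOuterMeasure_bind_apply]
  calc ∑' a, p a * (f a).toOuterMeasure B ≤ ∑' a, (B₁.indicator p a + p a * δ₂) := by
        refine ENNReal.tsum_le_tsum fun a => ?_
        by_cases ha : a ∈ p.support
        · by_cases hB : a ∈ B₁
          · rw [Set.indicator_of_mem hB]
            refine le_add_right (mul_le_of_le_one_right' ?_)
            rw [PMF.toOuterMeasure_apply, ← (f a).tsum_coe]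
            exact ENNReal.tsum_le_tsum fun b => Set.indicator_le_self _ _ _
          · exact le_add_left (mul_le_mul_right (h₂ a ha hB) _)
        · rw [(PMF.apply_eq_zero_iff p a).2 ha, zero_mul]
          exact zero_le
    _ ≤ δ₁ + δ₂ := by
        rw [ENNReal.tsum_add, ENNReal.tsum_mul_right, p.tsum_coe, one_mul]
        rw [PMF.toOuterMeasure_apply] at h₁
        gcongr

theorem toOuterMeasure_eq_zero_of_support {α : Type*} (p : PMF α) {B : Set α}
    (h : ∀ a ∈ p.support, a ∉ B) : p.toOuterMeasure B = 0 :=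
  (PMF.toOuterMeasure_apply_eq_zero_iff p B).2 (Set.disjoint_left.2 h)

/-- The expectation of a nonnegative function. -/
def expect {α : Type*} (p : PMF α) (W : α → ENNReal) : ENNReal := ∑' a, p a * W a

theorem expect_pure {α : Type*} (a : α) (W : α → ENNReal) : expect (PMF.pure a) W = W a := by
  rw [expect, tsum_eq_single a (fun b hb => by simp [hb])]
  simp

theorem expect_bind {α β : Type*} (p : PMF α) (f : α → PMF β) (W : β → ENNReal) :
    expect (p.bind f) W = expect p fun a => expect (f a) W := by
  simp only [expect, PMF.bind_apply, ← ENNReal.tsum_mul_right, ← ENNReal.tsum_mul_left]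
  rw [ENNReal.tsum_comm]
  simp only [mul_assoc]

theorem toOuterMeasure_le_expect {α : Type*} (p : PMF α) (W : α → ENNReal) {B : Set α}
    (h : ∀ a ∈ B, 1 ≤ W a) : p.toOuterMeasure B ≤ expect p W := by
  classical
  rw [PMF.toOuterMeasure_apply]
  refine ENNReal.tsum_le_tsum fun a => ?_
  by_cases ha : a ∈ B
  · rw [Set.indicator_of_mem ha]
    exact le_mul_of_one_le_right' (h a ha)
  · rw [Set.indicator_of_notMem ha]
    exact zero_le

/-- Numbers of successes of two experiments that are repeated `n` times, starting with `ab`. -/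
def score (P Q : PMF Bool) : ℕ → ℕ × ℕ → PMF (ℕ × ℕ)
  | 0, ab => PMF.pure ab
  | n + 1, ab => P.bind fun x => Q.bind fun y => score P Q n (ab.1 + x.toNat, ab.2 + y.toNat)

theorem expect_score (P Q : PMF Bool) (A B : ENNReal) (n : ℕ) (ab : ℕ × ℕ) :
    expect (score P Q n ab) (fun c => A ^ c.1 * B ^ c.2) =
      A ^ ab.1 * B ^ ab.2 * ((P false + P true * A) * (Q false + Q true * B)) ^ n := by
  induction n generalizing ab with
  | zero => simp [score, expect_pure]
  | succ n ih =>
    rw [score, expect_bind]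
    simp only [expect_bind, ih]
    simp only [expect, tsum_fintype, Fintype.sum_bool, Bool.toNat_true, Bool.toNat_false]
    ring

theorem exp_bound {p q δ l : ℝ} (hp : 0 ≤ p) (hp1 : p ≤ 1) (hq : 0 ≤ q) (hq1 : q ≤ 1)
    (hδ : 0 < δ) (hpq : q + δ ≤ p) (hl : l = δ / 4) :
    (1 - p + p * Real.exp (-l)) * (1 - q + q * Real.exp l) ≤ Real.exp (-(δ ^ 2 / 8)) := by
  have hδ1 : δ ≤ 1 := by linarith
  have h1 : Real.exp (-l) - 1 ≤ -l + l ^ 2 := by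
    have := (abs_le.1 (Real.abs_exp_sub_one_sub_id_le (x := -l)
      (by rw [abs_neg, abs_of_nonneg] <;> linarith))).2
    linarith [neg_sq l]
  have h2 : Real.exp l - 1 ≤ l + l ^ 2 := by
    have := (abs_le.1 (Real.abs_exp_sub_one_sub_id_le (x := l)
      (by rw [abs_of_nonneg] <;> linarith))).2
    linarith
  calc (1 - p + p * Real.exp (-l)) * (1 - q + q * Real.exp l)
      ≤ Real.exp (p * (Real.exp (-l) - 1)) * Real.exp (q * (Real.exp l - 1)) := by
        have a1 := Real.add_one_le_exp (p * (Real.exp (-l) - 1))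
        have a2 := Real.add_one_le_exp (q * (Real.exp l - 1))
        have := Real.exp_pos l
        refine mul_le_mul (by linarith) (by linarith) ?_ (Real.exp_pos _).le
        nlinarith
    _ = Real.exp (p * (Real.exp (-l) - 1) + q * (Real.exp l - 1)) := (Real.exp_add _ _).symm
    _ ≤ Real.exp (-(δ ^ 2 / 8)) := by
        refine Real.exp_le_exp.2 ?_
        have b1 : p * (Real.exp (-l) - 1) ≤ p * (-l + l ^ 2) := mul_le_mul_of_nonneg_left h1 hp
        have b2 : q * (Real.exp l - 1) ≤ q * (l + l ^ 2) := mul_le_mul_of_nonneg_left h2 hq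
        have b3 : p * l ^ 2 ≤ l ^ 2 := mul_le_of_le_one_left (sq_nonneg l) hp1
        have b4 : q * l ^ 2 ≤ l ^ 2 := mul_le_of_le_one_left (sq_nonneg l) hq1
        have b5 : l * (q + δ) ≤ l * p := mul_le_mul_of_nonneg_left hpq (by linarith)
        have b6 : l * δ = δ ^ 2 / 4 := by rw [hl]; ring
        have b7 : l ^ 2 = δ ^ 2 / 16 := by rw [hl]; ring
        linarith

/-- A bound for the probability that a comparison with `n` rounds fails. -/
def failProb (δ : ℝ) (n : ℕ) : ENNReal := ENNReal.ofReal (Real.exp (-(δ ^ 2 / 8))) ^ n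

theorem pmf_bool_eq (P : PMF Bool) : P true = ENNReal.ofReal (P true).toReal ∧
    P false = ENNReal.ofReal (1 - (P true).toReal) := by
  have h1 : P true ≠ ⊤ := P.apply_ne_top _
  have h2 : P true + P false = 1 := by
    have := P.tsum_coe
    rwa [tsum_fintype, Fintype.sum_bool] at this
  refine ⟨(ENNReal.ofReal_toReal h1).symm, ?_⟩
  rw [ENNReal.ofReal_sub _ ENNReal.toReal_nonneg, ENNReal.ofReal_toReal h1, ENNReal.ofReal_one,
    ← h2, ENNReal.add_sub_cancel_left h1]

theorem mgf_bound (P Q : PMF Bool) {δ : ℝ} (hδ : 0 < δ)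
    (h : (Q true).toReal + δ ≤ (P true).toReal) :
    (P false + P true * ENNReal.ofReal (Real.exp (-(δ / 4)))) *
      (Q false + Q true * ENNReal.ofReal (Real.exp (δ / 4))) ≤
      ENNReal.ofReal (Real.exp (-(δ ^ 2 / 8))) := by
  have hle : ∀ P : PMF Bool, (P true).toReal ≤ 1 := fun P =>
    ENNReal.toReal_le_of_le_ofReal zero_le_one (by simpa using P.coe_le_one true)
  have hp := hle P
  have hq := hle Q
  have hp0 : 0 ≤ (P true).toReal := ENNReal.toReal_nonneg
  have hq0 : 0 ≤ (Q true).toReal := ENNReal.toReal_nonneg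
  rw [(pmf_bool_eq P).1, (pmf_bool_eq P).2, (pmf_bool_eq Q).1, (pmf_bool_eq Q).2]
  have h1 := Real.exp_pos (-(δ / 4))
  have h2 := Real.exp_pos (δ / 4)
  rw [← ENNReal.ofReal_mul hp0, ← ENNReal.ofReal_mul hq0,
    ← ENNReal.ofReal_add (by linarith) (by positivity),
    ← ENNReal.ofReal_add (by linarith) (by positivity), ← ENNReal.ofReal_mul]
  · exact ENNReal.ofReal_le_ofReal (exp_bound hp0 hp hq0 hq hδ h rfl)
  · have := mul_nonneg hp0 h1.le
    linarith

theorem one_le_weight {x y : ℕ} (h : x ≤ y) (l : ℝ) (hl : 0 ≤ l) :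
    1 ≤ ENNReal.ofReal (Real.exp (-l)) ^ x * ENNReal.ofReal (Real.exp l) ^ y := by
  rw [← ENNReal.ofReal_pow (Real.exp_pos _).le, ← ENNReal.ofReal_pow (Real.exp_pos _).le,
    ← ENNReal.ofReal_mul (pow_nonneg (Real.exp_pos _).le _), ← Real.exp_nat_mul,
    ← Real.exp_nat_mul, ← Real.exp_add, ← ENNReal.ofReal_one]
  refine ENNReal.ofReal_le_ofReal (Real.one_le_exp ?_)
  have : (x : ℝ) ≤ y := by exact_mod_cast h
  nlinarith

theorem score_fst_le (P Q : PMF Bool) {δ : ℝ} (hδ : 0 < δ)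
    (h : (Q true).toReal + δ ≤ (P true).toReal) (n : ℕ) :
    (score P Q n (0, 0)).toOuterMeasure {c | c.1 ≤ c.2} ≤ failProb δ n := by
  refine (toOuterMeasure_le_expect _
    (fun c : ℕ × ℕ => ENNReal.ofReal (Real.exp (-(δ / 4))) ^ c.1 * ENNReal.ofReal (Real.exp (δ / 4)) ^ c.2)
    fun c hc => one_le_weight hc _ (by linarith)).trans ?_
  rw [expect_score, pow_zero, pow_zero, one_mul, one_mul]
  exact pow_le_pow_left' (mgf_bound P Q hδ h) n

theorem score_snd_le (P Q : PMF Bool) {δ : ℝ} (hδ : 0 < δ)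
    (h : (P true).toReal + δ ≤ (Q true).toReal) (n : ℕ) :
    (score P Q n (0, 0)).toOuterMeasure {c | c.2 < c.1} ≤ failProb δ n := by
  refine (toOuterMeasure_le_expect _
    (fun c : ℕ × ℕ => ENNReal.ofReal (Real.exp (δ / 4)) ^ c.1 * ENNReal.ofReal (Real.exp (-(δ / 4))) ^ c.2)
    fun c hc => ?_).trans ?_
  · rw [mul_comm]
    exact one_le_weight (le_of_lt hc) _ (by linarith)
  rw [expect_score, pow_zero, pow_zero, one_mul, one_mul]
  exact pow_le_pow_left' ((mul_comm _ _).trans_le (mgf_bound Q P hδ h)) n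

end

section

variable {R : Type u} [CommRing R] [Finite R] {Ω : Set (R → R → R)} {ι κ L ε : Type}
  [DecidableEq ι] [DecidableEq κ] [DecidableEq L] {f : L → ι} {g : Fin 3 → κ}

theorem Proc.sem_onView {C : Type} [DecidableEq C] {g : C → κ} (hf : Function.Injective f)
    (hg : Function.Injective g) (c : Cmd R Ω L C ε) (D : PMF (R × R)) (v : Mem R L C) :
    (Proc.onView f g hf hg c).sem D v = c.sem D v := rfl

theorem Proc.cost_onView {C : Type} [DecidableEq C] {g : C → κ} (hf : Function.Injective f)
    (hg : Function.Injective g) (c : Cmd R Ω L C ε) : (Proc.onView f g hf hg c).cost = 1 := rfl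

/-- An experiment with the outcome distribution `β D x`, where `x` is the content of the register
`l`, that does not change the visible registers. -/
structure Query (Ω : Set (R → R → R)) (f : L → ι) (g : Fin 3 → κ) where
  proc : L → Proc Ω (Mem.restrict (R := R) f g) Bool
  β : PMF (R × R) → R → PMF Bool
  sem_proc : ∀ l D v, (proc l).sem D v = (β D (v.reg l)).map fun b => (b, v)
  cost : ℕ
  cost_proc : ∀ l, (proc l).cost = cost

variable (o : RingOps Ω) (hf : Function.Injective f) (hg : Function.Injective g)
  (q : Query Ω f g)

/-- Runs the experiment on the register `l` and counts the successes in the counter `k`. -/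
def countRound (k : Fin 3) (l : L) : Proc Ω (Mem.restrict (R := R) f g) Unit :=
  (q.proc l).bind fun b => bif b then Proc.onView f g hf hg (.natAdd k k 2 ()) else Proc.skip _

/-- Runs the experiment `n` times on the registers `u` and `w`. -/
def rounds (n : ℕ) (u w : L) : Proc Ω (Mem.restrict (R := R) f g) Unit :=
  Proc.seqList _ (List.replicate n ((countRound hf hg q 0 u).seq (countRound hf hg q 1 w)))

theorem sem_countRound_zero (l : L) (D : PMF (R × R)) (x : L → R) (a b : ℕ) :
    (countRound hf hg q 0 l).sem D ⟨x, ![a, b, 1]⟩ =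
      (q.β D (x l)).map fun c => ((), ⟨x, ![a + c.toNat, b, 1]⟩) := by
  change PMF.bind ((q.proc l).sem D _) _ = _
  rw [q.sem_proc, PMF.bind_map, ← PMF.bind_pure_comp]
  congr 1
  funext c
  cases c
  · rfl
  · change PMF.pure _ = PMF.pure _
    congr 2
    refine Mem.ext rfl ?_
    funext i
    fin_cases i <;> rfl

theorem sem_countRound_one (l : L) (D : PMF (R × R)) (x : L → R) (a b : ℕ) :
    (countRound hf hg q 1 l).sem D ⟨x, ![a, b, 1]⟩ =
      (q.β D (x l)).map fun c => ((), ⟨x, ![a, b + c.toNat, 1]⟩) := by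
  change PMF.bind ((q.proc l).sem D _) _ = _
  rw [q.sem_proc, PMF.bind_map, ← PMF.bind_pure_comp]
  congr 1
  funext c
  cases c
  · rfl
  · change PMF.pure _ = PMF.pure _
    congr 2
    refine Mem.ext rfl ?_
    funext i
    fin_cases i <;> rfl

theorem sem_rounds (n : ℕ) (u w : L) (D : PMF (R × R)) (x : L → R) (ab : ℕ × ℕ) :
    (rounds hf hg q n u w).sem D ⟨x, ![ab.1, ab.2, 1]⟩ =
      (score (q.β D (x u)) (q.β D (x w)) n ab).map fun c => ((), ⟨x, ![c.1, c.2, 1]⟩) := by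
  induction n generalizing ab with
  | zero =>
    rw [score, PMF.pure_map]
    rfl
  | succ n ih =>
    change PMF.bind (PMF.bind _ _) _ = _
    rw [sem_countRound_zero, PMF.bind_map, PMF.bind_bind, score, PMF.map_bind]
    congr 1
    funext c
    simp only [Function.comp_apply, sem_countRound_one, PMF.bind_map, PMF.map_bind]
    congr 1
    funext d
    exact ih (ab.1 + c.toNat, ab.2 + d.toNat)

/-- Compares the contents of the registers `u` and `w` by `n` experiments, and copies `u` to `w` if
`u` wins. -/
def compare (n : ℕ) (u w : L) : Proc Ω (Mem.restrict (R := R) f g) Unit :=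
  (Proc.onView f g hf hg (.natConst 0 0 ())).seq <|
  (Proc.onView f g hf hg (.natConst 1 0 ())).seq <|
  (Proc.onView f g hf hg (.natConst 2 1 ())).seq <|
  (rounds hf hg q n u w).seq <|
  (Proc.onView f g hf hg (.natTest 1 0 true false)).bind fun b =>
    bif b then Proc.onView f g hf hg (.op o.copy w u u ()) else Proc.skip _

theorem cost_compare (n : ℕ) (u w : L) :
    (compare o hf hg q n u w).cost = n * (2 * q.cost + 4) + 7 := by
  have h1 : ∀ k l, (countRound hf hg q k l).cost = q.cost + 2 := by
    intro k l
    change (q.proc l).cost + ∑ b : Bool, _ = _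
    rw [q.cost_proc, Fintype.sum_bool]
    rfl
  have h2 : (rounds hf hg q n u w).cost = n * (2 * q.cost + 4) + 1 := by
    rw [rounds, Proc.cost_seqList]
    simp only [List.map_replicate, List.sum_replicate, Proc.cost_seq, h1, smul_eq_mul]
    ring
  rw [compare]
  simp only [Proc.cost_seq, h2, Proc.cost_onView]
  change 1 + (1 + (1 + (_ + (1 + ∑ b : Bool, _)))) = _
  rw [Fintype.sum_bool]
  change 1 + (1 + (1 + (_ + (1 + (1 + 1))))) = _
  ring

theorem sem_compare (n : ℕ) (u w : L) (D : PMF (R × R)) (v : Mem R L (Fin 3)) :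
    (compare o hf hg q n u w).sem D v =
      (score (q.β D (v.reg u)) (q.β D (v.reg w)) n (0, 0)).map fun c =>
        ((), ⟨if c.2 < c.1 then Function.update v.reg w (v.reg u) else v.reg,
          ![c.1, c.2, 1]⟩) := by
  have h0 : ((v.setCnt 0 0).setCnt 1 0).setCnt 2 1 = ⟨v.reg, ![0, 0, 1]⟩ := by
    refine Mem.ext rfl ?_
    funext i
    fin_cases i <;> simp [Mem.setCnt]
  rw [compare]
  simp only [Proc.sem_seq, Proc.sem_onView, Cmd.sem, PMF.pure_bind]
  rw [h0, sem_rounds hf hg q n u w D v.reg (0, 0), PMF.bind_map, ← PMF.bind_pure_comp]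
  congr 1
  funext c
  change PMF.bind (PMF.pure _) _ = PMF.pure _
  rw [PMF.pure_bind]
  change Proc.sem (bif (if c.2 < c.1 then true else false) then _ else _) D _ = _
  by_cases h : c.2 < c.1
  · simp only [if_pos h, cond_true, Proc.sem_onView, Cmd.sem, o.copy_apply, Mem.setReg]
  · simp only [if_neg h, cond_false]
    rfl

/-! ### The tournament -/

/-- The winner among `2 ^ h` guesses, in the register `w`; the registers `s j` with `j < h` are
used for intermediate results. -/
def tournament (N : ℕ → ℕ) (w : L) (s : ℕ → L) : ℕ → (ℕ → R) →
    Proc Ω (Mem.restrict (R := R) f g) Unit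
  | 0, x => Proc.onView f g hf hg (.const w (x 0) ())
  | h + 1, x =>
    (tournament N w s h x).seq <| (Proc.onView f g hf hg (.op o.copy (s h) w w ())).seq <|
    (tournament N w s h fun i => x (i + 2 ^ h)).seq <| compare o hf hg q (N h) (s h) w

theorem tournament_preserves (N : ℕ → ℕ) (w : L) (s : ℕ → L) (h : ℕ) (x : ℕ → R)
    (D : PMF (R × R)) (v : Mem R L (Fin 3)) :
    ∀ y ∈ ((tournament o hf hg q N w s h x).sem D v).support, ∀ l, l ≠ w →
      (∀ j < h, l ≠ s j) → y.2.reg l = v.reg l := by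
  induction h generalizing x v with
  | zero =>
    intro y hy l hl _
    change y ∈ (PMF.pure _).support at hy
    rw [PMF.mem_support_pure_iff] at hy
    rw [hy, Mem.setReg_reg, if_neg hl]
  | succ h ih =>
    intro y hy l hl hj
    rw [tournament] at hy
    simp only [Proc.sem_seq, Proc.sem_onView, Cmd.sem, PMF.pure_bind, sem_compare,
      PMF.mem_support_bind_iff, PMF.mem_support_map_iff] at hy
    obtain ⟨y₁, h1, y₂, h2, c, -, rfl⟩ := hy
    have e1 := ih _ _ y₁ h1 l hl fun j hj' => hj j (by omega)
    have e2 := ih _ _ y₂ h2 l hl fun j hj' => hj j (by omega)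
    rw [Mem.setReg_reg, if_neg (hj h (by omega)), e1] at e2
    dsimp only
    split_ifs
    · rw [Function.update_of_ne hl, e2]
    · exact e2

theorem tournament_fails {N : ℕ → ℕ} {w : L} {s : ℕ → L} {δ : ℝ} (hδ : 0 < δ) (D : PMF (R × R))
    (Good : R → Prop) (hgood : ∀ x y, Good x → ¬ Good y →
      (q.β D y true).toReal + δ ≤ (q.β D x true).toReal) {H : ℕ}
    (hsw : ∀ j < H, s j ≠ w) (hs : ∀ i < H, ∀ j < i, s i ≠ s j) (h : ℕ) (hH : h ≤ H) (x : ℕ → R)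
    (hx : ∃ i < 2 ^ h, Good (x i)) (v : Mem R L (Fin 3)) :
    ((tournament o hf hg q N w s h x).sem D v).toOuterMeasure {y | ¬ Good (y.2.reg w)} ≤
      ∑ j ∈ Finset.range h, failProb δ (N j) := by
  induction h generalizing x v with
  | zero =>
    obtain ⟨i, hi, hgi⟩ := hx
    obtain rfl : i = 0 := by simpa using hi
    refine (toOuterMeasure_eq_zero_of_support _ ?_).le.trans zero_le
    intro y hy
    change y ∈ (PMF.pure _).support at hy
    rw [PMF.mem_support_pure_iff] at hy
    rw [hy, Set.mem_ofPred_eq, Mem.setReg_reg, if_pos rfl, not_not]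
    exact hgi
  | succ h ih =>
    have hsh := hsw h (by omega)
    have hcmp : ∀ v : Mem R L (Fin 3), Good (v.reg (s h)) ∨ Good (v.reg w) →
        ((compare o hf hg q (N h) (s h) w).sem D v).toOuterMeasure {y | ¬ Good (y.2.reg w)} ≤
          failProb δ (N h) := by
      intro v hv
      rw [sem_compare, PMF.toOuterMeasure_map_apply]
      by_cases h1 : Good (v.reg (s h))
      · by_cases h2 : Good (v.reg w)
        · refine (toOuterMeasure_eq_zero_of_support _ ?_).le.trans zero_le
          intro c _
          simp only [Set.mem_preimage, Set.mem_ofPred_eq, not_not]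
          split_ifs
          · simpa using h1
          · exact h2
        · refine le_trans (MeasureTheory.measure_mono ?_) (score_fst_le _ _ hδ (hgood _ _ h1 h2) _)
          intro c hc
          simp only [Set.mem_preimage, Set.mem_ofPred_eq] at hc ⊢
          by_contra hlt
          rw [if_pos (by omega)] at hc
          exact hc (by simpa using h1)
      · have h2 : Good (v.reg w) := hv.resolve_left h1
        refine le_trans (MeasureTheory.measure_mono ?_) (score_snd_le _ _ hδ (hgood _ _ h2 h1) _)
        intro c hc
        simp only [Set.mem_preimage, Set.mem_ofPred_eq] at hc ⊢
        by_contra hlt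
        rw [if_neg hlt] at hc
        exact hc h2
    rw [tournament, Finset.sum_range_succ]
    simp only [Proc.sem_seq, Proc.sem_onView, Cmd.sem, PMF.pure_bind]
    obtain ⟨i, hi, hgi⟩ := hx
    by_cases hi' : i < 2 ^ h
    · refine toOuterMeasure_bind_le _ _ (ih (by omega) x ⟨i, hi', hgi⟩ v) fun y hy hyg => ?_
      rw [← zero_add (failProb δ (N h))]
      refine toOuterMeasure_bind_le (B₁ := {z | ¬ Good (z.2.reg (s h))}) _ _
        (toOuterMeasure_eq_zero_of_support _ ?_).le fun z hz hzg => hcmp _ (.inl ?_)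
      · intro z hz
        rw [Set.mem_ofPred_eq, not_not, tournament_preserves o hf hg q N w s h _ D _ z hz (s h) hsh
          (fun j hj => hs h (by omega) j hj), Mem.setReg_reg, if_pos rfl, o.copy_apply]
        simpa using hyg
      · simpa using hzg
    · rw [← zero_add (∑ j ∈ Finset.range h, failProb δ (N j)), add_assoc]
      refine toOuterMeasure_bind_le (B₁ := ∅) _ _ (by simp) fun y hy _ => ?_
      refine toOuterMeasure_bind_le _ _ (ih (by omega) _ ⟨i - 2 ^ h, by rw [pow_succ] at hi; omega,
        by rwa [Nat.sub_add_cancel (by omega)]⟩ _) fun z hz hzg => hcmp _ (.inr ?_)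
      simpa using hzg

theorem cost_tournament (N : ℕ → ℕ) (w : L) (s : ℕ → L) {a b : ℕ} (hN : ∀ h, N h = a * (b + h))
    (h : ℕ) (x : ℕ → R) :
    (tournament o hf hg q N w s h x).cost + a * (2 * q.cost + 4) * (b + h + 1) + 8 ≤
      (a * (2 * q.cost + 4) * (b + 1) + 9) * 2 ^ h := by
  induction h generalizing x with
  | zero =>
    change 1 + _ + 8 ≤ _
    rw [pow_zero, mul_one, add_zero]
    omega
  | succ h ih =>
    rw [tournament]
    simp only [Proc.cost_seq, Proc.cost_onView, cost_compare, hN]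
    have h1 := ih x
    have h2 := ih fun i => x (i + 2 ^ h)
    rw [pow_succ]
    generalize (tournament o hf hg q N w s h x).cost = c1 at *
    generalize (tournament o hf hg q N w s h fun i => x (i + 2 ^ h)).cost = c2 at *
    generalize 2 ^ h = p at *
    generalize 2 * q.cost + 4 = k at *
    have e : a * (b + h) * k = a * k * (b + h) := by ring
    rw [e]
    generalize a * k = z at *
    nlinarith

end

/-! ### Recovering the secret -/

section

variable {R : Type u} [CommRing R] [Finite R] {Ω : Set (R → R → R)} {ι κ L : Type}
  [DecidableEq ι] [DecidableEq κ] [DecidableEq L] {f : L → ι} {g : Fin 3 → κ}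
  (o : RingOps Ω) (hf : Function.Injective f) (hg : Function.Injective g)

/-- Finds the winner of a tournament, multiplies it by `e`, applies `τ` and adds the result to the
register `acc`. -/
def component (q : Query Ω f g) (N : ℕ → ℕ) (w tmp acc : L) (s : ℕ → L) (H : ℕ) (x : ℕ → R)
    (e : R) (τ : Ω) : Proc Ω (Mem.restrict (R := R) f g) Unit :=
  (tournament o hf hg q N w s H x).seq <|
  (Proc.onView f g hf hg (.const tmp e ())).seq <|
  (Proc.onView f g hf hg (.op o.mul tmp w tmp ())).seq <|
  (Proc.onView f g hf hg (.op τ tmp tmp tmp ())).seq <|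
  Proc.onView f g hf hg (.op o.add acc acc tmp ())

theorem component_fails {q : Query Ω f g} {N : ℕ → ℕ} {w tmp acc : L} {s : ℕ → L} {H : ℕ}
    {x : ℕ → R} {e G : R} {τ : Ω} {τ' : R → R} (hτ : ∀ a b, τ.1 a b = τ' a) {δ : ℝ} (hδ : 0 < δ)
    (D : PMF (R × R)) (hgood : ∀ x y, x * e = G → y * e ≠ G →
      (q.β D y true).toReal + δ ≤ (q.β D x true).toReal)
    (hsw : ∀ j < H, s j ≠ w) (hs : ∀ i < H, ∀ j < i, s i ≠ s j) (hacc : acc ≠ w)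
    (hsacc : ∀ j < H, acc ≠ s j) (htmp : acc ≠ tmp) (hwt : w ≠ tmp)
    (hx : ∃ i < 2 ^ H, x i * e = G) (v : Mem R L (Fin 3)) :
    ((component o hf hg q N w tmp acc s H x e τ).sem D v).toOuterMeasure
      {y | ¬ y.2.reg acc = v.reg acc + τ' G} ≤ ∑ j ∈ Finset.range H, failProb δ (N j) := by
  rw [component]
  simp only [Proc.sem_seq, Proc.sem_onView, Cmd.sem, PMF.pure_bind]
  rw [← add_zero (∑ j ∈ Finset.range H, failProb δ (N j))]
  refine toOuterMeasure_bind_le _ _ (tournament_fails o hf hg q hδ D (fun x => x * e = G)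
    hgood hsw hs H le_rfl x hx v) fun y hy hyg => ?_
  rw [PMF.toOuterMeasure_pure_apply, if_neg]
  rw [Set.mem_ofPred_eq, not_not] at hyg ⊢
  have := tournament_preserves o hf hg q N w s H x D v y hy acc hacc hsacc
  simp only [Mem.setReg_reg, if_neg htmp, if_neg hwt, o.mul_apply, o.add_apply, hτ, this, if_true,
    hyg]

theorem cost_component (q : Query Ω f g) (N : ℕ → ℕ) (w tmp acc : L) (s : ℕ → L) (H : ℕ)
    (x : ℕ → R) (e : R) (τ : Ω) : (component o hf hg q N w tmp acc s H x e τ).cost =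
      (tournament o hf hg q N w s H x).cost + 4 := by
  simp only [component, Proc.cost_seq, Proc.cost_onView]

theorem seqList_fails {J : Type*} (P : J → Proc Ω (Mem.restrict (R := R) f g) Unit) (acc : L)
    (D : PMF (R × R)) (G : J → R) (F : ENNReal) (hP : ∀ j v, ((P j).sem D v).toOuterMeasure
      {y | ¬ y.2.reg acc = v.reg acc + G j} ≤ F) (l : List J) (v : Mem R L (Fin 3)) :
    ((Proc.seqList _ (l.map P)).sem D v).toOuterMeasure
      {y | ¬ y.2.reg acc = v.reg acc + (l.map G).sum} ≤ l.length * F := by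
  induction l generalizing v with
  | nil =>
    rw [List.map_nil, Proc.sem_seqList_nil, PMF.toOuterMeasure_pure_apply, if_neg (by simp)]
    exact zero_le
  | cons j l ih =>
    rw [List.map_cons, Proc.sem_seqList_cons, List.length_cons, Nat.cast_add, Nat.cast_one,
      add_mul, one_mul, add_comm (_ * F) F]
    refine toOuterMeasure_bind_le _ _ (hP j v) fun y hy hyg => ?_
    rw [Set.mem_ofPred_eq, not_not] at hyg
    refine le_trans (le_of_eq ?_) (ih y.2)
    rw [hyg, List.map_cons, List.sum_cons, add_assoc]

end

section

theorem le_toReal_apply {α : Type*} (p : PMF α) (x : α) {δ : ℝ} (hδ : 0 ≤ δ)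
    (h : p.toOuterMeasure {y | ¬ y = x} ≤ ENNReal.ofReal δ) : 1 - δ ≤ (p x).toReal := by
  have h1 : (1 : ENNReal) ≤ p x + ENNReal.ofReal δ := by
    rw [← (p.toOuterMeasure_apply_eq_one_iff Set.univ).2 (Set.subset_univ _),
      ← p.toOuterMeasure_apply_singleton x]
    have : (Set.univ : Set α) = {x} ∪ {y | ¬ y = x} := by
      ext y
      simp [em]
    rw [this]
    exact (MeasureTheory.measure_union_le _ _).trans (by gcongr)
  have h2 := ENNReal.toReal_mono (by simp [p.apply_ne_top]) h1
  rw [ENNReal.toReal_add (p.apply_ne_top x) ENNReal.ofReal_ne_top, ENNReal.toReal_ofReal hδ,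
    ENNReal.toReal_one] at h2
  linarith

theorem failProb_le {δ : ℝ} (hδ : 0 < δ) {a : ℕ} (ha : 8 / δ ^ 2 ≤ a) (n : ℕ) :
    failProb δ (a * n) ≤ ENNReal.ofReal ((1 / 2) ^ n) := by
  rw [failProb, ← ENNReal.ofReal_pow (Real.exp_pos _).le]
  refine ENNReal.ofReal_le_ofReal ?_
  rw [pow_mul]
  refine pow_le_pow_left₀ (by positivity) ?_ n
  rw [← Real.exp_nat_mul]
  have h1 : 1 ≤ (a : ℝ) * (δ ^ 2 / 8) := by
    rw [div_le_iff₀ (by positivity)] at ha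
    linarith
  calc Real.exp (a * -(δ ^ 2 / 8)) ≤ Real.exp (-1) := Real.exp_le_exp.2 (by linarith)
    _ ≤ 1 / 2 := by
      rw [Real.exp_neg, one_div]
      exact inv_anti₀ (by norm_num) (by linarith [Real.add_one_le_exp (1 : ℝ)])

theorem sum_failProb_le {δ : ℝ} (hδ : 0 < δ) {a : ℕ} (ha : 8 / δ ^ 2 ≤ a) {k r : ℕ} (hk : k ≤ r)
    (H : ℕ) : k * ∑ j ∈ Finset.range H, failProb δ (a * (2 * r + 1 + j)) ≤
      ENNReal.ofReal ((1 / 2) ^ r) := by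
  have h1 : ∀ j, (0 : ℝ) ≤ (1 / 2) ^ j := fun j => by positivity
  calc k * ∑ j ∈ Finset.range H, failProb δ (a * (2 * r + 1 + j))
      ≤ k * ∑ j ∈ Finset.range H, ENNReal.ofReal ((1 / 2) ^ (2 * r + 1 + j)) := by
        gcongr with j _
        exact failProb_le hδ ha _
    _ = ENNReal.ofReal (k * ∑ j ∈ Finset.range H, (1 / 2) ^ (2 * r + 1 + j)) := by
        rw [ENNReal.ofReal_mul (by positivity), ENNReal.ofReal_natCast,
          ENNReal.ofReal_sum_of_nonneg fun j _ => h1 _]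
    _ ≤ ENNReal.ofReal ((1 / 2) ^ r) := by
        refine ENNReal.ofReal_le_ofReal ?_
        have h2 : ∑ j ∈ Finset.range H, (1 / 2 : ℝ) ^ (2 * r + 1 + j) ≤
            (1 / 2) ^ (2 * r) := by
          simp only [pow_add, ← Finset.mul_sum]
          have : ∑ j ∈ Finset.range H, (1 / 2 : ℝ) ^ j ≤ 2 := by
            rw [geom_sum_eq (by norm_num)]
            have := h1 H
            rw [div_le_iff_of_neg (by norm_num)]
            linarith
          have := h1 (2 * r)
          nlinarith
        have h3 : (k : ℝ) ≤ 2 ^ r := by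
          exact_mod_cast hk.trans (Nat.lt_two_pow_self).le
        calc (k : ℝ) * ∑ j ∈ Finset.range H, (1 / 2 : ℝ) ^ (2 * r + 1 + j)
            ≤ 2 ^ r * (1 / 2) ^ (2 * r) := by
              refine mul_le_mul h3 h2 (Finset.sum_nonneg fun j _ => h1 _) (by positivity)
          _ = (1 / 2) ^ r := by
              rw [two_mul, pow_add, ← mul_assoc, ← mul_pow]
              norm_num

end

section

variable {R : Type u} [CommRing R] [Finite R] {Ω : Set (R → R → R)} (A : Machine R Ω)

/-- The probability that `A` outputs `1` on hybrid samples with a uniform secret. -/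
def hybridProb (ψ : PMF R) (t : ℕ) (E : R) : ℝ :=
  (((unif R).bind fun s => (A.exec (hybrid ψ E s) t A.init).map A.result) (some 1)).toReal

theorem unif_bind_toReal {α β : Type*} [Fintype α] [Nonempty α] (F : α → PMF β) (b : β) :
    ((unif α).bind F b).toReal = (∑ a, (F a b).toReal) / Fintype.card α := by
  rw [PMF.bind_apply, tsum_fintype, ENNReal.toReal_sum fun a _ =>
    ENNReal.mul_ne_top (PMF.apply_ne_top _ _) (PMF.apply_ne_top _ _), Finset.sum_div]
  refine Finset.sum_congr rfl fun a _ => ?_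
  rw [ENNReal.toReal_mul, unif_apply, ENNReal.toReal_inv, ENNReal.toReal_natCast,
    Nat.card_eq_fintype_card]
  ring

theorem advantage_eq (ψ : PMF R) (t : ℕ) :
    A.advantage ψ t = 1 / 2 * (hybridProb A ψ t 0 - hybridProb A ψ t 1) := by
  let _ := Fintype.ofFinite R
  rw [Machine.advantage, Machine.avgProbOutput, hybridProb, hybridProb]
  simp only [hybrid_zero, hybrid_one, PMF.bind_const]
  rw [unif_bind_toReal]
  rfl

theorem hybridProb_nonneg (ψ : PMF R) (t : ℕ) (E : R) : 0 ≤ hybridProb A ψ t E :=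
  ENNReal.toReal_nonneg

theorem hybridProb_le_one (ψ : PMF R) (t : ℕ) (E : R) : hybridProb A ψ t E ≤ 1 :=
  ENNReal.toReal_le_of_le_ofReal zero_le_one (by
    rw [ENNReal.ofReal_one]
    exact PMF.coe_le_one _ _)

variable {A}

theorem accept_eq [Nontrivial R] {t : ℕ} {D : PMF (R × R)} {g : R → R} {e E x s : R} {E' : R}
    {ψ : PMF R} (h : ∀ s₀, guessSample D g e E x s₀ = hybrid ψ E' (s + s₀)) :
    (accept A t D g e E x true).toReal = hybridProb A ψ t E' := by
  classical
  rw [hybridProb, ← unif_bind_comp (AddGroup.addLeft_bijective s)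
    fun s => (A.exec (hybrid ψ E' s) t A.init).map A.result]
  simp only [accept, h, PMF.bind_apply]
  congr 1
  refine tsum_congr fun s₀ => ?_
  congr 1
  rw [PMF.map_apply, PMF.map_apply]
  refine tsum_congr fun c => ?_
  have : (true = decide ((A.result c).getD 0 = 1)) ↔ some 1 = A.result c := by
    rw [eq_comm, decide_eq_true_iff]
    cases A.result c <;> simp [eq_comm]
  by_cases hc : some 1 = A.result c
  · rw [if_pos (this.2 hc), if_pos hc]
  · rw [if_neg (mt this.1 hc), if_neg hc]

/-- Some hybrid step accounts for its share of the advantage. -/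
theorem exists_hybrid_gap {ψ : PMF R} {t : ℕ} {ε : ℝ} (hε : ε ≤ A.advantage ψ t) {k : ℕ}
    (hk : 0 < k) (e : Fin k → R) (he : ∑ i, e i = 1) :
    ∃ i : Fin k, hybridProb A ψ t ((∑ j ∈ Finset.univ.filter (· < i), e j) + e i) + 2 * ε / k ≤
      hybridProb A ψ t (∑ j ∈ Finset.univ.filter (· < i), e j) := by
  by_contra! hcon
  let E : ℕ → R := fun n => ∑ j ∈ Finset.univ.filter (fun j : Fin k => (j : ℕ) < n), e j
  have hE : ∀ i : Fin k, E (i + 1) = (∑ j ∈ Finset.univ.filter (· < i), e j) + e i := by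
    intro i
    have : Finset.univ.filter (fun j : Fin k => (j : ℕ) < i + 1) =
        insert i (Finset.univ.filter (· < i)) := by
      ext j
      simp only [Finset.mem_filter, Finset.mem_univ, true_and, Finset.mem_insert, Fin.lt_def,
        Fin.ext_iff]
      omega
    simp only [E]
    rw [this, Finset.sum_insert (by simp), add_comm]
  have hsum : ∀ n ≤ k, 0 < n →
      hybridProb A ψ t (E 0) - hybridProb A ψ t (E n) < n * (2 * ε / k) := by
    intro n hn hn0
    induction n with
    | zero => omega
    | succ n ih =>
      have h1 := hcon ⟨n, hn⟩
      rw [← hE] at h1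
      have h2 : (∑ j ∈ Finset.univ.filter (· < (⟨n, hn⟩ : Fin k)), e j) = E n := rfl
      rw [h2] at h1
      rcases Nat.eq_zero_or_pos n with rfl | hn1
      · push_cast
        simp only [zero_add, one_mul] at h1 ⊢
        linarith
      · have h3 := ih (by omega) hn1
        push_cast
        simp only at h1
        linarith
  have h0 : E 0 = 0 := by simp [E]
  have h1 : E k = 1 := by
    rw [← he]
    simp [E]
  have := hsum k le_rfl hk
  rw [h0, h1, mul_div_cancel₀ _ (by positivity)] at this
  rw [advantage_eq] at hε
  linarith

end

section

theorem exists_leaves {R : Type u} [CommRing R] [Finite R] (e : R) {n H : ℕ}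
    (hn : Nat.card (Set.range fun x : R => x * e) ≤ n) (hH : n ≤ 2 ^ H) :
    ∃ x : ℕ → R, ∀ y, ∃ i < 2 ^ H, x i * e = y * e := by
  let e1 := Finite.equivFin (Set.range fun x : R => x * e)
  have h1 : ∀ i, ∃ x : R, ∀ h : i < Nat.card (Set.range fun x : R => x * e),
      x * e = e1.symm ⟨i, h⟩ := by
    intro i
    by_cases h : i < Nat.card (Set.range fun x : R => x * e)
    · obtain ⟨x, hx⟩ := (e1.symm ⟨i, h⟩).2
      exact ⟨x, fun _ => hx⟩
    · exact ⟨0, fun h' => absurd h' h⟩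
  choose x hx using h1
  refine ⟨x, fun y => ⟨e1 ⟨y * e, y, rfl⟩, (e1 ⟨y * e, y, rfl⟩).2.trans_le (hn.trans hH), ?_⟩⟩
  rw [hx _ (e1 ⟨y * e, y, rfl⟩).2]
  exact congrArg Subtype.val (e1.symm_apply_apply ⟨y * e, y, rfl⟩)

variable {R : Type u} [CommRing R] [Finite R] [Nontrivial R] {Ω : Set (R → R → R)}
  {A : Machine R Ω}

/-- The query that runs the machine `A` for a guess of the component of `e` of the image of the
secret under `γ`. -/
def callQuery (L : Type) [DecidableEq L] (o : RingOps Ω) (γ : Ω) (g : R → R)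
    (hγ : ∀ x y, γ.1 x y = g x) (e E : R) {t : ℕ} (ht : A.RunsIn t) :
    Query Ω (.inr ∘ .inr ∘ some : L → A.ι ⊕ Fin 4 ⊕ Option L) (.inr : Fin 3 → A.κ ⊕ Fin 3) where
  proc l := call o γ g hγ e E ht l
  β D x := accept A t D g e E x
  sem_proc _ _ _ := rfl
  cost := 19 * (t + 1) + 1
  cost_proc l := cost_call o γ g hγ e E ht l

/-- A distinguisher yields an algorithm that recovers the secret, when the ring operations and
automorphisms that preserve the error distribution and permute the components of the ring
transitively are available. -/
theorem exists_search (o : RingOps Ω) {ψ : PMF R} {t : ℕ} (ht : A.RunsIn t) {ε : ℝ} (hε0 : 0 < ε)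
    (hε : ε ≤ A.advantage ψ t) {k r n : ℕ} (hk : 0 < k) (hkr : k ≤ r) (hn : 1 ≤ n)
    {e : Fin k → R} (he : CompleteOrthogonalIdempotents e)
    (hfield : ∀ i x, e i * x ≠ 0 → ∃ w, e i * x * w = e i)
    (hcard : ∀ i, Nat.card (Set.range fun x : R => x * e i) ≤ n)
    (haut : ∀ i, ∃ (σ τ : Fin k → R →+* R) (σ' τ' : Fin k → Ω),
      (∀ j x y, (σ' j).1 x y = σ j x) ∧ (∀ j x y, (τ' j).1 x y = τ j x) ∧
      (∀ j, Function.Bijective (σ j)) ∧ (∀ j x, τ j (σ j x) = x) ∧ (∀ j, ψ.map (σ j) = ψ) ∧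
      ∑ j, τ j (e i) = 1) :
    ∃ (B : Machine R Ω) (t' : ℕ), (t' : ℝ) ≤ 2100 * ((k : ℝ) ^ 3 * r * n * t / ε ^ 2) ∧
      B.RunsIn t' ∧
      ∀ s : R, 1 - (1 / 2 : ℝ) ^ r ≤ B.probOutput (sampleDist ψ s) t' s := by
  obtain ⟨i, hi⟩ := exists_hybrid_gap hε hk e he.complete
  obtain ⟨σ, τ, σ', τ', hσ', hτ', hσ, hτσ, hψ, hsum⟩ := haut i
  set E := ∑ j ∈ Finset.univ.filter (· < i), e j with hEdef
  have heE : e i * E = 0 := by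
    rw [hEdef, Finset.mul_sum]
    refine Finset.sum_eq_zero fun j hj => he.ortho ?_
    rw [Finset.mem_filter] at hj
    exact hj.2.ne'
  have hEE : E * E = E := by
    have : ∀ j ∈ Finset.univ.filter (· < i), e j * E = e j := by
      intro j hj
      rw [hEdef, Finset.mul_sum, Finset.sum_eq_single j (fun l _ hl => he.ortho hl.symm)
        (fun h => absurd hj h)]
      exact he.idem j
    conv_lhs => rw [hEdef, Finset.sum_mul]
    exact Finset.sum_congr rfl this
  set δ : ℝ := 2 * ε / k with hδdef
  have hk0 : (0 : ℝ) < k := by exact_mod_cast hk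
  have hδ : 0 < δ := by positivity
  have hε1 : ε ≤ 1 / 2 := by
    have h1 := hybridProb_le_one A ψ t 0
    have h2 := hybridProb_nonneg A ψ t 1
    rw [advantage_eq] at hε
    linarith
  obtain ⟨H, hH1, hH2⟩ : ∃ H, n ≤ 2 ^ H ∧ 2 ^ H ≤ 2 * n :=
    ⟨Nat.log 2 n + 1, (Nat.lt_pow_succ_log_self (by norm_num) n).le, by
      rw [pow_succ]
      linarith [Nat.pow_log_le_self 2 (show n ≠ 0 by omega)]⟩
  obtain ⟨x, hx⟩ := exists_leaves (e i) (hcard i) hH1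
  set a : ℕ := ⌈8 / δ ^ 2⌉₊ with hadef
  have ha : 8 / δ ^ 2 ≤ a := Nat.le_ceil _
  let L := Fin 3 ⊕ Fin (H + 1)
  let N : ℕ → ℕ := fun h => a * (2 * r + 1 + h)
  let w : L := .inl 0
  let tmp : L := .inl 1
  let acc : L := .inl 2
  let s : ℕ → L := fun j => .inr (Fin.ofNat (H + 1) j)
  have hf : Function.Injective (.inr ∘ .inr ∘ some : L → A.ι ⊕ Fin 4 ⊕ Option L) :=
    Sum.inr_injective.comp (Sum.inr_injective.comp (Option.some_injective _))
  have hg : Function.Injective (.inr : Fin 3 → A.κ ⊕ Fin 3) := Sum.inr_injective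
  have hs : ∀ i < H, ∀ j < i, s i ≠ s j := by
    intro i hi j hj h
    have h1 := congrArg Fin.val (Sum.inr_injective h)
    simp only [Fin.val_ofNat] at h1
    rw [Nat.mod_eq_of_lt (by omega), Nat.mod_eq_of_lt (by omega)] at h1
    omega
  let q : Fin k → Query Ω (.inr ∘ .inr ∘ some : L → A.ι ⊕ Fin 4 ⊕ Option L)
      (.inr : Fin 3 → A.κ ⊕ Fin 3) :=
    fun j => callQuery L o (σ' j) (σ j) (hσ' j) (e i) E ht
  let P : Fin k → Proc Ω (Mem.restrict (R := R)
      (.inr ∘ .inr ∘ some : L → A.ι ⊕ Fin 4 ⊕ Option L) (.inr : Fin 3 → A.κ ⊕ Fin 3)) Unit :=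
    fun j => component o hf hg (q j) N w tmp acc s H x (e i) (τ' j)
  let P' := Proc.seqList _ ((List.finRange k).map P)
  let out : A.ι ⊕ Fin 4 ⊕ Option L := .inr (.inr (some acc))
  refine ⟨P'.toMachine out, P'.cost + 1 + Fintype.card (A.ι ⊕ Fin 4 ⊕ Option L) +
    Fintype.card (A.κ ⊕ Fin 3), ?_, P'.runsIn_toMachine out le_rfl, fun S => ?_⟩
  · have ht1 : 1 ≤ t := by
      have h1 : 0 < Fintype.card A.σ := Fintype.card_pos_iff.2 ⟨A.start⟩
      have h2 := ht.1
      rw [Machine.size] at h2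
      omega
    have hsize : Fintype.card A.ι + Fintype.card A.κ ≤ t := by
      have h2 := ht.1
      rw [Machine.size] at h2
      omega
    have ha1 : 1 ≤ a := Nat.ceil_pos.2 (by positivity)
    have hr1 : 1 ≤ r := by omega
    have hP : ∀ j, (P j).cost ≤ 680 * (a * t * r * n) := by
      intro j
      have h1 := cost_tournament o hf hg (q j) N w s (a := a) (b := 2 * r + 1) (fun _ => rfl) H x
      have h2 : 2 * (q j).cost + 4 ≤ 82 * t := by
        change 2 * (19 * (t + 1) + 1) + 4 ≤ _
        omega
      have h3 : (a * (2 * (q j).cost + 4) * (2 * r + 1 + 1) + 9) * 2 ^ H ≤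
          (a * (82 * t) * (4 * r) + 9 * (a * t * r)) * (2 * n) := by
        refine Nat.mul_le_mul (Nat.add_le_add (Nat.mul_le_mul (Nat.mul_le_mul le_rfl h2)
          (by omega)) ?_) hH2
        have : 1 ≤ a * t * r := Nat.one_le_iff_ne_zero.2 (by positivity)
        omega
      have h4 : (a * (82 * t) * (4 * r) + 9 * (a * t * r)) * (2 * n) = 674 * (a * t * r * n) := by
        ring
      have h5 : 1 ≤ a * t * r * n := Nat.one_le_iff_ne_zero.2 (by positivity)
      change (component o hf hg (q j) N w tmp acc s H x (e i) (τ' j)).cost ≤ _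
      rw [cost_component]
      omega
    have hP' : P'.cost ≤ k * (680 * (a * t * r * n)) + 1 := by
      change (Proc.seqList _ _).cost ≤ _
      rw [Proc.cost_seqList, List.map_map]
      refine Nat.add_le_add_right ?_ 1
      refine (List.sum_le_card_nsmul _ (680 * (a * t * r * n)) ?_).trans ?_
      · intro y hy
        obtain ⟨j, -, rfl⟩ := List.mem_map.1 hy
        exact hP j
      · simp
    have hcard' : P'.cost + 1 + Fintype.card (A.ι ⊕ Fin 4 ⊕ Option L) +
        Fintype.card (A.κ ⊕ Fin 3) ≤ 700 * (k * a * t * r * n) := by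
      have c1 : Fintype.card (A.ι ⊕ Fin 4 ⊕ Option L) = Fintype.card A.ι + (4 + (H + 5)) := by
        simp [L]
        omega
      have c2 : Fintype.card (A.κ ⊕ Fin 3) = Fintype.card A.κ + 3 := by simp
      have h1 : k * (680 * (a * t * r * n)) = 680 * (k * a * t * r * n) := by ring
      have h2 : t ≤ k * a * t * r * n := by
        calc t = 1 * 1 * t * 1 * 1 := by ring
          _ ≤ k * a * t * r * n := by gcongr <;> omega
      have h3 : n ≤ k * a * t * r * n := by
        calc n = 1 * 1 * 1 * 1 * n := by ring
          _ ≤ k * a * t * r * n := by gcongr <;> omega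
      have h4 : H < 2 ^ H := Nat.lt_two_pow_self
      rw [c1, c2]
      omega
    have ha2 : (a : ℝ) ≤ 3 * (k ^ 2 / ε ^ 2) := by
      have h1 : (a : ℝ) < 8 / δ ^ 2 + 1 := Nat.ceil_lt_add_one (by positivity)
      have h2 : 8 / δ ^ 2 = 2 * (k ^ 2 / ε ^ 2) := by
        rw [hδdef]
        field_simp
        norm_num
      have h3 : 1 ≤ (k : ℝ) ^ 2 / ε ^ 2 := by
        rw [one_le_div (by positivity)]
        have : (1 : ℝ) ≤ k := by exact_mod_cast hk
        nlinarith
      linarith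
    calc ((P'.cost + 1 + Fintype.card (A.ι ⊕ Fin 4 ⊕ Option L) +
          Fintype.card (A.κ ⊕ Fin 3) : ℕ) : ℝ) ≤ ((700 * (k * a * t * r * n) : ℕ) : ℝ) := by
          exact_mod_cast hcard'
      _ = 700 * (k * t * r * n) * a := by push_cast; ring
      _ ≤ 700 * (k * t * r * n) * (3 * (k ^ 2 / ε ^ 2)) := by gcongr
      _ = _ := by ring
  · rw [P'.probOutput_toMachine out (by omega) _ (fun v => v.reg acc) (fun _ => rfl)]
    refine le_toReal_apply _ _ (by positivity) ?_
    rw [PMF.toOuterMeasure_map_apply]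
    have hfail := seqList_fails P acc (sampleDist ψ S) (fun j => τ j (σ j S * e i))
      (∑ j ∈ Finset.range H, failProb δ (N j)) (fun j v => ?_) (List.finRange k)
      (Mem.restrict
        (.inr ∘ .inr ∘ some : L → A.ι ⊕ Fin 4 ⊕ Option L) (.inr : Fin 3 → A.κ ⊕ Fin 3)
        (Mem.zero R _ _))
    · have hG : ((List.finRange k).map fun j => τ j (σ j S * e i)).sum = S := by
        rw [← List.ofFn_eq_map, List.sum_ofFn]
        simp only [map_mul, hτσ]
        rw [← Finset.mul_sum, hsum, mul_one]
      rw [hG, List.length_finRange] at hfail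
      refine (le_trans (le_of_eq ?_) hfail).trans (sum_failProb_le hδ ha hkr H)
      congr 1
      ext y
      simp [Mem.restrict, Mem.zero]
    · refine component_fails o hf hg (hτ' j) hδ _ ?_ (fun _ _ => by simp [s]) hs
        (fun h => absurd (Sum.inl_injective h) (by decide)) (fun _ _ => by simp [s]) 
          (fun h => absurd (Sum.inl_injective h) (by decide))
        (fun h => absurd (Sum.inl_injective h) (by decide)) (hx _) v
      intro y z hy hz
      have hgy : ∀ s₀, guessSample (sampleDist ψ S) (σ j) (e i) E y s₀ =
          hybrid ψ E (σ j S + s₀) := fun s₀ => guessSample_of_eq (hσ j) (hψ j) (by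
        rw [mul_comm, hy, mul_comm])
      obtain ⟨w, hw⟩ := hfield i (z - σ j S) (by
        intro h
        refine hz ?_
        linear_combination h)
      have hgz : ∀ s₀, guessSample (sampleDist ψ S) (σ j) (e i) E z s₀ =
          hybrid ψ (E + e i) (σ j S + s₀) := fun s₀ =>
        guessSample_of_ne (hσ j) (hψ j) (he.idem i) hEE heE hw
      change (accept A t _ (σ j) (e i) E z true).toReal + δ ≤
        (accept A t _ (σ j) (e i) E y true).toReal
      rw [accept_eq hgy, accept_eq hgz]
      exact hi

end

section

variable {R : Type u} [CommRing R] [Finite R] [IsReduced R]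

open Classical in
/-- The idempotent of a finite reduced ring that belongs to a maximal ideal. -/
def maximalIdempotent (m : MaximalSpectrum R) : R :=
  (IsArtinianRing.equivPi R).symm (Pi.single m 1)

open Classical in
theorem mk_maximalIdempotent (m m' : MaximalSpectrum R) :
    Ideal.Quotient.mk m'.asIdeal (maximalIdempotent m) = if m = m' then 1 else 0 := by
  have h := congrFun ((IsArtinianRing.equivPi R).apply_symm_apply (Pi.single m 1)) m'
  rw [IsArtinianRing.equivPi_apply] at h
  refine h.trans ?_
  by_cases h1 : m = m'
  · subst h1
    rw [Pi.single_eq_same, if_pos rfl]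
  · rw [Pi.single_eq_of_ne (Ne.symm h1), if_neg h1]

theorem eq_of_mk_eq {x y : R}
    (h : ∀ m : MaximalSpectrum R, Ideal.Quotient.mk m.asIdeal x = Ideal.Quotient.mk m.asIdeal y) :
    x = y :=
  (IsArtinianRing.equivPi R).injective (funext h)

theorem completeOrthogonalIdempotents_maximalIdempotent [Fintype (MaximalSpectrum R)] :
    CompleteOrthogonalIdempotents (maximalIdempotent (R := R)) where
  idem m := eq_of_mk_eq fun m' => by
    rw [map_mul, mk_maximalIdempotent]
    split_ifs <;> simp
  ortho m₁ m₂ h := eq_of_mk_eq fun m' => by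
    simp only [map_mul, mk_maximalIdempotent, map_zero]
    split_ifs with h1 h2
    · exact absurd (h1.trans h2.symm) h
    all_goals simp
  complete := eq_of_mk_eq fun m' => by
    rw [map_sum, map_one, Finset.sum_eq_single m']
    · rw [mk_maximalIdempotent, if_pos rfl]
    · intro m _ hm
      rw [mk_maximalIdempotent, if_neg hm]
    · exact fun h => absurd (Finset.mem_univ _) h

theorem eq_maximalIdempotent (m : MaximalSpectrum R) {x : R} (h1 : x - 1 ∈ m.asIdeal)
    (h2 : ∀ P : Ideal R, P.IsMaximal → P ≠ m.asIdeal → x ∈ P) : x = maximalIdempotent m := by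
  refine eq_of_mk_eq fun m' => ?_
  rw [mk_maximalIdempotent]
  split_ifs with h
  · subst h
    rw [← map_one (Ideal.Quotient.mk m.asIdeal)]
    exact Ideal.Quotient.eq.2 h1
  · exact Ideal.Quotient.eq_zero_iff_mem.2
      (h2 _ m'.isMaximal fun h' => h (MaximalSpectrum.ext h'.symm))

theorem exists_mul_eq_maximalIdempotent (m : MaximalSpectrum R) {x : R}
    (h : maximalIdempotent m * x ≠ 0) : ∃ w, maximalIdempotent m * x * w = maximalIdempotent m := by
  have hx : Ideal.Quotient.mk m.asIdeal x ≠ 0 := by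
    intro hx
    refine h (eq_of_mk_eq fun m' => ?_)
    rw [map_mul, mk_maximalIdempotent]
    split_ifs with h1
    · rw [← h1, hx]
      simp
    · simp
  let := Ideal.Quotient.field m.asIdeal
  obtain ⟨w, hw⟩ := Ideal.Quotient.mk_surjective (Ideal.Quotient.mk m.asIdeal x)⁻¹
  refine ⟨w, eq_of_mk_eq fun m' => ?_⟩
  rw [map_mul, map_mul, mk_maximalIdempotent]
  split_ifs with h1
  · subst h1
    rw [hw, one_mul, mul_inv_cancel₀ hx]
  · simp

theorem card_range_mul_maximalIdempotent (m : MaximalSpectrum R) :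
    Nat.card (Set.range fun x : R => x * maximalIdempotent m) = Nat.card (R ⧸ m.asIdeal) := by
  refine Nat.card_congr (Equiv.ofBijective
    (fun y : Set.range fun x : R => x * maximalIdempotent m =>
      Ideal.Quotient.mk m.asIdeal y.1) ⟨?_, fun y => ?_⟩)
  · rintro ⟨_, x, rfl⟩ ⟨_, y, rfl⟩ h
    refine Subtype.ext (eq_of_mk_eq fun m' => ?_)
    simp only [map_mul, mk_maximalIdempotent] at h ⊢
    split_ifs with h1
    · subst h1
      simpa using h
    · simp
  · obtain ⟨x, rfl⟩ := Ideal.Quotient.mk_surjective y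
    exact ⟨⟨_, x, rfl⟩, by simp [mk_maximalIdempotent]⟩

open Pointwise in
theorem exists_smul_maximalIdempotent (F G : Type*) [Field F] [Algebra F R] [Group G] [Finite G]
    [MulSemiringAction G R] [SMulCommClass G F R] [Algebra.IsInvariant F R G]
    (m m' : MaximalSpectrum R) : ∃ g : G, g • maximalIdempotent m = maximalIdempotent m' := by
  have := m.isMaximal.isPrime
  have := m'.isMaximal.isPrime
  obtain ⟨g, hg⟩ := Algebra.IsInvariant.exists_smul_of_under_eq F R G m.asIdeal m'.asIdeal (by
    have h1 : ∀ P : Ideal R, P.IsPrime → P.under F = ⊥ := fun P hP =>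
      (Ideal.eq_bot_or_top _).resolve_right (hP.under F).ne_top
    rw [h1 _ this, h1 _ ‹_›])
  refine ⟨g, eq_maximalIdempotent m' ?_ fun P hP hPm => ?_⟩
  · have h1 : g • maximalIdempotent m - 1 = g • (maximalIdempotent m - 1) := by
      rw [smul_sub, smul_one]
    rw [h1, hg]
    refine Ideal.smul_mem_pointwise_smul _ _ _ (Ideal.Quotient.eq.1 ?_)
    rw [mk_maximalIdempotent, if_pos rfl, map_one]
  · have hP' : (g⁻¹ • P).IsMaximal := by
      have := hP.isPrime
      have : (g⁻¹ • P).IsPrime := inferInstance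
      exact IsArtinianRing.isMaximal_of_isPrime _
    rw [← Ideal.mem_inv_pointwise_smul_iff, ← Ideal.Quotient.eq_zero_iff_mem]
    have h1 := mk_maximalIdempotent m ⟨g⁻¹ • P, hP'⟩
    rw [if_neg] at h1
    · exact h1
    · rintro rfl
      exact hPm (by rw [hg, smul_inv_smul])

theorem exists_idempotents (F G : Type*) [Field F] [Algebra F R] [Group G] [Finite G]
    [MulSemiringAction G R] [SMulCommClass G F R] [Algebra.IsInvariant F R G] {n : ℕ}
    (hn : ∀ m : MaximalSpectrum R, Nat.card (R ⧸ m.asIdeal) = n) :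
    ∃ (k : ℕ) (e : Fin k → R), Nat.card R = n ^ k ∧ CompleteOrthogonalIdempotents e ∧
      (∀ i x, e i * x ≠ 0 → ∃ w, e i * x * w = e i) ∧
      (∀ i, Nat.card (Set.range fun x : R => x * e i) ≤ n) ∧
      ∀ i j, ∃ g : G, g • e i = e j := by
  let := Fintype.ofFinite (MaximalSpectrum R)
  let E := Fintype.equivFin (MaximalSpectrum R)
  refine ⟨_, maximalIdempotent ∘ E.symm, ?_,
    (CompleteOrthogonalIdempotents.equiv E.symm).2 completeOrthogonalIdempotents_maximalIdempotent,
    fun i x => exists_mul_eq_maximalIdempotent _,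
    fun i => ((card_range_mul_maximalIdempotent _).trans (hn _)).le,
    fun i j => exists_smul_maximalIdempotent F G _ _⟩
  rw [Nat.card_congr (IsArtinianRing.equivPi R).toEquiv, Nat.card_pi]
  simp [hn]

end

theorem trace_ne_zero_of_normal {F R G : Type*} [Field F] [CommRing R] [Algebra F R] [Group G]
    [MulSemiringAction G R] [Fintype G] {c : R} (hli : LinearIndependent F fun g : G => g • c) :
    ∑ g : G, g • c ≠ 0 := by
  intro h
  have := Fintype.linearIndependent_iff.1 hli (fun _ => 1) (by simpa using h) 1
  exact one_ne_zero this

section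

variable {F R G : Type*} [Field F] [CommRing R] [Algebra F R] [Group G] [MulSemiringAction G R]
  [SMulCommClass G F R] [Fintype G] {c : R}

theorem exists_smul_trace_eq (hli : LinearIndependent F fun g : G => g • c)
    (hspan : Submodule.span F (Set.range fun g : G => g • c) = ⊤) {x : R}
    (hx : ∀ g : G, g • x = x) : ∃ a : F, x = a • ∑ g : G, g • c := by
  let b := Module.Basis.mk hli hspan.ge
  have hb : ∀ g, b g = g • c := fun g => Module.Basis.mk_apply hli hspan.ge g
  refine ⟨b.repr x 1, ?_⟩
  have h1 : ∀ h : G, b.repr x h = b.repr x 1 := by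
    intro h
    have h2 : h • ∑ g, b.repr x g • b g = ∑ g, b.repr x (h⁻¹ * g) • b g := by
      rw [Finset.smul_sum, ← Equiv.sum_comp (Equiv.mulLeft h) fun g => b.repr x (h⁻¹ * g) • b g]
      refine Finset.sum_congr rfl fun g _ => ?_
      rw [smul_comm, hb, Equiv.coe_mulLeft, hb, inv_mul_cancel_left, mul_smul]
    rw [b.sum_repr, hx] at h2
    have h3 := congrArg (fun y => b.repr y h) h2
    simp only [b.repr_sum_self, inv_mul_cancel] at h3
    exact h3
  conv_lhs => rw [← b.sum_repr x]
  rw [Finset.smul_sum]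
  refine Finset.sum_congr rfl fun g _ => ?_
  rw [h1, hb]

theorem isInvariant_of_normal (hli : LinearIndependent F fun g : G => g • c)
    (hspan : Submodule.span F (Set.range fun g : G => g • c) = ⊤) : Algebra.IsInvariant F R G where
  isInvariant x hx := by
    obtain ⟨a, ha⟩ := exists_smul_trace_eq hli hspan hx
    obtain ⟨b, hb⟩ := exists_smul_trace_eq hli hspan (x := 1) fun g => smul_one g
    rcases eq_or_ne b 0 with rfl | hb0
    · rw [zero_smul] at hb
      have := subsingleton_of_zero_eq_one hb.symm
      exact ⟨0, Subsingleton.elim _ _⟩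
    · refine ⟨a * b⁻¹, ?_⟩
      rw [Algebra.algebraMap_eq_smul_one, hb, smul_smul, inv_mul_cancel_right₀ hb0, ha]

/-- Every linear form on a finite-dimensional algebra with suitable symmetries is a scaled
trace. -/
theorem exists_trace_mul_eq [Module.Finite F R] [Algebra.IsInvariant F R G] [Nontrivial R]
    (hli : LinearIndependent F fun g : G => g • c) {k : ℕ} {e : Fin k → R}
    (he : CompleteOrthogonalIdempotents e)
    (hfield : ∀ i x, e i * x ≠ 0 → ∃ w, e i * x * w = e i)
    (htrans : ∀ i j, ∃ g : G, g • e i = e j) (l : R →ₗ[F] F) :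
    ∃ c' : R, ∀ x, ∑ g : G, g • (c' * x) = algebraMap F R (l x) := by
  have hfix : ∀ x : R, ∃ a : F, algebraMap F R a = ∑ g : G, g • x := fun x =>
    Algebra.IsInvariant.isInvariant (G := G) _ fun h => by
      rw [Finset.smul_sum]
      simp only [smul_smul]
      exact Equiv.sum_comp (Equiv.mulLeft h) fun g => g • x
  choose t' ht' using hfix
  have hinj := (algebraMap F R).injective
  let t : R →ₗ[F] F :=
    { toFun := t'
      map_add' := fun x y => hinj (by
        simp only [map_add, ht', smul_add, Finset.sum_add_distrib])
      map_smul' := fun a x => hinj (by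
        rw [ht', RingHom.id_apply, smul_eq_mul, map_mul, ht', ← Algebra.smul_def, Finset.smul_sum]
        exact Finset.sum_congr rfl fun g _ => smul_comm _ _ _) }
  have ht : ∀ x, algebraMap F R (t x) = ∑ g : G, g • x := ht'
  let T : R →ₗ[F] R →ₗ[F] F := (LinearMap.mul F R).compr₂ t
  have hT : ∀ y x, T y x = t (y * x) := fun _ _ => rfl
  have hTinj : Function.Injective T := by
    rw [injective_iff_map_eq_zero]
    intro y hy
    by_contra hy0
    have hN : ∀ x, t (y * x) = 0 := fun x => by rw [← hT, hy]; rfl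
    obtain ⟨i, hi⟩ : ∃ i, e i * y ≠ 0 := by
      by_contra! h
      refine hy0 ?_
      rw [← one_mul y, ← he.complete, Finset.sum_mul]
      exact Finset.sum_eq_zero fun i _ => h i
    obtain ⟨w, hw⟩ := hfield i y hi
    have hsmul : ∀ (g : G) x, t (g • x) = t x := fun g x => hinj (by
      rw [ht, ht]
      simp only [smul_smul]
      exact Equiv.sum_comp (Equiv.mulRight g) fun h => h • x)
    have h1 : ∀ j x, t (e j * x) = 0 := by
      intro j x
      obtain ⟨g, hg⟩ := htrans i j
      have : e j * x = g • (e i * g⁻¹ • x) := by rw [smul_mul', hg, smul_inv_smul]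
      rw [this, hsmul, ← hw]
      have : e i * y * w * g⁻¹ • x = y * (e i * w * g⁻¹ • x) := by ring
      rw [this, hN]
    refine trace_ne_zero_of_normal hli ?_
    rw [← ht, ← one_mul c, ← he.complete, Finset.sum_mul, map_sum,
      Finset.sum_eq_zero fun j _ => h1 j c, map_zero]
  obtain ⟨c', hc'⟩ := (LinearMap.injective_iff_surjective_of_finrank_eq_finrank
    (Subspace.dual_finrank_eq (K := F) (V := R)).symm).1 hTinj l
  exact ⟨c', fun x => by rw [← ht, ← hT, hc']⟩

end

namespace GaloisModulus

section

variable {F : Type u} [Field F] {K : Type v} [Field K] [Algebra F K] [Algebra F[X] K]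
  [Algebra (RatFunc F) K] [IsScalarTower F F[X] K] [IsScalarTower F[X] (RatFunc F) K]
  {f : F[X]} {d : ℕ} (M : GaloisModulus K f d)

theorem intAct_one (x : OK F K) : intAct (1 : Gal(K/RatFunc F)) x = x :=
  Subtype.ext rfl

theorem intAct_mul (g h : Gal(K/RatFunc F)) (x : OK F K) :
    intAct (g * h) x = intAct g (intAct h x) :=
  Subtype.ext rfl

theorem intAct_smul (g : Gal(K/RatFunc F)) (a : F) (x : OK F K) :
    intAct g (a • x) = a • intAct g x := by
  refine Subtype.ext ?_
  have h : ∀ z : K, a • z = (algebraMap F F[X] a) • z := fun z => (algebraMap_smul F[X] a z).symm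
  change (g.restrictScalars F[X]) (a • x.1) = a • (g.restrictScalars F[X]) x.1
  rw [h, map_smul, h]

theorem residueAct_mk (Q : F[X]) (g : Gal(K/RatFunc F)) (x : OK F K) :
    residueAct Q g (Ideal.Quotient.mk _ x) = Ideal.Quotient.mk _ (intAct g x) :=
  rfl

theorem exists_iso_symm_mk (x : AdjoinRoot f) :
    ∃ y : OK F K, M.iso.symm (Ideal.Quotient.mk _ y) = x := by
  obtain ⟨y, hy⟩ := Ideal.Quotient.mk_surjective (M.iso x)
  exact ⟨y, by rw [hy, AlgEquiv.symm_apply_apply]⟩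

theorem act_iso_symm_mk (g : Gal(K/RatFunc F)) (y : OK F K) :
    M.act g (M.iso.symm (Ideal.Quotient.mk _ y)) =
      M.iso.symm (Ideal.Quotient.mk _ (intAct g y)) := by
  rw [act, AlgEquiv.apply_symm_apply, residueAct_mk]

/-- The action of the Galois group on `F[X]/(f)`. -/
@[reducible]
def mulSemiringAction : MulSemiringAction Gal(K/RatFunc F) (AdjoinRoot f) where
  smul := M.act
  one_smul x := by
    obtain ⟨y, rfl⟩ := M.exists_iso_symm_mk x
    exact (M.act_iso_symm_mk 1 y).trans (by rw [intAct_one])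
  mul_smul g h x := by
    obtain ⟨y, rfl⟩ := M.exists_iso_symm_mk x
    change M.act _ _ = M.act _ (M.act _ _)
    simp only [act_iso_symm_mk, intAct_mul]
  smul_zero g := by
    change M.act g 0 = 0
    simp only [act, map_zero]
  smul_add g x y := by
    change M.act g (x + y) = M.act g x + M.act g y
    simp only [act, map_add]
  smul_one g := by
    change M.act g 1 = 1
    simp only [act, map_one]
  smul_mul g x y := by
    change M.act g (x * y) = M.act g x * M.act g y
    simp only [act, map_mul]

theorem act_smul (g : Gal(K/RatFunc F)) (a : F) (x : AdjoinRoot f) :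
    M.act g (a • x) = a • M.act g x := by
  obtain ⟨y, rfl⟩ := M.exists_iso_symm_mk x
  have h : ∀ z : OK F K, a • M.iso.symm (Ideal.Quotient.mk _ z) =
      M.iso.symm (Ideal.Quotient.mk _ (a • z)) := fun z => by
    rw [← map_smul]
    rfl
  rw [h, act_iso_symm_mk, act_iso_symm_mk, intAct_smul, h]

theorem Q_ne_zero : M.Q ≠ 0 := by
  intro h
  have := M.natDegree_Q
  rw [h, natDegree_zero] at this
  exact absurd this (by norm_num)

theorem isMaximal_span_Q : (Ideal.span {M.Q}).IsMaximal := by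
  have : Irreducible M.Q := irreducible_of_degree_eq_one
    ((degree_eq_iff_natDegree_eq_of_pos one_pos).2 M.natDegree_Q)
  exact PrincipalIdealRing.isMaximal_of_irreducible this

theorem map_span_Q : (Ideal.span {M.Q}).map (algebraMap F[X] (OK F K)) = modIdeal F K M.Q := by
  rw [Ideal.map_span, Set.image_singleton]

theorem liesOver {P : Ideal (OK F K)} (hP : P.IsPrime) (h : modIdeal F K M.Q ≤ P) :
    P.LiesOver (Ideal.span {M.Q}) := by
  refine ⟨(M.isMaximal_span_Q.eq_of_le (hP.under F[X]).ne_top ?_)⟩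
  rw [← map_span_Q, Ideal.map_le_iff_le_comap] at h
  exact h

variable [FunctionField F K] [IsGalois (RatFunc F) K]

theorem isRadical_modIdeal : (modIdeal F K M.Q).IsRadical := by
  classical
  have h0 : (Ideal.span {M.Q}).map (algebraMap F[X] (OK F K)) ≠ ⊥ := by
    rw [map_span_Q, Ne, Ideal.span_singleton_eq_bot]
    exact fun h => M.Q_ne_zero
      (FunctionField.ringOfIntegers.algebraMap_injective F K (h.trans (map_zero _).symm))
  have hsq : Squarefree (modIdeal F K M.Q) := by
    rw [UniqueFactorizationMonoid.squarefree_iff_nodup_normalizedFactors (by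
      rw [← map_span_Q]; exact h0), Multiset.nodup_iff_count_le_one]
    intro P
    by_cases hP : P ∈ UniqueFactorizationMonoid.normalizedFactors (modIdeal F K M.Q)
    · have hP1 : P.IsPrime := Ideal.isPrime_of_prime
        (UniqueFactorizationMonoid.prime_of_normalized_factor P hP)
      have hle : modIdeal F K M.Q ≤ P := Ideal.le_of_dvd
        (UniqueFactorizationMonoid.dvd_of_mem_normalizedFactors hP)
      have hlo := M.liesOver hP1 hle
      have h1 := M.unramified P ⟨hP1, hlo⟩
      rw [Ideal.IsDedekindDomain.ramificationIdx_eq_normalizedFactors_count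
        (Ideal.span {M.Q}) P h0, map_span_Q] at h1
      exact h1.le
    · rw [Multiset.count_eq_zero_of_notMem hP]
      exact zero_le_one
  intro x hx
  obtain ⟨n, hn⟩ := hx
  rw [← Ideal.dvd_span_singleton] at hn ⊢
  rw [← Ideal.span_singleton_pow] at hn
  exact hsq.isRadical n _ hn

theorem isReduced (M : GaloisModulus K f d) : IsReduced (AdjoinRoot f) := by
  have := (Ideal.isRadical_iff_quotient_reduced _).1 M.isRadical_modIdeal
  exact isReduced_of_injective M.iso M.iso.injective

theorem card_quotient (M : GaloisModulus K f d) [Finite F] (m : Ideal (AdjoinRoot f)) [hm : m.IsMaximal] :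
    Nat.card (AdjoinRoot f ⧸ m) = Nat.card F ^ d := by
  let φ : OK F K →+* AdjoinRoot f ⧸ m := (Ideal.Quotient.mk m).comp
    ((M.iso.symm : _ →+* AdjoinRoot f).comp (Ideal.Quotient.mk (modIdeal F K M.Q)))
  have hφ : Function.Surjective φ := fun x => by
    obtain ⟨x, rfl⟩ := Ideal.Quotient.mk_surjective x
    obtain ⟨y, rfl⟩ := M.exists_iso_symm_mk x
    exact ⟨y, rfl⟩
  let := Ideal.Quotient.field m
  have hmax : (RingHom.ker φ).IsMaximal := RingHom.ker_isMaximal_of_surjective φ hφ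
  have hle : modIdeal F K M.Q ≤ RingHom.ker φ := fun x hx => by
    rw [RingHom.mem_ker]
    change Ideal.Quotient.mk m (M.iso.symm (Ideal.Quotient.mk _ x)) = 0
    rw [Ideal.Quotient.eq_zero_iff_mem.2 hx, map_zero, map_zero]
  have hlo := M.liesOver hmax.isPrime hle
  have hQ := M.isMaximal_span_Q
  have hfin : Module.Finite F[X] (OK F K) := IsIntegralClosure.finite F[X] (RatFunc F) K _
  have h1 := Ideal.cardQuot_pow_inertiaDeg (R := F[X]) (Ideal.span {M.Q}) (RingHom.ker φ)
  rw [M.inertia _ ⟨hmax.isPrime, hlo⟩] at h1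
  rw [← Nat.card_congr (RingHom.quotientKerEquivOfSurjective hφ).toEquiv]
  refine h1.symm.trans ?_
  congr 1
  have : Module.Finite F (AdjoinRoot M.Q) := (AdjoinRoot.powerBasis M.Q_ne_zero).finite
  refine (Module.natCard_eq_pow_finrank (K := F) (V := AdjoinRoot M.Q)).trans ?_
  rw [(AdjoinRoot.powerBasis M.Q_ne_zero).finrank, AdjoinRoot.powerBasis_dim, M.natDegree_Q,
    pow_one]

end

end GaloisModulus

/-! ### Distinguishing with a search algorithm -/

section

variable {R : Type u} [CommRing R] [Finite R] {Ω : Set (R → R → R)} {ι κ C : Type}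
  [DecidableEq ι] [DecidableEq κ] [DecidableEq C] {f : Fin 4 → ι} {g : C → κ}

/-- Adds the image of the register `2` under an operation to the register `3`, with the
register `1` as scratch space. -/
def addImage (hf : Function.Injective f) (hg : Function.Injective g) (o : RingOps Ω) (γ : Ω) :
    Proc Ω (Mem.restrict (R := R) f g) Unit :=
  (Proc.onView f g hf hg (.op γ 1 2 2 ())).seq (Proc.onView f g hf hg (.op o.add 3 3 1 ()))

theorem sem_addImages (hf : Function.Injective f) (hg : Function.Injective g) (o : RingOps Ω)
    {J : Type*} (γ : J → Ω) (γ' : J → R → R) (hγ : ∀ j x y, (γ j).1 x y = γ' j x) (l : List J)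
    (D : PMF (R × R)) (v : Mem R (Fin 4) C) : ∃ v' : Mem R (Fin 4) C,
      (Proc.seqList _ (l.map fun j => addImage hf hg o (γ j))).sem D v = PMF.pure ((), v') ∧
      v'.reg 3 = v.reg 3 + (l.map fun j => γ' j (v.reg 2)).sum ∧ v'.reg 0 = v.reg 0 := by
  induction l generalizing v with
  | nil => exact ⟨v, rfl, by simp, rfl⟩
  | cons j l ih =>
    obtain ⟨v', h1, h2, h3⟩ := ih ((v.setReg 1 (γ' j (v.reg 2))).setReg 3
      (v.reg 3 + γ' j (v.reg 2)))
    refine ⟨v', ?_, ?_, ?_⟩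
    · rw [List.map_cons, Proc.sem_seqList_cons, ← h1, addImage]
      simp only [Proc.sem_seq, Proc.sem_onView, Cmd.sem, PMF.pure_bind, hγ, o.add_apply]
      simp [Mem.setReg_reg]
    · rw [h2]
      simp [Mem.setReg_reg, add_assoc]
    · rw [h3]
      simp [Mem.setReg_reg]

/-- Draws a sample, subtracts the guess in the register `0`, and tests whether the sum of the
images of the multiple of the difference by `c` vanishes. The answer replaces the guess. -/
def verify (hf : Function.Injective f) (hg : Function.Injective g) (o : RingOps Ω) (c : R)
    {r : ℕ} (γ : Fin r → Ω) : Proc Ω (Mem.restrict (R := R) f g) Unit :=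
  (Proc.onView f g hf hg (.sample 1 2 ())).seq <|
  (Proc.onView f g hf hg (.op o.mul 1 1 0 ())).seq <|
  (Proc.onView f g hf hg (.op o.sub 2 2 1 ())).seq <|
  (Proc.onView f g hf hg (.const 1 c ())).seq <|
  (Proc.onView f g hf hg (.op o.mul 2 1 2 ())).seq <|
  (Proc.onView f g hf hg (.const 3 0 ())).seq <|
  (Proc.seqList _ ((List.finRange r).map fun j => addImage hf hg o (γ j))).seq <|
  (Proc.onView f g hf hg (.const 0 0 ())).seq <|
  (Proc.onView f g hf hg (.test 3 0 true false)).bind fun b =>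
    Proc.onView f g hf hg (.const 0 (if b = true then 1 else 0) ())

theorem cost_verify (hf : Function.Injective f) (hg : Function.Injective g) (o : RingOps Ω) (c : R)
    {r : ℕ} (γ : Fin r → Ω) : (verify hf hg o c γ).cost = 2 * r + 11 := by
  have h1 : ∀ j, (addImage hf hg o (γ j)).cost = 2 := fun j => by
    simp [addImage, Proc.cost_seq, Proc.cost_onView]
  simp only [verify, Proc.cost_seq, Proc.cost_onView, Proc.cost_seqList, Proc.bind]
  simp [Function.comp_def, h1]
  ring

open Classical in
theorem sem_verify (hf : Function.Injective f) (hg : Function.Injective g) (o : RingOps Ω) (c : R)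
    {r : ℕ} (γ : Fin r → Ω) (γ' : Fin r → R → R) (hγ : ∀ j x y, (γ j).1 x y = γ' j x)
    (D : PMF (R × R)) (v : Mem R (Fin 4) C) :
    ((verify hf hg o c γ).sem D v).map (fun y => y.2.reg 0) = D.map fun x =>
      if ∑ j, γ' j (c * (x.2 - x.1 * v.reg 0)) = 0 then 1 else 0 := by
  simp only [verify, Proc.sem_seq, Proc.sem_onView, Cmd.sem, PMF.pure_bind, PMF.bind_map,
    PMF.map_bind]
  rw [← PMF.bind_pure_comp]
  congr 1
  funext x
  obtain ⟨v', h1, h2, h3⟩ := sem_addImages hf hg o γ γ' hγ (List.finRange r) D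
    (((((((v.setReg 1 x.1).setReg 2 x.2).setReg 1 (x.1 * v.reg 0)).setReg 2
      (x.2 - x.1 * v.reg 0)).setReg 1 c).setReg 2 (c * (x.2 - x.1 * v.reg 0))).setReg 3 0)
  simp only [Mem.setReg_reg, Fin.reduceEq, if_true, if_false, zero_add] at h2 h3
  rw [← List.ofFn_eq_map, List.sum_ofFn] at h2
  simp only [Function.comp_apply, o.mul_apply, o.sub_apply, Mem.setReg_reg, Fin.reduceEq, if_true,
    if_false]
  rw [h1]
  simp only [Proc.bind, Proc.sem_onView, Cmd.sem, PMF.pure_bind, PMF.pure_map, Mem.setReg_reg,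
    Fin.reduceEq, if_true, if_false, h2]
  split_ifs <;> simp_all

end

section

theorem le_bind_apply {α β : Type*} (p : PMF α) (F : α → PMF β) (y : β) (s : α) {δ ε : ENNReal}
    (h : ∀ x, δ ≤ F x y) (hs : δ + ε ≤ F s y) : δ + ε * p s ≤ p.bind F y := by
  classical
  rw [PMF.bind_apply]
  calc δ + ε * p s = ∑' x, p x * (δ + if x = s then ε else 0) := by
        simp only [mul_add]
        rw [ENNReal.tsum_add, ENNReal.tsum_mul_right, p.tsum_coe, one_mul, tsum_eq_single s
          (fun x hx => by rw [if_neg hx, mul_zero]), if_pos rfl, mul_comm]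
    _ ≤ ∑' x, p x * F x y := by
        refine ENNReal.tsum_le_tsum fun x => mul_le_mul_right ?_ _
        split_ifs with hx
        · exact hx ▸ hs
        · simpa using h x

variable {R F : Type*} [CommRing R] [Finite R] [Field F] [Finite F] [Algebra F R]
  (l : R →ₗ[F] F)

theorem unif_map_sub_mul (hl : Function.Surjective l) (s : R) :
    (unif (R × R)).map (fun x => l (x.2 - x.1 * s)) = unif F := by
  let h : R × R →+ F :=
    { toFun := fun x => l (x.2 - x.1 * s)
      map_zero' := by simp
      map_add' := fun x y => by
        rw [← map_add]
        congr 1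
        simp only [Prod.snd_add, Prod.fst_add]
        ring }
  exact unif_map_of_surjective h fun a => by
    obtain ⟨b, rfl⟩ := hl a
    exact ⟨(0, b), by simp [h]⟩

theorem sampleDist_map_sub_mul (ψ : PMF R) (s s' : R) :
    (sampleDist ψ s).map (fun x => l (x.2 - x.1 * s')) =
      ψ.bind fun e => (unif R).map fun a => l (a * (s - s')) + l e := by
  simp only [sampleDist, PMF.map_bind, PMF.map_comp]
  simp only [← PMF.bind_pure_comp]
  rw [PMF.bind_comm]
  congr 1; funext e; congr 1; funext a
  simp only [Function.comp_apply]
  rw [← map_add]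
  congr 2
  ring

theorem sampleDist_map_sub_mul_self (ψ : PMF R) (s : R) :
    (sampleDist ψ s).map (fun x => l (x.2 - x.1 * s)) = ψ.map l := by
  rw [sampleDist_map_sub_mul]
  simp only [sub_self, mul_zero, map_zero, zero_add, ← PMF.bind_pure_comp, Function.comp_def,
    PMF.bind_const]

theorem le_sampleDist_map_apply_zero (ψ : PMF R) (hψ : (Nat.card F : ENNReal)⁻¹ ≤ ψ.map l 0)
    (s s' : R) : (Nat.card F : ENNReal)⁻¹ ≤
      (sampleDist ψ s).map (fun x => l (x.2 - x.1 * s')) 0 := by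
  rw [sampleDist_map_sub_mul]
  let h : R →ₗ[F] F := l.comp (LinearMap.mulRight F (s - s'))
  by_cases hh : h = 0
  · have : ∀ a, l (a * (s - s')) = 0 := fun a => LinearMap.congr_fun hh a
    simp only [this, zero_add, ← PMF.bind_pure_comp, Function.comp_def, PMF.bind_const] at hψ ⊢
    exact hψ
  · have hs : Function.Surjective h := LinearMap.surjective hh
    have : ∀ e, (unif R).map (fun a => l (a * (s - s')) + l e) = unif F := fun e => by
      have h1 : (unif R).map h = unif F := unif_map_of_surjective h.toAddMonoidHom hs
      rw [← unif_map_of_bijective (AddGroup.addRight_bijective (l e)), ← h1, PMF.map_comp]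
      rfl
    simp only [this, PMF.bind_const, unif_apply, le_refl]

end

section

variable {R : Type u} [CommRing R] [Finite R] [Nontrivial R] {Ω : Set (R → R → R)}
  {B : Machine R Ω}

/-- A search algorithm yields a distinguisher, when the values of a suitable linear form can be
computed. -/
theorem exists_distinguisher {F : Type*} [Field F] [Finite F] [Algebra F R] (o : RingOps Ω)
    {ψ : PMF R} {t : ℕ} (ht : B.RunsIn t) {η : ℝ} (hη : η ≤ B.avgProbOutput ψ t fun s => s)
    (l : R →ₗ[F] F) (hl : Function.Surjective l) {c : R} {r : ℕ} (γ : Fin r → Ω)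
    (γ' : Fin r → R → R) (hγ : ∀ j x y, (γ j).1 x y = γ' j x)
    (hc : ∀ x, ∑ j, γ' j (c * x) = algebraMap F R (l x))
    {δ : ℝ} (hδ : 1 / (Nat.card F : ℝ) ≤ δ) (hψ : ψ.map l 0 = ENNReal.ofReal δ) :
    ∃ (A : Machine R Ω) (t' : ℕ), t' ≤ 40 * (r + t) ∧ A.RunsIn t' ∧
      1 / 2 * η * (δ - 1 / (Nat.card F : ℝ)) ≤ A.advantage ψ t' := by
  classical
  have hf : Function.Injective (.inr ∘ .inr : Fin 4 → B.ι ⊕ Fin 0 ⊕ Fin 4) :=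
    Sum.inr_injective.comp Sum.inr_injective
  have hg : Function.Injective (.inr : Fin 0 → B.κ ⊕ Fin 0) := Sum.inr_injective
  let fin : B.ι → Proc Ω (simView B (T := Fin 0) (L := Fin 4) (C := Fin 0)) Unit := fun i =>
    (Proc.cmd (.op o.copy (.inr (.inr 0)) (.inl i) (.inl i) ())).coarsen (simView B)
      (fun _ v => PMF.pure ((), (v.1, v.2.setReg 0 (v.1.reg i)))) (fun D m => by
        simp only [Proc.cmd, Cmd.sem, PMF.pure_map, o.copy_apply, Prod.map, id]
        congr 2
        simp [simView, Mem.setReg, Mem.restrict, Function.comp_def])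
  let sim := simulate (A := B) (T := Fin 0) (L := Fin 4) (C := Fin 0) (S := fun D _ => D)
    (φ := fun x v => ((), v.setReg 0 x)) (smp := fun i j => simCmd B (.sample i j ()))
    (fin := fin) (K := 1)
    (hsmp := fun i j D v => by
      change PMF.map _ (PMF.map _ _) = _
      rw [PMF.map_comp]
      rfl)
    (hfin := fun i D v => PMF.pure_map _ _)
    (cost_simBody_le le_rfl (fun _ _ => le_rfl) fun _ => le_rfl) ht
  let P := sim.seq (verify hf hg o c γ)
  let out : B.ι ⊕ Fin 0 ⊕ Fin 4 := .inr (.inr 0)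
  have hPcost : P.cost = 2 * (t + 1) + (2 * r + 11) := by
    rw [Proc.cost_seq, cost_verify]
    change t + 1 + (t + 1) * 1 + _ = _
    ring
  have hprob : ∀ D, (P.toMachine out).probOutput D
      (P.cost + 1 + Fintype.card (B.ι ⊕ Fin 0 ⊕ Fin 4) + Fintype.card (B.κ ⊕ Fin 0)) 1 =
      (((B.exec D t B.init).bind fun x => D.map fun y =>
        l (y.2 - y.1 * (B.result x).getD 0)) 0).toReal := by
    intro D
    rw [P.probOutput_toMachine out (by omega) _ (fun v => v.reg 0) (fun _ => rfl), Proc.sem_seq,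
      PMF.map_bind]
    change (((PMF.map _ (B.exec D t B.init)).bind _) _).toReal = _
    rw [PMF.bind_map, PMF.bind_apply, PMF.bind_apply]
    congr 1
    refine tsum_congr fun x => ?_
    congr 1
    simp only [Function.comp_apply]
    rw [sem_verify hf hg o c γ γ' hγ, PMF.map_apply, PMF.map_apply]
    refine tsum_congr fun y => ?_
    have h1 : ∀ z : R, ((1 : R) = if ∑ j, γ' j (c * z) = 0 then 1 else 0) ↔ (0 : F) = l z := by
      intro z
      rw [hc, map_eq_zero_iff _ (algebraMap F R).injective]
      split_ifs with h
      · simp [h]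
      · simp [Ne.symm h]
    simp only [h1, Mem.setReg_reg, if_true]
  refine ⟨P.toMachine out, _, ?_, P.runsIn_toMachine out le_rfl, ?_⟩
  · have h2 := ht.1
    have h1 : 0 < Fintype.card B.σ := Fintype.card_pos_iff.2 ⟨B.start⟩
    rw [Machine.size] at h2
    rw [hPcost]
    simp
    omega
  · have hq : (0 : ℝ) ≤ 1 / Nat.card F := by positivity
    have hqE : (Nat.card F : ENNReal)⁻¹ = ENNReal.ofReal (1 / Nat.card F) := by
      rw [one_div, ENNReal.ofReal_inv_of_pos (by exact_mod_cast Nat.card_pos),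
        ENNReal.ofReal_natCast]
    have hunif : (P.toMachine out).probOutput (unif (R × R))
        (P.cost + 1 + Fintype.card (B.ι ⊕ Fin 0 ⊕ Fin 4) + Fintype.card (B.κ ⊕ Fin 0)) 1 =
        1 / Nat.card F := by
      rw [hprob]
      simp only [unif_map_sub_mul l hl, PMF.bind_const, unif_apply]
      rw [hqE, ENNReal.toReal_ofReal hq]
    have hsample : ∀ s, 1 / (Nat.card F : ℝ) + (δ - 1 / (Nat.card F : ℝ)) *
        B.probOutput (sampleDist ψ s) t s ≤ (P.toMachine out).probOutput (sampleDist ψ s)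
        (P.cost + 1 + Fintype.card (B.ι ⊕ Fin 0 ⊕ Fin 4) + Fintype.card (B.κ ⊕ Fin 0)) 1 := by
      intro s
      have h1 := le_bind_apply ((B.exec (sampleDist ψ s) t B.init).map B.result)
        (fun x => (sampleDist ψ s).map fun y => l (y.2 - y.1 * x.getD 0)) 0 (some s)
        (δ := ENNReal.ofReal (1 / Nat.card F)) (ε := ENNReal.ofReal (δ - 1 / Nat.card F))
        (fun x => by
          rw [← hqE]
          refine le_sampleDist_map_apply_zero l ψ ?_ s _
          rw [hψ, hqE]
          exact ENNReal.ofReal_le_ofReal hδ)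
        (by
          rw [Option.getD_some, sampleDist_map_sub_mul_self, hψ, ← ENNReal.ofReal_add hq
            (sub_nonneg.2 hδ), add_sub_cancel])
      rw [PMF.bind_map] at h1
      have h2 := ENNReal.toReal_mono (PMF.apply_ne_top _ _) h1
      rw [ENNReal.toReal_add ENNReal.ofReal_ne_top
        (ENNReal.mul_ne_top ENNReal.ofReal_ne_top (PMF.apply_ne_top _ _)), ENNReal.toReal_mul,
        ENNReal.toReal_ofReal hq, ENNReal.toReal_ofReal (sub_nonneg.2 hδ)] at h2
      rw [hprob]
      exact h2
    let := Fintype.ofFinite R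
    have havg : 1 / (Nat.card F : ℝ) + (δ - 1 / (Nat.card F : ℝ)) *
        B.avgProbOutput ψ t (fun s => s) ≤ (P.toMachine out).avgProbOutput ψ
        (P.cost + 1 + Fintype.card (B.ι ⊕ Fin 0 ⊕ Fin 4) + Fintype.card (B.κ ⊕ Fin 0))
        fun _ => 1 := by
      have hc0 : (0 : ℝ) < Fintype.card R := by exact_mod_cast Fintype.card_pos
      rw [Machine.avgProbOutput, Machine.avgProbOutput, le_div_iff₀ hc0, add_mul, mul_assoc,
        div_mul_cancel₀ _ hc0.ne']
      refine le_trans (le_of_eq ?_) (Finset.sum_le_sum fun s _ => hsample s)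
      rw [Finset.sum_add_distrib, Finset.mul_sum, Finset.sum_const, Finset.card_univ, nsmul_eq_mul]
      ring
    rw [Machine.advantage, hunif]
    have := mul_le_mul_of_nonneg_left hη (sub_nonneg.2 hδ)
    linarith

end

section

variable {G F : Type*} [Finite G] [Fintype F] (μ : PMF F)

theorem iidFamily_apply [Fintype G] (e : G → F) : iidFamily G μ e = ∏ g, μ (e g) := by
  change (@Finset.prod G ENNReal _ (@Finset.univ G (Fintype.ofFinite G)) fun g => μ (e g)) = _
  rw [Subsingleton.elim (Fintype.ofFinite G) ‹Fintype G›]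

theorem iidFamily_map_comp (E : G ≃ G) : (iidFamily G μ).map (fun e => e ∘ E) = iidFamily G μ := by
  let := Fintype.ofFinite G
  ext e
  rw [PMF.map_apply, tsum_eq_single (e ∘ E.symm), if_pos, iidFamily_apply, iidFamily_apply]
  · exact Equiv.prod_comp E.symm fun g => μ (e g)
  · simp [Function.comp_assoc]
  · intro e' he'
    rw [if_neg]
    rintro rfl
    exact he' (by simp [Function.comp_assoc])

theorem iidFamily_map_eval (g : G) : (iidFamily G μ).map (fun e => e g) = μ := by
  classical
  let := Fintype.ofFinite G
  ext a
  have h1 : ∑ x, μ x = 1 := (tsum_fintype _).symm.trans μ.tsum_coe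
  rw [PMF.map_apply, tsum_fintype]
  have h2 : ∀ e : G → F, (if a = e g then iidFamily G μ e else 0) =
      ∏ h, if h = g then (if a = e h then μ (e h) else 0) else μ (e h) := by
    intro e
    rw [iidFamily_apply, ← Finset.mul_prod_erase _ _ (Finset.mem_univ g),
      ← Finset.mul_prod_erase _ (fun h => if h = g then (if a = e h then μ (e h) else 0)
        else μ (e h)) (Finset.mem_univ g), if_pos rfl, Finset.prod_congr rfl
        (fun h hh => if_neg (Finset.ne_of_mem_erase hh))]
    split_ifs <;> simp
  simp only [h2]
  rw [← Fintype.piFinset_univ, ← Finset.prod_univ_sum (fun _ => Finset.univ)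
    (fun h x => if h = g then (if a = x then μ x else 0) else μ x),
    Finset.prod_eq_single g (fun h _ hh => by simp [hh, h1]) (by simp)]
  simp

theorem qBernoulli_apply_zero (F : Type u) [Field F] [Fintype F] (p : ℝ) (hp0 : 0 ≤ p)
    (hp : p < 1 / 2) : qBernoulli F p hp0 hp 0 = ENNReal.ofReal (1 - p) := by
  rw [qBernoulli, PMF.ofFintype_apply, if_pos rfl]

end

namespace GaloisModulus

section

variable {F : Type u} [Field F] {K : Type v} [Field K] [Algebra F K] [Algebra F[X] K]
  [Algebra (RatFunc F) K] [IsScalarTower F F[X] K] [IsScalarTower F[X] (RatFunc F) K]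
  {f : F[X]} {d : ℕ} (M : GaloisModulus K f d) {c : AdjoinRoot f}

theorem act_mul (g h : Gal(K/RatFunc F)) (x : AdjoinRoot f) :
    M.act (g * h) x = M.act g (M.act h x) :=
  M.mulSemiringAction.mul_smul g h x

theorem act_one (x : AdjoinRoot f) : M.act 1 x = x :=
  M.mulSemiringAction.one_smul x

/-- An element of the Galois group as an endomorphism of `F[X]/(f)`. -/
def actHom (g : Gal(K/RatFunc F)) : AdjoinRoot f →+* AdjoinRoot f :=
  (M.iso.symm : _ →+* AdjoinRoot f).comp ((residueAct M.Q g).comp (M.iso : AdjoinRoot f →+* _))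

theorem actHom_apply (g : Gal(K/RatFunc F)) (x : AdjoinRoot f) : M.actHom g x = M.act g x := rfl

theorem actHom_bijective (g : Gal(K/RatFunc F)) : Function.Bijective (M.actHom g) := by
  refine Function.bijective_iff_has_inverse.2 ⟨M.actHom g⁻¹, fun x => ?_, fun x => ?_⟩
  · rw [actHom_apply, actHom_apply, ← act_mul, inv_mul_cancel, act_one]
  · rw [actHom_apply, actHom_apply, ← act_mul, mul_inv_cancel, act_one]

variable {M}

/-- The normal basis. -/
def IsNormal.basis (hc : M.IsNormal c) : Module.Basis Gal(K/RatFunc F) F (AdjoinRoot f) :=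
  .mk hc.1 hc.2.ge

theorem IsNormal.basis_apply (hc : M.IsNormal c) (g : Gal(K/RatFunc F)) :
    hc.basis g = M.act g c :=
  Module.Basis.mk_apply _ _ _

variable [FunctionField F K]

theorem IsNormal.card_gal (hc : M.IsNormal c) [hf : Fact (0 < f.natDegree)] :
    Nat.card Gal(K/RatFunc F) = f.natDegree := by
  have h0 : f ≠ 0 := by
    rintro rfl
    simpa using hf.out
  rw [← Module.finrank_eq_nat_card_basis hc.basis, (AdjoinRoot.powerBasis h0).finrank,
    AdjoinRoot.powerBasis_dim]

theorem noise_map_actHom [Fintype F] (c : AdjoinRoot f) (p : ℝ) (hp0 : 0 ≤ p)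
    (hp : p < 1 / 2) (h : Gal(K/RatFunc F)) :
    (M.noise c p hp0 hp).map (M.actHom h) = M.noise c p hp0 hp := by
  let := Fintype.ofFinite Gal(K/RatFunc F)
  conv_rhs => rw [noise, ← iidFamily_map_comp _ (Equiv.mulLeft h⁻¹), PMF.map_comp]
  rw [noise, PMF.map_comp]
  congr 1
  funext e
  simp only [Function.comp_apply, map_sum, actHom_apply, act_smul, ← act_mul]
  rw [← Equiv.sum_comp (Equiv.mulLeft h)
    fun g => e (Equiv.mulLeft h⁻¹ g) • M.act g c]
  simp

theorem IsNormal.noise_map_coord [Fintype F] (hc : M.IsNormal c) (p : ℝ) (hp0 : 0 ≤ p)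
    (hp : p < 1 / 2) : (M.noise c p hp0 hp).map (hc.basis.coord 1) = qBernoulli F p hp0 hp := by
  let := Fintype.ofFinite Gal(K/RatFunc F)
  rw [← iidFamily_map_eval (qBernoulli F p hp0 hp) (1 : Gal(K/RatFunc F)), noise, PMF.map_comp]
  congr 1
  funext e
  simp only [Function.comp_apply, ← hc.basis_apply, Module.Basis.coord_apply]
  exact congrFun (hc.basis.repr_sum_self e) 1

theorem IsNormal.exists_idempotents [Fintype F] [IsGalois (RatFunc F) K] (hc : M.IsNormal c)
    [hf : Fact (0 < f.natDegree)] : ∃ (k : ℕ) (e : Fin k → AdjoinRoot f), d * k = f.natDegree ∧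
      CompleteOrthogonalIdempotents e ∧ (∀ i x, e i * x ≠ 0 → ∃ w, e i * x * w = e i) ∧
      (∀ i, Nat.card (Set.range fun x : AdjoinRoot f => x * e i) ≤ Fintype.card F ^ d) ∧
      (∀ i j, ∃ g, M.act g (e i) = e j) ∧
      ∀ l : AdjoinRoot f →ₗ[F] F, ∃ c' : AdjoinRoot f, ∀ x,
        ∑ j : Fin f.natDegree, M.act ((Finite.equivFinOfCardEq hc.card_gal).symm j) (c' * x) =
          algebraMap F (AdjoinRoot f) (l x) := by
  have h0 : f ≠ 0 := by
    rintro rfl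
    simpa using hf.out
  let := Fintype.ofFinite Gal(K/RatFunc F)
  let := M.mulSemiringAction
  have : SMulCommClass Gal(K/RatFunc F) F (AdjoinRoot f) := ⟨M.act_smul⟩
  have := M.isReduced
  have : Algebra.IsInvariant F (AdjoinRoot f) Gal(K/RatFunc F) := isInvariant_of_normal hc.1 hc.2
  have hfin : Module.Finite F (AdjoinRoot f) := (AdjoinRoot.powerBasis h0).finite
  have hnt : Nontrivial (AdjoinRoot f) := AdjoinRoot.nontrivial f (by
    rw [degree_eq_natDegree h0]
    exact_mod_cast hf.out.ne')
  obtain ⟨k, e, h1, h2, h3, h4, h5⟩ := RingLPN.exists_idempotents F Gal(K/RatFunc F)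
    (R := AdjoinRoot f) fun m => M.card_quotient m.asIdeal (hm := m.isMaximal)
  refine ⟨k, e, ?_, h2, h3, fun i => (h4 i).trans_eq (by rw [Nat.card_eq_fintype_card]), h5,
    fun l => ?_⟩
  · rw [Module.natCard_eq_pow_finrank (K := F), (AdjoinRoot.powerBasis h0).finrank,
      AdjoinRoot.powerBasis_dim, ← pow_mul] at h1
    exact (Nat.pow_right_injective (Finite.one_lt_card (α := F)) h1).symm
  · obtain ⟨c', hc'⟩ := exists_trace_mul_eq hc.1 h2 h3 h5 l
    refine ⟨c', fun x => ?_⟩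
    rw [← hc']
    exact Equiv.sum_comp (Finite.equivFinOfCardEq hc.card_gal).symm fun g => M.act g (c' * x)

variable (M) in
/-- The available operation that is given by an element of the Galois group. -/
def actOp {Ω : Set (AdjoinRoot f → AdjoinRoot f → AdjoinRoot f)} (hΩ : M.basicOps ⊆ Ω)
    (g : Gal(K/RatFunc F)) : Ω := ⟨fun x _ => M.act g x, hΩ (.inr ⟨g, rfl⟩)⟩

variable (M) in
/-- The available ring operations. -/
def ringOps {Ω : Set (AdjoinRoot f → AdjoinRoot f → AdjoinRoot f)} (hΩ : M.basicOps ⊆ Ω) :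
    RingOps Ω where
  add := ⟨fun x y => x + y, hΩ (.inl (.inl rfl))⟩
  sub := ⟨fun x y => x - y, hΩ (.inl (.inr (.inl rfl)))⟩
  mul := ⟨fun x y => x * y, hΩ (.inl (.inr (.inr rfl)))⟩
  copy := M.actOp hΩ 1
  add_apply _ _ := rfl
  sub_apply _ _ := rfl
  mul_apply _ _ := rfl
  copy_apply x _ := M.act_one x

end

end GaloisModulus

end RingLPN

end

theorem mainTheorem4 :
    ∃ C : ℝ, 0 < C ∧
      ∀ (F : Type u) [Field F] [Fintype F]
        (K : Type v) [Field K] [Algebra F K] [Algebra F[X] K] [Algebra (RatFunc F) K]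
        [IsScalarTower F F[X] K] [IsScalarTower F[X] (RatFunc F) K]
        [FunctionField F K] [IsGalois (RatFunc F) K]
        (f : F[X]) [Fact (0 < f.natDegree)] (d : ℕ)
        (M : RingLPN.GaloisModulus K f d)
        (c : AdjoinRoot f) (_ : M.IsNormal c)
        (p : ℝ) (hp0 : 0 ≤ p) (hp : p < 1 / 2)
        (Ω : Set (AdjoinRoot f → AdjoinRoot f → AdjoinRoot f)) (_ : M.basicOps ⊆ Ω),
        -- a distinguisher yields an algorithm that finds every secret
        (∀ (A : RingLPN.Machine (AdjoinRoot f) Ω) (t : ℕ) (ε : ℝ),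
          A.RunsIn t → 0 < ε → ε ≤ A.advantage (M.noise c p hp0 hp) t →
          ∃ (B : RingLPN.Machine (AdjoinRoot f) Ω) (t' : ℕ),
            (t' : ℝ) ≤ C * ((f.natDegree : ℝ) ^ 4 / (d : ℝ) ^ 3 * (1 / ε ^ 2)
              * (Fintype.card F : ℝ) ^ d * t) ∧
            B.RunsIn t' ∧
            ∀ s : AdjoinRoot f,
              1 - (1 / 2 : ℝ) ^ f.natDegree ≤
                B.probOutput (RingLPN.sampleDist (M.noise c p hp0 hp) s) t' s) ∧
        -- an algorithm that finds a random secret yields a distinguisher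
        (∀ (B : RingLPN.Machine (AdjoinRoot f) Ω) (t : ℕ) (η : ℝ),
          B.RunsIn t → η ≤ B.avgProbOutput (M.noise c p hp0 hp) t (fun s => s) →
          ∃ (A : RingLPN.Machine (AdjoinRoot f) Ω) (t' : ℕ),
            (t' : ℝ) ≤ C * ((f.natDegree : ℝ) + t) ∧
            A.RunsIn t' ∧
            1 / 2 * η * (1 - p - 1 / (Fintype.card F : ℝ)) ≤
              A.advantage (M.noise c p hp0 hp) t') := by
  refine ⟨2100, by norm_num, ?_⟩
  intro F _ _ K _ _ _ _ _ _ _ _ f hf d M c hc p hp0 hp Ω hΩ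
  have hnt : Nontrivial (AdjoinRoot f) := AdjoinRoot.nontrivial f
    (natDegree_pos_iff_degree_pos.1 hf.out).ne'
  obtain ⟨k, e, hdk, he, hfield, hcard, htrans, htrace⟩ := hc.exists_idempotents
  refine ⟨fun A t ε ht hε0 hε => ?_, fun B t η ht hη => ?_⟩
  · have hd : 0 < d := Nat.pos_of_ne_zero fun h => by
      have := hf.out
      rw [← hdk, h, zero_mul] at this
      exact this.false
    have hk : 0 < k := Nat.pos_of_ne_zero fun h => by
      have := hf.out
      rw [← hdk, h, mul_zero] at this
      exact this.false
    obtain ⟨B, t', hB, hB'⟩ := RingLPN.exists_search (M.ringOps hΩ) ht hε0 hε (k := k)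
      (r := f.natDegree) hk (hdk ▸ Nat.le_mul_of_pos_left k hd)
      (Nat.one_le_pow _ _ Fintype.card_pos) he hfield hcard fun i => by
        choose g hg using htrans i
        refine ⟨fun j => M.actHom (g j)⁻¹, fun j => M.actHom (g j), fun j => M.actOp hΩ (g j)⁻¹,
          fun j => M.actOp hΩ (g j), fun _ _ _ => rfl, fun _ _ _ => rfl,
          fun j => M.actHom_bijective _, fun j x => ?_,
          fun j => RingLPN.GaloisModulus.noise_map_actHom c p hp0 hp _, ?_⟩
        · rw [M.actHom_apply, M.actHom_apply, ← M.act_mul, mul_inv_cancel, M.act_one]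
        · simp only [M.actHom_apply, hg]
          exact he.complete
    refine ⟨B, t', hB.trans_eq ?_, hB'⟩
    have hd' : (d : ℝ) ≠ 0 := by exact_mod_cast hd.ne'
    rw [← hdk]
    push_cast
    field_simp
  · have hq : (1 : ℝ) / Nat.card F ≤ 1 - p := by
      have h1 : (2 : ℝ) ≤ Nat.card F := by exact_mod_cast Finite.one_lt_card (α := F)
      have h2 : (1 : ℝ) / Nat.card F ≤ 1 / 2 := one_div_le_one_div_of_le two_pos h1
      linarith
    obtain ⟨c', hc'⟩ := htrace (hc.basis.coord 1)
    obtain ⟨A, t', hA, hA', hadv⟩ := RingLPN.exists_distinguisher (M.ringOps hΩ) ht hη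
      (hc.basis.coord 1) (fun a => ⟨a • hc.basis 1, by simp⟩)
      (fun j => M.actOp hΩ ((Finite.equivFinOfCardEq hc.card_gal).symm j))
      (fun j => M.act ((Finite.equivFinOfCardEq hc.card_gal).symm j)) (fun _ _ _ => rfl) hc' hq
      (by rw [hc.noise_map_coord, RingLPN.qBernoulli_apply_zero])
    refine ⟨A, t', ?_, hA', ?_⟩
    · calc (t' : ℝ) ≤ ((40 * (f.natDegree + t) : ℕ) : ℝ) := by exact_mod_cast hA
        _ = 40 * ((f.natDegree : ℝ) + t) := by push_cast; ring
        _ ≤ 2100 * ((f.natDegree : ℝ) + t) := by gcongr; norm_num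
    · rw [Nat.card_eq_fintype_card] at hadv
      exact hadv
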